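/- A hypergraph $\mathcal H=(V,E)$ consists of a finite nonempty set $V$ and a set $E$ of subsets of $V$ (hyperedges) such that every vertex lies in a hyperedge. Let $\Delta$ be its maximum degree (the maximum number of hyperedges containing a common vertex) and let its dimension be the maximum size of a hyperedge. Let $\mathcal H^d$ be the dual hypergraph, with vertex set $V$, whose hyperedges are the inclusion-minimal transversals of $\mathcal H$ (a transversal is a set of vertices meeting every hyperedge). Let $G=G(\mathcal H^d)$ be the graph on $V$ in which two distinct vertices are adjacent if and only if some hyperedge of $\mathcal H^d$ contains both. $\mathcal H$ is dually conformal if $\mathcal H^d$ is conformal, that is, every $U\subseteq V$ any two distinct elements of which lie in a common hyperedge of $\mathcal H^d$ is contained in a hyperedge of $\mathcal H^d$. For $v\in V$ let $\Phi_v$ be the following formula in conjunctive normal form with variables $x_u$, $u\in N_G(v)$: it has a clause $\neg x_u\vee\neg x_w$ for any two distinct nonadjacent $u,w\in N_G(v)$, and a clause $\bigvee_{u\in e\cap N_G(v)}x_u$ for each hyperedge $e\in E$ containing $v$ (an empty clause is false). Algorithms run on a unit-cost random access machine with words of $O(\log N)$ bits, where $N$ is the length of the input; the input is a list of all hyperedges,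 each given as a list of its vertices, with respect to some ordering of $V$ and of $E$. The following hold. 1. There is an algorithm running in time $O(|E||V|^2\Delta^2+|V|^3)$ that, given a hypergraph $\mathcal H$ of dimension at most $3$, tests whether $G$ contains a clique $C$ and a vertex $v\in C$ such that $|C\cap e|\ge 2$ for each hyperedge $e\in E$ containing $v$. Within this time it writes out, for every vertex $v$, the formula $\Phi_v$ as a list of at most $|V|^2+\Delta$ clauses with at most two literals each, and whether $\Phi_v$ is satisfiable. 2. For every hypergraph $\mathcal H$ of dimension at most $3$ and every $v\in V$, the formula $\Phi_v$ is an instance of 2-Satisfiability (all its clauses have at most two literals), and it is satisfiable if and only if $G$ contains a clique $C$ with $v\in C$ such that $|C\cap e|\ge 2$ for each $e\in E$ containing $v$. Moreover, $\mathcal H$ is not dually conformal if and only if $G$ contains a maximal clique that is not a transversal of $\mathcal H$, or $\Phi_v$ is satisfiable for some $v\in V$. 3. There is an algorithm running in time $O(|E||V|^2\Delta^2+|E||V|^3)$ that decides, given a hypergraph $\mathcal H$ of dimension at most $3$, whether $\mathcal H$ is dually conformal. -/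

import Mathlib

namespace DualConf

/-! ## Hypergraphs

A hypergraph is Mathlib's `Hypergraph`.  In the theorem the ground type `V` is finite and nonempty
and every `v : V` lies in a hyperedge (`Covered`), so that the vertex set is all of `V`. -/

section Hypergraphs

variable {V : Type*}

/-- Every vertex belongs to a hyperedge; in particular the vertex set is the whole type. -/
def Covered (H : Hypergraph V) : Prop := ∀ v : V, ∃ e ∈ H.edgeSet, v ∈ e

/-- The maximum size of a hyperedge. -/
noncomputable def dim (H : Hypergraph V) : ℕ := sSup (Set.ncard '' H.edgeSet)

/-- The number of hyperedges that contain `v`. -/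
noncomputable def degree (H : Hypergraph V) (v : V) : ℕ := {e ∈ H.edgeSet | v ∈ e}.ncard

/-- The maximum degree of a vertex. -/
noncomputable def maxDegree (H : Hypergraph V) : ℕ := sSup (Set.range (degree H))

/-- A set of vertices that intersects all hyperedges. -/
def IsTransversal (H : Hypergraph V) (T : Set V) : Prop :=
  T ⊆ H.vertexSet ∧ ∀ e ∈ H.edgeSet, (T ∩ e).Nonempty

/-- The dual hypergraph: same vertices, hyperedges are the minimal transversals. -/
def dual (H : Hypergraph V) : Hypergraph V where
  vertexSet := H.vertexSet
  edgeSet := {T | Minimal (IsTransversal H) T}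
  subset_vertexSet_of_mem_edgeSet' := fun _ hT => hT.prop.1

/-- The co-occurrence graph: distinct vertices are adjacent if some hyperedge contains both. -/
def coGraph (H : Hypergraph V) : SimpleGraph V where
  Adj u v := u ≠ v ∧ ∃ e ∈ H.edgeSet, u ∈ e ∧ v ∈ e
  symm := ⟨fun _ _ h => ⟨h.1.symm, h.2.imp fun _ he => ⟨he.1, he.2.2, he.2.1⟩⟩⟩
  loopless := ⟨fun _ h => h.1 rfl⟩

/-- Every set of vertices in which each pair of distinct vertices is contained in some hyperedge is
itself contained in some hyperedge. -/
def Conformal (H : Hypergraph V) : Prop :=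
  ∀ U : Set V, U ⊆ H.vertexSet →
    (∀ u ∈ U, ∀ w ∈ U, u ≠ w → ∃ e ∈ H.edgeSet, u ∈ e ∧ w ∈ e) → ∃ e ∈ H.edgeSet, U ⊆ e

/-- The dual hypergraph is conformal. -/
def DuallyConformal (H : Hypergraph V) : Prop := Conformal (dual H)

/-- Some clique `C` of `G(H^d)` contains `v` and meets every hyperedge through `v` in at least two
vertices. -/
def HasCliqueAt (H : Hypergraph V) (v : V) : Prop :=
  ∃ C : Set V, (coGraph (dual H)).IsClique C ∧ v ∈ C ∧
    ∀ e ∈ H.edgeSet, v ∈ e → 2 ≤ (C ∩ e).ncard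

end Hypergraphs

/-! ## Satisfiability

The literal `(x, true)` is the variable `x`, and `(x, false)` is its negation.  A clause is the set
of its literals (a disjunction), a formula is the set of its clauses (a conjunction). -/

section Satisfiability

variable {V : Type*}

/-- Some truth assignment makes at least one literal of every clause true. -/
def Satisfiable (Φ : Set (Set (V × Bool))) : Prop :=
  ∃ a : V → Bool, ∀ c ∈ Φ, ∃ l ∈ c, a l.1 = l.2

/-- The formula attached to the vertex `v`, with `G = G(H^d)`.  Its variables are the neighbours of
`v` in `G`.  It has a clause `¬u ∨ ¬w` for any two distinct nonadjacent neighbours `u`, `w` of `v`,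
and, for every hyperedge `e` through `v`, the disjunction of all `u ∈ e ∩ N_G(v)`. -/
def vertexFormula (H : Hypergraph V) (v : V) : Set (Set (V × Bool)) :=
  {c | ∃ u w : V, (coGraph (dual H)).Adj v u ∧ (coGraph (dual H)).Adj v w ∧ u ≠ w ∧
      ¬ (coGraph (dual H)).Adj u w ∧ c = {(u, false), (w, false)}} ∪
  {c | ∃ e ∈ H.edgeSet, v ∈ e ∧
      c = {l | l.2 = true ∧ l.1 ∈ e ∧ (coGraph (dual H)).Adj v l.1}}

/-- `φ`, a list of clauses over the variables `0, …, n - 1`, lists exactly the clauses of the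
formula `Φ`, where the variable number `i` stands for `vert i`. -/
def ListsFormula {n : ℕ} (vert : Fin n ≃ V) (φ : List (List (Fin n × Bool)))
    (Φ : Set (Set (V × Bool))) : Prop :=
  {c | ∃ d ∈ φ, c = {l | ∃ x ∈ d, l = (vert x.1, x.2)}} = Φ

/-- The code of a literal: `2 i + 2` for the variable `i`, and `2 i + 3` for its negation. -/
def encodeLiteral {n : ℕ} (l : Fin n × Bool) : ℕ := 2 * l.1.val + if l.2 then 2 else 3

/-- The code of a formula: every clause is the sequence of its literals, closed by a `0`; the
formula is closed by a `1`. -/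
def encodeFormula {n : ℕ} (φ : List (List (Fin n × Bool))) : List ℕ :=
  (φ.flatMap fun c => c.map encodeLiteral ++ [0]) ++ [1]

end Satisfiability

/-! ## Input -/

/-- A presentation of the hypergraph `H`: its vertices in some order, and a complete list of its
hyperedges without repetition, each of them given as a list of its vertices without repetition. -/
structure Listing {V : Type*} (H : Hypergraph V) where
  /-- the number of vertices -/
  n : ℕ
  /-- the order of the vertices -/
  vert : Fin n ≃ V
  /-- the hyperedges, as lists of positions of vertices -/
  edges : List (List (Fin n))
  nodup_vertices : ∀ l ∈ edges, l.Nodup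
  nodup_edges : (edges.map fun l => {v | ∃ i ∈ l, vert i = v}).Nodup
  complete : ∀ e : Set V, e ∈ H.edgeSet ↔ ∃ l ∈ edges, e = {v | ∃ i ∈ l, vert i = v}

/-- The input word: number of vertices, number of hyperedges, and then, for each hyperedge, its size
followed by its vertices. -/
def Listing.input {V : Type*} {H : Hypergraph V} (L : Listing H) : List ℕ :=
  L.n :: L.edges.length :: L.edges.flatMap fun l => l.length :: l.map Fin.val

/-! ## Random access machine

A structured program for a unit-cost word RAM: finitely many registers, an addressable memory and a
write-only output tape.  A machine word holds a number below `W`; an operation with a result of `W`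
or more cannot be carried out (there is then no execution). -/

/-- Registers, memory, and what has been written to the output tape so far. -/
structure State where
  reg : ℕ → ℕ
  mem : ℕ → ℕ
  out : List ℕ

/-- Initial state: the input is in the memory cells `0, 1, 2, …`, everything else is `0`. -/
def State.init (input : List ℕ) : State where
  reg := fun _ => 0
  mem := fun i => input.getD i 0
  out := []

/-- Arithmetical expressions; `load a` reads the memory cell with address `a`. -/
inductive Expr where
  | const (k : ℕ)
  | reg (r : ℕ)
  | load (a : Expr)
  | add (a b : Expr)
  | sub (a b : Expr)
  | mul (a b : Expr)

/-- The value of an expression; subtraction is truncated at `0`. -/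
def Expr.eval (s : State) : Expr → ℕ
  | .const k => k
  | .reg r => s.reg r
  | .load a => s.mem (a.eval s)
  | .add a b => a.eval s + b.eval s
  | .sub a b => a.eval s - b.eval s
  | .mul a b => a.eval s * b.eval s

/-- The number of elementary operations in an expression. -/
def Expr.cost : Expr → ℕ
  | .const _ => 1
  | .reg _ => 1
  | .load a => a.cost + 1
  | .add a b => a.cost + b.cost + 1
  | .sub a b => a.cost + b.cost + 1
  | .mul a b => a.cost + b.cost + 1

/-- All intermediate results fit into a machine word. -/
def Expr.Fits (W : ℕ) (s : State) : Expr → Prop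
  | .const k => k < W
  | .reg r => s.reg r < W
  | .load a => a.Fits W s ∧ s.mem (a.eval s) < W
  | .add a b => a.Fits W s ∧ b.Fits W s ∧ a.eval s + b.eval s < W
  | .sub a b => a.Fits W s ∧ b.Fits W s
  | .mul a b => a.Fits W s ∧ b.Fits W s ∧ a.eval s * b.eval s < W

/-- Programs.  `store a e` writes `e` to the memory cell `a`; `emit e` appends `e` to the output
tape; `ite a b c d` runs `c` if `a < b` and `d` otherwise; `while a b c` repeats `c` as long as
`a < b`. -/
inductive Cmd where
  | skip
  | assign (r : ℕ) (e : Expr)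
  | store (a e : Expr)
  | emit (e : Expr)
  | seq (c d : Cmd)
  | ite (a b : Expr) (c d : Cmd)
  | while (a b : Expr) (c : Cmd)

/-- `Exec W c s t s'`: with word bound `W`, the program `c`, started in state `s`, halts after `t`
steps in state `s'`. -/
inductive Exec (W : ℕ) : Cmd → State → ℕ → State → Prop where
  | skip (s : State) : Exec W .skip s 1 s
  | assign (r : ℕ) (e : Expr) (s : State) (he : e.Fits W s) :
      Exec W (.assign r e) s (e.cost + 1) { s with reg := Function.update s.reg r (e.eval s) }
  | store (a e : Expr) (s : State) (ha : a.Fits W s) (he : e.Fits W s) :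
      Exec W (.store a e) s (a.cost + e.cost + 1)
        { s with mem := Function.update s.mem (a.eval s) (e.eval s) }
  | emit (e : Expr) (s : State) (he : e.Fits W s) :
      Exec W (.emit e) s (e.cost + 1) { s with out := s.out ++ [e.eval s] }
  | seq {c d : Cmd} {s s' s'' : State} {t t' : ℕ} (hc : Exec W c s t s') (hd : Exec W d s' t' s'') :
      Exec W (.seq c d) s (t + t') s''
  | ite_true {a b : Expr} {c d : Cmd} {s s' : State} {t : ℕ} (ha : a.Fits W s) (hb : b.Fits W s)
      (h : a.eval s < b.eval s) (hc : Exec W c s t s') :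
      Exec W (.ite a b c d) s (a.cost + b.cost + 1 + t) s'
  | ite_false {a b : Expr} {c d : Cmd} {s s' : State} {t : ℕ} (ha : a.Fits W s) (hb : b.Fits W s)
      (h : ¬ a.eval s < b.eval s) (hd : Exec W d s t s') :
      Exec W (.ite a b c d) s (a.cost + b.cost + 1 + t) s'
  | while_true {a b : Expr} {c : Cmd} {s s' s'' : State} {t t' : ℕ} (ha : a.Fits W s)
      (hb : b.Fits W s) (h : a.eval s < b.eval s) (hc : Exec W c s t s')
      (hw : Exec W (.while a b c) s' t' s'') :
      Exec W (.while a b c) s (a.cost + b.cost + 1 + t + t') s''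
  | while_false {a b : Expr} {c : Cmd} {s : State} (ha : a.Fits W s) (hb : b.Fits W s)
      (h : ¬ a.eval s < b.eval s) :
      Exec W (.while a b c) s (a.cost + b.cost + 1) s

/-- The final state answers the question `p`: register `0` holds `1` for yes and `0` for no. -/
def State.Answers (s : State) (p : Prop) : Prop := (p → s.reg 0 = 1) ∧ (¬ p → s.reg 0 = 0)

end DualConf

/-! Adjacency in `G` has a local description (`coGraph_dual_adj`): `u` and `w` lie in a common
minimal transversal iff there are hyperedges `e ∋ u` and `f ∋ w`, with `u ∉ f` and `w ∉ e`, such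
that no hyperedge lies inside `(e ∪ f) \ {u, w}`. In dimension 3, scanning all triples of hyperedges
therefore computes `G` in time `O(|E|^3)`. Since `|E| ≤ |V|Δ + 1`, this is `O(|E||V|^2Δ^2)`.

Dual conformality says that every clique of `G` lies in a minimal transversal
(`not_duallyConformal_iff_hasCliqueAt`). If it fails, some maximal clique is not a minimal
transversal. Either it is not a transversal, or it contains a smaller transversal that misses a
vertex `v` of the clique; then every hyperedge through `v` meets the clique a second time.
Conversely, a minimal transversal meets some hyperedge in `v` alone, which rules out the second case
for cliques inside it. The second case at `v` is the satisfiability of `Φ_v`: the true variables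
together with `v` form the clique. The clause of a hyperedge omits `v`, hence has at most two
literals.

Satisfiability is decided as a binary constraint problem. Each hyperedge through `v` offers its
other vertices as two options, and one must choose pairwise equal or adjacent options that are also
compatible with `v`. Rows are eliminated one after another. Two later options stay compatible iff
one option of the eliminated row fits both. This loses nothing because there are only two options:
if the first conflicts with a chosen `p` and the second with a chosen `q`, then already the pair
`p`, `q` is rejected (`hasChoice_elim`). The cost is `O(Δ^3)` per vertex, in addition to `O(|V|^2 +
|E|)` for writing the clauses.

A maximal clique misses `e` iff some clique has, for each `a ∈ e`, a member neither equal nor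
adjacent to `a`. Three members suffice when `|e| ≤ 3`, so a search over `|E||V|^3` candidates
settles the remaining case (`avoids_iff`).

The machine part is a Hoare calculus `Ter` with time bounds. Registers and cells stay below `Y =
N^3`, and expressions have bounded size, so all intermediate values stay below a fixed power of `N`.
Rows of the hyperedge table are padded to length three with the non-vertex `n`, which is related to
nothing. -/

namespace DualConf

/-! ## Running programs within a word and time bound -/

section Machine

/-- The largest constant in an expression. -/
def Expr.maxConst : Expr → ℕ
  | .const k => k
  | .reg _ => 0
  | .load a => a.maxConst
  | .add a b => max a.maxConst b.maxConst
  | .sub a b => max a.maxConst b.maxConst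
  | .mul a b => max a.maxConst b.maxConst

/-- A uniform bound on the size of the expressions in the programs below. -/
def exprBound : ℕ := 5000

/-- Expressions of bounded size with bounded constants. -/
def Expr.Good (e : Expr) : Prop := e.cost ≤ exprBound ∧ e.maxConst ≤ 10

instance (e : Expr) : Decidable e.Good := inferInstanceAs (Decidable (_ ∧ _))

/-- All registers and memory cells hold numbers up to `Y`. -/
structure Bdd (Y : ℕ) (s : State) : Prop where
  ten : 10 ≤ Y
  reg : ∀ r, s.reg r ≤ Y
  mem : ∀ a, s.mem a ≤ Y

variable {Y : ℕ} {s s' : State} {Q Q' : State → Prop} {T T' : ℕ}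

theorem Expr.cost_pos (e : Expr) : 1 ≤ e.cost := by
  cases e <;> simp [Expr.cost]

/-- Each operation adds at least one to the exponent, which absorbs even the factor 2 from a sum; a
loaded value is at most `Y` whatever its address. -/
theorem Expr.eval_le (hb : Bdd Y s) (e : Expr) (hc : e.maxConst ≤ 10) :
    e.eval s ≤ Y ^ e.cost := by
  have h10 := hb.ten
  have hY : 1 ≤ Y := by omega
  induction e with
  | const k => simpa [Expr.eval, Expr.cost, Expr.maxConst] using le_trans hc h10
  | reg r => simpa [Expr.eval, Expr.cost] using hb.reg r
  | load a => exact (hb.mem _).trans (Nat.le_self_pow (by simp [Expr.cost]) _)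
  | add a b iha ihb =>
    simp only [Expr.maxConst, max_le_iff] at hc
    have h1 : Y ^ a.cost ≤ Y ^ (a.cost + b.cost) := Nat.pow_le_pow_right hY (by omega)
    have h2 : Y ^ b.cost ≤ Y ^ (a.cost + b.cost) := Nat.pow_le_pow_right hY (by omega)
    have := iha hc.1
    have := ihb hc.2
    simp only [Expr.eval, Expr.cost, pow_succ]
    nlinarith
  | sub a b iha ihb =>
    simp only [Expr.maxConst, max_le_iff] at hc
    refine (Nat.sub_le _ _).trans ((iha hc.1).trans (Nat.pow_le_pow_right hY ?_))
    simp only [Expr.cost]; omega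
  | mul a b iha ihb =>
    simp only [Expr.maxConst, max_le_iff] at hc
    refine (Nat.mul_le_mul (iha hc.1) (ihb hc.2)).trans ?_
    rw [← pow_add]
    exact Nat.pow_le_pow_right hY (by simp [Expr.cost])

/-- The bound `k` is kept apart from the cost of `e` so that the same word size serves all
subexpressions in the induction. -/
theorem Expr.fits_of_cost_le (hb : Bdd Y s) (e : Expr) {k : ℕ} (hk : e.cost ≤ k)
    (hc : e.maxConst ≤ 10) : e.Fits (Y ^ (k + 1)) s := by
  have h10 := hb.ten
  have key : ∀ e : Expr, e.cost ≤ k → e.maxConst ≤ 10 → e.eval s < Y ^ (k + 1) :=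
    fun e hk hc => (e.eval_le hb hc).trans_lt (Nat.pow_lt_pow_right (by omega) (by omega))
  have h1 := key e hk hc
  have hY : Y < Y ^ (k + 1) := by
    have := e.cost_pos
    exact lt_self_pow₀ (by omega) (by omega)
  induction e with
  | const j => exact h1
  | reg r => exact h1
  | load a iha =>
    simp only [Expr.cost] at hk
    exact ⟨iha (by omega) hc (key a (by omega) hc), (hb.mem _).trans_lt hY⟩
  | add a b iha ihb =>
    simp only [Expr.maxConst, max_le_iff] at hc
    simp only [Expr.cost] at hk
    exact ⟨iha (by omega) hc.1 (key a (by omega) hc.1),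
      ihb (by omega) hc.2 (key b (by omega) hc.2), h1⟩
  | sub a b iha ihb =>
    simp only [Expr.maxConst, max_le_iff] at hc
    simp only [Expr.cost] at hk
    exact ⟨iha (by omega) hc.1 (key a (by omega) hc.1),
      ihb (by omega) hc.2 (key b (by omega) hc.2)⟩
  | mul a b iha ihb =>
    simp only [Expr.maxConst, max_le_iff] at hc
    simp only [Expr.cost] at hk
    exact ⟨iha (by omega) hc.1 (key a (by omega) hc.1),
      ihb (by omega) hc.2 (key b (by omega) hc.2), h1⟩

theorem Expr.Good.fits {e : Expr} (he : e.Good) (hb : Bdd Y s) :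
    e.Fits (Y ^ (exprBound + 1)) s :=
  e.fits_of_cost_le hb he.1 he.2

/-! ### What a program leaves unchanged -/

/-- The registers that a program may write. -/
def Cmd.writes : Cmd → ℕ → Bool
  | .skip, _ => false
  | .assign r _, q => q == r
  | .store _ _, _ => false
  | .emit _, _ => false
  | .seq c d, q => c.writes q || d.writes q
  | .ite _ _ c d, q => c.writes q || d.writes q
  | .while _ _ c, q => c.writes q

/-- Whether a program contains a `store`. -/
def Cmd.stores : Cmd → Bool
  | .skip => false
  | .assign _ _ => false
  | .store _ _ => true
  | .emit _ => false
  | .seq c d => c.stores || d.stores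
  | .ite _ _ c d => c.stores || d.stores
  | .while _ _ c => c.stores

/-- Whether a program contains an `emit`. -/
def Cmd.emits : Cmd → Bool
  | .skip => false
  | .assign _ _ => false
  | .store _ _ => false
  | .emit _ => true
  | .seq c d => c.emits || d.emits
  | .ite _ _ c d => c.emits || d.emits
  | .while _ _ c => c.emits

/-- `s'` differs from `s` only where the program `c` may make a change. -/
structure Frame (c : Cmd) (s s' : State) : Prop where
  reg : ∀ q, c.writes q = false → s'.reg q = s.reg q
  mem : c.stores = false → s'.mem = s.mem
  out : c.emits = false → s'.out = s.out

theorem Frame.refl (c : Cmd) (s : State) : Frame c s s := ⟨fun _ _ => rfl, fun _ => rfl, fun _ => rfl⟩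

theorem Frame.trans {c : Cmd} {s₁ s₂ s₃ : State} (h : Frame c s₁ s₂) (h' : Frame c s₂ s₃) :
    Frame c s₁ s₃ :=
  ⟨fun q hq => (h'.reg q hq).trans (h.reg q hq), fun hq => (h'.mem hq).trans (h.mem hq),
    fun hq => (h'.out hq).trans (h.out hq)⟩

theorem Frame.mono {c d : Cmd} (h : Frame c s s') (h1 : ∀ q, d.writes q = false → c.writes q = false)
    (h2 : d.stores = false → c.stores = false) (h3 : d.emits = false → c.emits = false) :
    Frame d s s' :=
  ⟨fun q hq => h.reg q (h1 q hq), fun hq => h.mem (h2 hq), fun hq => h.out (h3 hq)⟩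

/-- Preservation of registers, memory and output becomes a computation on the program text, to be
settled by `decide`. -/
theorem Exec.frame {W : ℕ} {c : Cmd} {t : ℕ} (h : Exec W c s t s') : Frame c s s' := by
  induction h with
  | skip s => exact .refl _ _
  | assign r e s he =>
    refine ⟨fun q hq => ?_, fun _ => rfl, fun _ => rfl⟩
    simp only [Cmd.writes, beq_eq_false_iff_ne] at hq
    simp [Function.update_of_ne hq]
  | store a e s ha he => exact ⟨fun _ _ => rfl, fun h => by simp [Cmd.stores] at h, fun _ => rfl⟩
  | emit e s he => exact ⟨fun _ _ => rfl, fun _ => rfl, fun h => by simp [Cmd.emits] at h⟩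
  | seq hc hd ihc ihd =>
    exact (ihc.mono (by simp +contextual [Cmd.writes]) (by simp +contextual [Cmd.stores])
      (by simp +contextual [Cmd.emits])).trans (ihd.mono (by simp +contextual [Cmd.writes])
      (by simp +contextual [Cmd.stores]) (by simp +contextual [Cmd.emits]))
  | ite_true ha hb h hc ih =>
    exact ih.mono (by simp +contextual [Cmd.writes]) (by simp +contextual [Cmd.stores])
      (by simp +contextual [Cmd.emits])
  | ite_false ha hb h hc ih =>
    exact ih.mono (by simp +contextual [Cmd.writes]) (by simp +contextual [Cmd.stores])
      (by simp +contextual [Cmd.emits])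
  | while_true ha hb h hc hw ih ihw =>
    exact (ih.mono (by simp [Cmd.writes]) (by simp [Cmd.stores]) (by simp [Cmd.emits])).trans ihw
  | while_false ha hb h => exact .refl _ _

/-- The state after an assignment to a register. -/
def State.setReg (s : State) (r x : ℕ) : State := { s with reg := Function.update s.reg r x }

/-- The state after an assignment to a memory cell. -/
def State.setMem (s : State) (a x : ℕ) : State := { s with mem := Function.update s.mem a x }

/-- The state after an output. -/
def State.addOut (s : State) (x : ℕ) : State := { s with out := s.out ++ [x] }

@[simp] theorem State.setReg_reg (s : State) (r x q : ℕ) :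
    (s.setReg r x).reg q = if q = r then x else s.reg q := by
  simp [State.setReg, Function.update_apply]
@[simp] theorem State.setReg_mem (s : State) (r x : ℕ) : (s.setReg r x).mem = s.mem := rfl
@[simp] theorem State.setReg_out (s : State) (r x : ℕ) : (s.setReg r x).out = s.out := rfl
@[simp] theorem State.setMem_reg (s : State) (a x : ℕ) : (s.setMem a x).reg = s.reg := rfl
@[simp] theorem State.setMem_mem (s : State) (a x : ℕ) :
    (s.setMem a x).mem = Function.update s.mem a x := rfl
@[simp] theorem State.addOut_reg (s : State) (x : ℕ) : (s.addOut x).reg = s.reg := rfl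
@[simp] theorem State.addOut_mem (s : State) (x : ℕ) : (s.addOut x).mem = s.mem := rfl
@[simp] theorem State.addOut_out (s : State) (x : ℕ) : (s.addOut x).out = s.out ++ [x] := rfl

theorem Bdd.setReg (hb : Bdd Y s) (r : ℕ) {x : ℕ} (hx : x ≤ Y) : Bdd Y (s.setReg r x) :=
  ⟨hb.ten, fun q => by rw [State.setReg_reg]; split_ifs; exacts [hx, hb.reg q], hb.mem⟩

theorem Bdd.setMem (hb : Bdd Y s) (a : ℕ) {x : ℕ} (hx : x ≤ Y) : Bdd Y (s.setMem a x) :=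
  ⟨hb.ten, hb.reg, fun q => by
    rw [State.setMem_mem, Function.update_apply]; split_ifs; exacts [hx, hb.mem q]⟩

theorem Bdd.addOut (hb : Bdd Y s) (x : ℕ) : Bdd Y (s.addOut x) := ⟨hb.ten, hb.reg, hb.mem⟩

/-! ### Total correctness with time bounds -/

/-- The time for one elementary command or test. -/
def unitTime : ℕ := 2 * exprBound + 1

/-- Started in `s`, the program `c` halts within `T` time units in a bounded state with `Q`. -/
def Ter (Y : ℕ) (c : Cmd) (s : State) (T : ℕ) (Q : State → Prop) : Prop :=
  ∃ t s', Exec (Y ^ (exprBound + 1)) c s t s' ∧ t ≤ unitTime * T ∧ Bdd Y s' ∧ Q s'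

/-- The new postcondition may use boundedness and the frame, so that loop bodies need not restate
what they do not touch. -/
theorem Ter.mono {c : Cmd} (h : Ter Y c s T Q) (hT : T ≤ T')
    (hQ : ∀ s', Bdd Y s' → Frame c s s' → Q s' → Q' s') : Ter Y c s T' Q' := by
  obtain ⟨t, s', h1, h2, h3, h4⟩ := h
  exact ⟨t, s', h1, h2.trans (Nat.mul_le_mul_left _ hT), h3, hQ _ h3 h1.frame h4⟩

theorem Ter.assign {r : ℕ} {e : Expr} (he : e.Good) (hb : Bdd Y s) (hY : e.eval s ≤ Y)
    (hQ : Q (s.setReg r (e.eval s))) : Ter Y (.assign r e) s 1 Q := by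
  refine ⟨_, _, .assign r e s (he.fits hb), ?_, hb.setReg r hY, hQ⟩
  have := he.1
  simp only [unitTime]; omega

theorem Ter.store {a e : Expr} (ha : a.Good) (he : e.Good) (hb : Bdd Y s) (hY : e.eval s ≤ Y)
    (hQ : Q (s.setMem (a.eval s) (e.eval s))) : Ter Y (.store a e) s 1 Q := by
  refine ⟨_, _, .store a e s (ha.fits hb) (he.fits hb), ?_, hb.setMem _ hY, hQ⟩
  have := he.1
  have := ha.1
  simp only [unitTime]; omega

theorem Ter.emit {e : Expr} (he : e.Good) (hb : Bdd Y s)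
    (hQ : Q (s.addOut (e.eval s))) : Ter Y (.emit e) s 1 Q := by
  refine ⟨_, _, .emit e s (he.fits hb), ?_, hb.addOut _, hQ⟩
  have := he.1
  simp only [unitTime]; omega

/-- The postcondition of the first command is the triple for the second one, so a proof runs forward
through the program without stating intermediate assertions. -/
theorem Ter.seq {c d : Cmd} {T₁ T₂ : ℕ}
    (h : Ter Y c s T₁ (fun s' => Bdd Y s' → Frame c s s' → Ter Y d s' T₂ Q)) :
    Ter Y (.seq c d) s (T₁ + T₂) Q := by
  obtain ⟨t, s', h1, h2, h3, h4⟩ := h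
  obtain ⟨t', s'', h5, h6, h7, h8⟩ := h4 h3 h1.frame
  exact ⟨_, _, .seq h1 h5, by rw [mul_add]; omega, h7, h8⟩

/-- Run `c` if `e` is nonzero. -/
def Cmd.when (e : Expr) (c : Cmd) : Cmd := .ite (.const 0) e c .skip

/-- `1 ≤ T` pays for the `skip` of the branch not taken. -/
theorem Ter.when {e : Expr} {c : Cmd} (hT : 1 ≤ T) (he : e.Good) (hb : Bdd Y s)
    (h1 : 0 < e.eval s → Ter Y c s T Q) (h0 : e.eval s = 0 → Q s) :
    Ter Y (.when e c) s (T + 1) Q := by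
  have hk : (Expr.const 0).Good := ⟨by simp [Expr.cost, exprBound], by simp [Expr.maxConst]⟩
  by_cases h : 0 < e.eval s
  · obtain ⟨t, s', h2, h3, h4, h5⟩ := h1 h
    refine ⟨_, s', .ite_true (hk.fits hb) (he.fits hb) h h2, ?_, h4, h5⟩
    have := he.1
    have := hk.1
    rw [mul_add, mul_one]
    simp only [unitTime] at *; omega
  · refine ⟨_, s, .ite_false (hk.fits hb) (he.fits hb) h (.skip s), ?_, hb, h0 (by omega)⟩
    have := he.1
    have := hk.1
    have : unitTime * 1 ≤ unitTime * T := Nat.mul_le_mul_left _ hT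
    rw [mul_add, mul_one]
    simp only [unitTime] at *; omega

/-- Run `c` for `r = 0, 1, …, b - 1`. -/
def Cmd.forTo (r : ℕ) (b : Expr) (c : Cmd) : Cmd :=
  .seq (.assign r (.const 0))
    (.while (.reg r) b (.seq c (.assign r (.add (.reg r) (.const 1)))))

/-- Each round pays for the body, the test and the increment; the initial 2 pays for the first
assignment and the last test. The bound must keep its value `k` in every state that the loop can
reach. -/
theorem Ter.forTo {r : ℕ} {b : Expr} {c : Cmd} {k : ℕ} (I : ℕ → State → Prop)
    (hbG : b.Good) (hw : c.writes r = false) (hb : Bdd Y s) (hk : k ≤ Y)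
    (hbk : ∀ s', Frame (.forTo r b c) s s' → b.eval s' = k)
    (h0 : I 0 (s.setReg r 0))
    (hstep : ∀ i s', i < k → Bdd Y s' → Frame (.forTo r b c) s s' → s'.reg r = i → I i s' →
      Ter Y c s' T (fun s'' => Bdd Y s'' → Frame c s' s'' → I (i + 1) (s''.setReg r (i + 1))))
    (hQ : ∀ s', Frame (.forTo r b c) s s' → I k s' → Q s') :
    Ter Y (.forTo r b c) s (2 + k * (T + 2)) Q := by
  have hr : (Expr.reg r).Good := ⟨by simp [Expr.cost, exprBound], by simp [Expr.maxConst]⟩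
  have hr1 : (Expr.add (.reg r) (.const 1)).Good :=
    ⟨by simp [Expr.cost, exprBound], by simp [Expr.maxConst]⟩
  have hk0 : (Expr.const 0).Good := ⟨by simp [Expr.cost, exprBound], by simp [Expr.maxConst]⟩
  have hfor : ∀ {c' : Cmd} {s₁ s₂ : State}, Frame c' s₁ s₂ → (c' = c ∨
      c' = .seq c (.assign r (.add (.reg r) (.const 1))) ∨ c' = .assign r (.const 0)) →
      Frame (.forTo r b c) s₁ s₂ := by
    rintro c' s₁ s₂ h (rfl | rfl | rfl) <;>
    exact h.mono (by simp +contextual [Cmd.writes, Cmd.forTo])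
      (by simp +contextual [Cmd.stores, Cmd.forTo]) (by simp +contextual [Cmd.emits, Cmd.forTo])
  -- Induction on the number `j` of rounds still to come.
  have loop : ∀ j i s', i + j = k → Bdd Y s' → Frame (.forTo r b c) s s' → s'.reg r = i → I i s' →
      Ter Y (.while (.reg r) b (.seq c (.assign r (.add (.reg r) (.const 1))))) s'
        (1 + j * (T + 2)) Q := by
    intro j
    induction j with
    | zero =>
      intro i s' hi hb' hF hri hI
      have hbe := hbk s' hF
      refine ⟨_, s', .while_false (hr.fits hb') (hbG.fits hb') ?_, ?_, hb', hQ s' hF ?_⟩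
      · simp only [Expr.eval]; omega
      · have := hbG.1
        have := hr.1
        simp only [unitTime]; omega
      · rwa [show k = i by omega]
    | succ j ih =>
      intro i s' hi hb' hF hri hI
      have hbe := hbk s' hF
      have h1 : Ter Y (.seq c (.assign r (.add (.reg r) (.const 1)))) s' (T + 1)
          (fun s'' => Frame (.forTo r b c) s s'' ∧ s''.reg r = i + 1 ∧ I (i + 1) s'') := by
        refine Ter.seq ((hstep i s' (by omega) hb' hF hri hI).mono le_rfl ?_)
        intro s₁ hb₁ hF₁ hI₁ _ _
        have hr₁ : s₁.reg r = i := (hF₁.reg r hw).trans hri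
        refine Ter.assign hr1 hb₁ ?_ ⟨?_, ?_, ?_⟩
        · simp only [Expr.eval]; omega
        · refine (hF.trans (hfor hF₁ (by simp))).trans (Frame.mk ?_ ?_ ?_)
          · intro q hq
            simp only [Cmd.writes, Cmd.forTo, Bool.or_eq_false_iff, beq_eq_false_iff_ne] at hq
            simp [hq.1]
          · simp
          · simp
        · simp [Expr.eval, hr₁]
        · simpa [Expr.eval, hr₁] using hI₁ hb₁ hF₁
      obtain ⟨t, s'', h2, h3, h4, h5, h6, h7⟩ := h1
      obtain ⟨t', s₃, h8, h9, h10, h11⟩ := ih (i + 1) s'' (by omega) h4 h5 h6 h7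
      refine ⟨_, s₃, .while_true (hr.fits hb') (hbG.fits hb') ?_ h2 h8, ?_, h10, h11⟩
      · simp only [Expr.eval]; omega
      · have := hbG.1
        have := hr.1
        have h12 : unitTime * (1 + (j + 1) * (T + 2)) =
          unitTime * (1 + j * (T + 2)) + unitTime * (T + 1) + unitTime := by ring
        rw [h12]
        have : (Expr.reg r).cost + b.cost + 1 ≤ unitTime := by simp only [unitTime]; omega
        omega
  have := Ter.seq (Y := Y) (s := s) (c := .assign r (.const 0)) (T₁ := 1) (T₂ := 1 + k * (T + 2))
    (d := .while (.reg r) b (.seq c (.assign r (.add (.reg r) (.const 1))))) (Q := Q)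
    (Ter.assign hk0 hb (by simp [Expr.eval]) ?_)
  · refine this.mono (by omega) (fun _ _ _ h => h)
  · intro hb' hF
    exact loop k 0 _ (by omega) hb' (hfor hF (by simp)) (by simp [Expr.eval]) h0

end Machine

/-! ## Truth values, arrays, and the layout of the memory -/

section Layout

open Classical in
/-- The truth value of `p` as a number. -/
noncomputable def ind (p : Prop) : ℕ := if p then 1 else 0

variable {p q : Prop}

theorem ind_le_one : ind p ≤ 1 := by unfold ind; split_ifs <;> simp
@[simp] theorem ind_pos : 0 < ind p ↔ p := by unfold ind; split_ifs <;> simp_all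
@[simp] theorem ind_eq_zero : ind p = 0 ↔ ¬ p := by unfold ind; split_ifs <;> simp_all
theorem ind_of (h : p) : ind p = 1 := by simp [ind, h]
theorem ind_not_of (h : ¬ p) : ind p = 0 := by simp [ind, h]
@[simp] theorem ind_mul : ind p * ind q = ind (p ∧ q) := by
  unfold ind; split_ifs <;> simp_all
@[simp] theorem one_sub_ind : 1 - ind p = ind (¬ p) := by
  unfold ind; split_ifs <;> simp_all
theorem ind_congr (h : p ↔ q) : ind p = ind q := by rw [h]

namespace Expr

variable (a b c : Expr) (s : State)

/-- Equality test. -/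
def eq : Expr := .sub (.const 1) (.add (.sub a b) (.sub b a))
/-- Comparison test. -/
def lt : Expr := .sub (.const 1) (.sub (.const 1) (.sub b a))
/-- Negation. -/
def not : Expr := .sub (.const 1) a
/-- Conjunction. -/
def and : Expr := .mul a b
/-- Disjunction. -/
def or : Expr := (a.not.and b.not).not
/-- The expression `b` if `a` is true, and `c` otherwise. -/
def cond : Expr := .add (.mul a b) (.mul a.not c)

@[simp] theorem eval_const (k : ℕ) : (const k).eval s = k := rfl
@[simp] theorem eval_reg (r : ℕ) : (reg r).eval s = s.reg r := rfl
@[simp] theorem eval_load : (load a).eval s = s.mem (a.eval s) := rfl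
@[simp] theorem eval_add : (add a b).eval s = a.eval s + b.eval s := rfl
@[simp] theorem eval_sub : (sub a b).eval s = a.eval s - b.eval s := rfl
@[simp] theorem eval_mul : (mul a b).eval s = a.eval s * b.eval s := rfl
-- With truncated subtraction, `(a - b) + (b - a)` is the distance of `a` and `b`.
@[simp] theorem eval_eq : (a.eq b).eval s = ind (a.eval s = b.eval s) := by
  simp only [eq, eval_sub, eval_const, eval_add, ind]
  split_ifs <;> omega
@[simp] theorem eval_lt : (a.lt b).eval s = ind (a.eval s < b.eval s) := by
  simp only [lt, eval_sub, eval_const, ind]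
  split_ifs <;> omega
@[simp] theorem eval_not : a.not.eval s = 1 - a.eval s := rfl
@[simp] theorem eval_and : (a.and b).eval s = a.eval s * b.eval s := rfl

variable {a b c s}

/-- The arithmetic computes a disjunction only for operands 0 and 1, hence the two hypotheses. -/
theorem eval_or (ha : a.eval s = ind p) (hb : b.eval s = ind q) : (a.or b).eval s = ind (p ∨ q) := by
  simp only [or, eval_not, eval_and, ha, hb, one_sub_ind, ind_mul]
  exact ind_congr (by tauto)

-- Both branches are evaluated, and the rejected one is multiplied by 0. It may read a meaningless
-- cell, but its value must fit into a word.
open Classical in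
theorem eval_cond (ha : a.eval s = ind p) :
    (cond a b c).eval s = if p then b.eval s else c.eval s := by
  simp only [cond, eval_add, eval_mul, eval_not, ha, one_sub_ind]
  split_ifs with h <;> simp [ind, h]

end Expr

/-! ### Arrays in memory -/

/-- The square array, stored row by row with rows of length `S`, of a relation. -/
noncomputable def arr (S : ℕ) (R : ℕ → ℕ → Prop) (k : ℕ) : ℕ := ind (R (k / S) (k % S))

theorem arr_apply {S x y : ℕ} (hy : y < S) (R : ℕ → ℕ → Prop) :
    arr S R (x * S + y) = ind (R x y) := by
  rw [arr, add_comm, mul_comm, Nat.add_mul_div_left _ _ (by omega), Nat.add_mul_mod_self_left,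
    Nat.div_eq_of_lt hy, Nat.mod_eq_of_lt hy, zero_add]

/-- `y < S` makes the address determine the pair, so exactly one entry of the relation changes. -/
theorem arr_update {S x y : ℕ} (hy : y < S) (R : ℕ → ℕ → Prop) (p : Prop) :
    Function.update (arr S R) (x * S + y) (ind p) =
      arr S (fun a b => a = x ∧ b = y ∧ p ∨ ¬ (a = x ∧ b = y) ∧ R a b) := by
  funext k
  have h : k = x * S + y ↔ k / S = x ∧ k % S = y := by
    constructor
    · rintro rfl
      rw [add_comm, mul_comm, Nat.add_mul_div_left _ _ (by omega), Nat.add_mul_mod_self_left,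
        Nat.div_eq_of_lt hy, Nat.mod_eq_of_lt hy]
      simp
    · rintro ⟨rfl, rfl⟩
      rw [mul_comm]; exact (Nat.div_add_mod k S).symm
  rw [Function.update_apply, arr, arr]
  split_ifs with hk
  · exact ind_congr (by simp [h.1 hk])
  · exact ind_congr (by rw [h] at hk; tauto)

/-- The memory with `inp` in the cells below `A`, followed by four interleaved arrays. -/
def lay (A : ℕ) (inp E B L M : ℕ → ℕ) (a : ℕ) : ℕ :=
  if a < A then inp a else
    if (a - A) % 4 = 0 then E ((a - A) / 4) else
      if (a - A) % 4 = 1 then B ((a - A) / 4) else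
        if (a - A) % 4 = 2 then L ((a - A) / 4) else M ((a - A) / 4)

variable {A : ℕ} {inp E B L M : ℕ → ℕ} (i x : ℕ)

theorem lay_inp {a : ℕ} (h : a < A) : lay A inp E B L M a = inp a := by simp [lay, h]
@[simp] theorem lay_E : lay A inp E B L M (A + (4 * i + 0)) = E i := by
  simp [lay]
@[simp] theorem lay_B : lay A inp E B L M (A + (4 * i + 1)) = B i := by
  simp only [lay]; rw [if_neg (by omega), if_neg (by omega), if_pos (by omega)]; congr; omega
@[simp] theorem lay_L : lay A inp E B L M (A + (4 * i + 2)) = L i := by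
  simp only [lay]; rw [if_neg (by omega), if_neg (by omega), if_neg (by omega), if_pos (by omega)]
  congr; omega
@[simp] theorem lay_M : lay A inp E B L M (A + (4 * i + 3)) = M i := by
  simp only [lay]; rw [if_neg (by omega), if_neg (by omega), if_neg (by omega), if_neg (by omega)]
  congr; omega

/-- Interleaving modulo 4 leaves all four arrays unbounded, so writing to one never collides with
another and no disjointness conditions arise. -/
theorem update_lay_E : Function.update (lay A inp E B L M) (A + (4 * i + 0)) x =
    lay A inp (Function.update E i x) B L M := by
  funext a; simp only [lay, Function.update_apply]; grind
theorem update_lay_B : Function.update (lay A inp E B L M) (A + (4 * i + 1)) x =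
    lay A inp E (Function.update B i x) L M := by
  funext a; simp only [lay, Function.update_apply]; grind
theorem update_lay_L : Function.update (lay A inp E B L M) (A + (4 * i + 2)) x =
    lay A inp E B (Function.update L i x) M := by
  funext a; simp only [lay, Function.update_apply]; grind
theorem update_lay_M : Function.update (lay A inp E B L M) (A + (4 * i + 3)) x =
    lay A inp E B L (Function.update M i x) := by
  funext a; simp only [lay, Function.update_apply]; grind

end Layout

/-! ## Reading the input -/

section Parse

namespace Expr

/-- The address of the entry `idx` of the array number `k`. -/
def cell (k : ℕ) (idx : Expr) : Expr := .add (.reg 3) (.add (.mul (.const 4) idx) (.const k))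

/-- The vertex number `i` of the hyperedge number `j`. -/
def vertexAt (j i : Expr) : Expr := .load (cell 0 (.add (.mul (.const 3) j) i))

/-- The entry `x`, `y` of the adjacency matrix. -/
def relB (x y : Expr) : Expr := .load (cell 1 (.add (.mul x (.add (.reg 1) (.const 1))) y))

/-- The vertex of the option number `p`. -/
def optAt (p : Expr) : Expr := .load (cell 2 p)

/-- The address of the entry `p`, `q` of the compatibility matrix. -/
def cellM (p q : Expr) : Expr := cell 3 (.add (.mul p (.reg 4)) q)

/-- The entry `p`, `q` of the compatibility matrix. -/
def relM (p q : Expr) : Expr := .load (cellM p q)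

end Expr

/-- The registers that hold the dimensions of the memory layout. -/
structure Ctx (n m : ℕ) (s : State) : Prop where
  r1 : s.reg 1 = n
  r2 : s.reg 2 = m
  r3 : s.reg 3 = 4 * m + 2
  r4 : s.reg 4 = 2 * m + 1

theorem Ctx.of_frame {n m : ℕ} {s s' : State} {c : Cmd} (h : Ctx n m s) (hF : Frame c s s')
    (hc : (c.writes 1 || c.writes 2 || c.writes 3 || c.writes 4) = false) : Ctx n m s' := by
  simp only [Bool.or_eq_false_iff] at hc
  obtain ⟨⟨⟨h1, h2⟩, h3⟩, h4⟩ := hc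
  exact ⟨(hF.reg 1 h1).trans h.r1, (hF.reg 2 h2).trans h.r2, (hF.reg 3 h3).trans h.r3,
    (hF.reg 4 h4).trans h.r4⟩

theorem Ctx.setReg {n m : ℕ} {s : State} (h : Ctx n m s) {r x : ℕ} (hr : 4 < r) :
    Ctx n m (s.setReg r x) := by
  refine ⟨?_, ?_, ?_, ?_⟩ <;> rw [State.setReg_reg, if_neg (by omega)]
  exacts [h.r1, h.r2, h.r3, h.r4]

/-- The table of the first `k` hyperedges, with three entries for each. -/
def tbl (k : ℕ) (v : ℕ → ℕ → ℕ) (a : ℕ) : ℕ := if a < 3 * k then v (a / 3) (a % 3) else 0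

theorem tbl_apply {k j i : ℕ} (hj : j < k) (hi : i < 3) (v : ℕ → ℕ → ℕ) :
    tbl k v (3 * j + i) = v j i := by
  rw [tbl, if_pos (by omega), show (3 * j + i) / 3 = j by omega,
    show (3 * j + i) % 3 = i by omega]

theorem tbl_succ (k : ℕ) (v : ℕ → ℕ → ℕ) :
    Function.update (Function.update (Function.update (tbl k v) (3 * k + 0) (v k 0))
      (3 * k + 1) (v k 1)) (3 * k + 2) (v k 2) = tbl (k + 1) v := by
  funext a
  simp only [Function.update_apply, tbl]
  split_ifs with h1 h2 h3 h4 h5 h6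
  all_goals first
    | omega
    | (rw [show a / 3 = k by omega]; congr 1; omega)

/-- A list of lists of numbers, each preceded by its length. -/
def encodeLists (l : List (List ℕ)) : List ℕ := l.flatMap fun x => x.length :: x

theorem encodeLists_append (l l' : List (List ℕ)) :
    encodeLists (l ++ l') = encodeLists l ++ encodeLists l' := List.flatMap_append

theorem encodeLists_cons (x : List ℕ) (l : List (List ℕ)) :
    encodeLists (x :: l) = (x.length :: x) ++ encodeLists l := List.flatMap_cons

/-- The entry number `i` of the list number `j`, and `n` if there is none. -/
def entry (edges : List (List ℕ)) (n j i : ℕ) : ℕ := (edges.getD j []).getD i n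

/-- The input cells. -/
def inputCells (n : ℕ) (edges : List (List ℕ)) (i : ℕ) : ℕ :=
  (n :: edges.length :: encodeLists edges).getD i 0

/-- The address of the list number `k` in the input. -/
def inputPos (edges : List (List ℕ)) (k : ℕ) : ℕ := 2 + (encodeLists (edges.take k)).length

variable {edges : List (List ℕ)} {n Y k : ℕ}

/-- The encoding splits at list `k`: its part before that list has the length built into `inputPos`,
next to the two header cells. -/
theorem inputCells_eq (hk : k < edges.length) (i : ℕ) :
    inputCells n edges (inputPos edges k + i) =
      ((edges[k].length :: edges[k]) ++ encodeLists (edges.drop (k + 1))).getD i 0 := by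
  have h : encodeLists edges = encodeLists (edges.take k) ++
      ((edges[k].length :: edges[k]) ++ encodeLists (edges.drop (k + 1))) := by
    conv_lhs => rw [← List.take_append_drop k edges, List.drop_eq_getElem_cons hk]
    rw [encodeLists_append, encodeLists_cons]
  rw [inputCells, inputPos, show ∀ a : ℕ, 2 + a + i = (a + i) + 1 + 1 by intro a; omega,
    List.getD_cons_succ, List.getD_cons_succ, h, List.getD_append_right _ _ _ _ (by omega)]
  congr 1
  omega

theorem inputCells_length (hk : k < edges.length) :
    inputCells n edges (inputPos edges k) = edges[k].length := by
  simpa using inputCells_eq (n := n) hk 0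

theorem inputCells_entry (hk : k < edges.length) {i : ℕ} (hi : i < edges[k].length) :
    inputCells n edges (inputPos edges k + (i + 1)) = entry edges n k i := by
  rw [inputCells_eq hk, List.cons_append, List.getD_cons_succ, List.getD_append _ _ _ _ hi, entry,
    List.getD_eq_getElem _ _ hk, List.getD_eq_getElem _ _ hi, List.getD_eq_getElem _ _ hi]

theorem inputPos_succ (hk : k < edges.length) :
    inputPos edges (k + 1) = inputPos edges k + edges[k].length + 1 := by
  rw [inputPos, inputPos, List.take_add_one, List.getElem?_eq_getElem hk, encodeLists_append,
    Option.toList_some, encodeLists_cons]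
  simp only [encodeLists, List.flatMap_nil, List.append_nil, List.length_append, List.length_cons]
  omega

theorem length_encodeLists_le (h3 : ∀ l ∈ edges, l.length ≤ 3) :
    (encodeLists edges).length ≤ 4 * edges.length := by
  induction edges with
  | nil => simp [encodeLists]
  | cons a t ih =>
    have := ih fun l hl => h3 l (List.mem_cons_of_mem _ hl)
    have := h3 a List.mem_cons_self
    simp only [encodeLists, List.flatMap_cons, List.length_append, List.length_cons] at *
    omega

/-- A list takes at most four cells, so the length cell of every list lies below `4 * m + 2`, in the
region that the tables do not overwrite. -/
theorem inputPos_le (h3 : ∀ l ∈ edges, l.length ≤ 3) (k : ℕ) : inputPos edges k ≤ 2 + 4 * k := by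
  have := length_encodeLists_le (edges := edges.take k) fun l hl => h3 l (List.mem_of_mem_take hl)
  have : (edges.take k).length ≤ k := by simp
  rw [inputPos]
  omega

theorem entry_le (hn : ∀ l ∈ edges, ∀ x ∈ l, x < n) (j i : ℕ) : entry edges n j i ≤ n := by
  unfold entry
  by_cases hj : j < edges.length
  · rw [List.getD_eq_getElem _ _ hj]
    by_cases hi : i < edges[j].length
    · rw [List.getD_eq_getElem _ _ hi]
      exact (hn _ (List.getElem_mem _) _ (List.getElem_mem _)).le
    · rw [List.getD_eq_default _ _ (by omega)]
  · rw [List.getD_eq_default edges _ (by omega)]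
    simp

theorem bdd_init (hn : ∀ l ∈ edges, ∀ x ∈ l, x < n) (h3 : ∀ l ∈ edges, l.length ≤ 3)
    (hY : 10 ≤ Y) (hnY : n ≤ Y) (hmY : edges.length ≤ Y) :
    Bdd Y (State.init (n :: edges.length :: encodeLists edges)) := by
  refine ⟨hY, fun _ => Nat.zero_le _, fun a => ?_⟩
  have h : ∀ x ∈ n :: edges.length :: encodeLists edges, x ≤ Y := by
    intro x hx
    simp only [List.mem_cons, encodeLists, List.mem_flatMap] at hx
    rcases hx with rfl | rfl | ⟨l, hl, rfl | hx⟩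
    · exact hnY
    · exact hmY
    · exact (h3 l hl).trans (by omega)
    · exact (hn l hl x hx).le.trans hnY
  simp only [State.init]
  by_cases ha : a < (n :: edges.length :: encodeLists edges).length
  · rw [List.getD_eq_getElem _ _ ha]
    exact h _ (List.getElem_mem _)
  · rw [List.getD_eq_default _ _ (by omega)]
    omega

open DualConf.Expr in
/-- Copy the entry number `i` of the current list to the table. -/
def copyEntry (i : ℕ) : Cmd :=
  .store (cell 0 (.add (.mul (.const 3) (.reg 6)) (.const i)))
    (cond (lt (.const i) (.load (.reg 5))) (.load (.add (.reg 5) (.const (i + 1)))) (.reg 1))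

open DualConf.Expr in
/-- Initialize the registers and copy the hyperedges to the table. -/
def parse : Cmd :=
  .seq (.assign 1 (.load (.const 0))) <|
  .seq (.assign 2 (.load (.const 1))) <|
  .seq (.assign 3 (.add (.mul (.const 4) (.reg 2)) (.const 2))) <|
  .seq (.assign 4 (.add (.mul (.const 2) (.reg 2)) (.const 1))) <|
  .seq (.assign 5 (.const 2)) <|
  .forTo 6 (.reg 2) <|
    .seq (copyEntry 0) <| .seq (copyEntry 1) <| .seq (copyEntry 2) <|
    .assign 5 (.add (.reg 5) (.add (.load (.reg 5)) (.const 1)))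

variable {m : ℕ} {s : State} {B L M : ℕ → ℕ} {Q : State → Prop}

/-- A list with at most `i` entries receives the padding value `n`. In that case the discarded
branch reads past the list, possibly in the next list or in the table. -/
theorem copyEntry_ter {E : ℕ → ℕ} {i : ℕ} (hi : i < 3) (hn : ∀ l ∈ edges, ∀ x ∈ l, x < n)
    (h3 : ∀ l ∈ edges, l.length ≤ 3) (hb : Bdd Y s) (hc : Ctx n edges.length s)
    (hk : k < edges.length) (h6 : s.reg 6 = k) (h5 : s.reg 5 = inputPos edges k)
    (hm : s.mem = lay (4 * edges.length + 2) (inputCells n edges) E B L M) (hnY : n ≤ Y)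
    (hQ : ∀ s', s'.reg = s.reg → s'.out = s.out → s'.mem = lay (4 * edges.length + 2)
      (inputCells n edges) (Function.update E (3 * k + i) (entry edges n k i)) B L M → Q s') :
    Ter Y (copyEntry i) s 1 Q := by
  have hp := inputPos_le h3 k
  have h1 : (Expr.lt (.const i) (.load (.reg 5))).eval s = ind (i < edges[k].length) := by
    rw [Expr.eval_lt, Expr.eval_load, Expr.eval_reg, h5, hm, lay_inp (by omega),
      inputCells_length hk, Expr.eval_const]
  have h2 : (Expr.cond (.lt (.const i) (.load (.reg 5))) (.load (.add (.reg 5) (.const (i + 1))))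
      (.reg 1)).eval s = entry edges n k i := by
    rw [Expr.eval_cond h1]
    split_ifs with h
    · rw [Expr.eval_load, Expr.eval_add, Expr.eval_reg, Expr.eval_const, h5, hm,
        lay_inp (by omega), inputCells_entry hk h]
    · rw [Expr.eval_reg, hc.r1, entry, List.getD_eq_getElem _ _ hk,
        List.getD_eq_default _ _ (by omega)]
  refine Ter.store ?_ ?_ hb ?_ (hQ _ rfl rfl ?_)
  · interval_cases i <;> decide
  · interval_cases i <;> decide
  · rw [h2]; exact (entry_le hn k i).trans hnY
  · simp only [State.setMem_mem, h2, hm]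
    simp only [Expr.cell, Expr.eval_add, Expr.eval_mul, Expr.eval_const, Expr.eval_reg, hc.r3, h6]
    rw [update_lay_E]

theorem parse_ter (hn : ∀ l ∈ edges, ∀ x ∈ l, x < n) (h3 : ∀ l ∈ edges, l.length ≤ 3)
    (hY : 10 ≤ Y) (hnY : n ≤ Y) (hmY : 4 * edges.length + 2 ≤ Y) :
    Ter Y parse (State.init (n :: edges.length :: encodeLists edges))
      (1 + (1 + (1 + (1 + (1 + (2 + edges.length * ((1 + (1 + (1 + 1))) + 2)))))))
      fun s => Ctx n edges.length s ∧ s.reg 0 = 0 ∧ s.out = [] ∧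
        s.mem = lay (4 * edges.length + 2) (inputCells n edges)
          (tbl edges.length (entry edges n)) 0 0 0 := by
  have hb := bdd_init (Y := Y) hn h3 hY hnY (by omega)
  -- Cells beyond the input are 0, so the initial memory already has the layout, with empty tables.
  have hm : (State.init (n :: edges.length :: encodeLists edges)).mem =
      lay (4 * edges.length + 2) (inputCells n edges) (tbl 0 (entry edges n)) 0 0 0 := by
    funext a
    have hl := length_encodeLists_le h3
    simp only [lay, tbl]
    split_ifs with h
    · rfl
    all_goals
      simp only [State.init]
      refine (List.getD_eq_default _ _ (by simp only [List.length_cons]; omega)).trans ?_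
      first | rfl | omega
  refine Ter.seq (Ter.assign (by decide) hb (hb.mem _) fun hb1 _ => ?_)
  refine Ter.seq (Ter.assign (by decide) hb1 (hb1.mem _) fun hb2 _ => ?_)
  refine Ter.seq (Ter.assign (by decide) hb2 ?_ fun hb3 _ => ?_)
  · simpa [State.init] using hmY
  refine Ter.seq (Ter.assign (by decide) hb3 ?_ fun hb4 _ => ?_)
  · simp [State.init]; omega
  refine Ter.seq (Ter.assign (by decide) hb4 ?_ fun hb5 _ => ?_)
  · simpa using by omega
  set s0 := ((((((State.init (n :: edges.length :: encodeLists edges)).setReg 1 _).setReg 2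
    _).setReg 3 _).setReg 4 _).setReg 5 _) with hs0
  have hc : Ctx n edges.length s0 := by
    constructor <;> simp [hs0, State.init]
  have h5 : s0.reg 5 = 2 := by simp [hs0]
  have h00 : s0.reg 0 = 0 := by simp [hs0, State.init]
  have hm0 : s0.mem = (State.init (n :: edges.length :: encodeLists edges)).mem := rfl
  have ho0 : s0.out = [] := rfl
  clear_value s0
  refine Ter.forTo (k := edges.length) (T := 1 + (1 + (1 + 1)))
    (fun k s => s.reg 5 = inputPos edges k ∧ s.mem = lay (4 * edges.length + 2)
      (inputCells n edges) (tbl k (entry edges n)) 0 0 0) (by decide) (by decide) hb5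
    (by omega) ?_ ?_ ?_ ?_
  · intro s' hF
    exact (hc.of_frame hF (by decide)).r2
  · refine ⟨?_, ?_⟩
    · simp [h5, inputPos, encodeLists]
    · rw [State.setReg_mem, hm0, hm]
  · rintro k s hk hb hF h6 ⟨h5, hm⟩
    have hc' := hc.of_frame hF (by decide)
    refine Ter.seq (copyEntry_ter (by omega) hn h3 hb hc' hk h6 h5 hm hnY ?_)
    intro s1 hr1 _ hm1 hb1 hF1
    refine Ter.seq (copyEntry_ter (by omega) hn h3 hb1 (hc'.of_frame hF1 (by decide)) hk
      (by rw [hr1, h6]) (by rw [hr1, h5]) hm1 hnY ?_)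
    intro s2 hr2 _ hm2 hb2 hF2
    refine Ter.seq (copyEntry_ter (by omega) hn h3 hb2 ((hc'.of_frame hF1 (by decide)).of_frame hF2
      (by decide)) hk (by rw [hr2, hr1, h6]) (by rw [hr2, hr1, h5]) hm2 hnY ?_)
    intro s3 hr3 _ hm3 hb3 hF3
    have hp := inputPos_le h3 k
    have hlen := h3 _ (List.getElem_mem hk)
    have he : (Expr.add (.reg 5) (.add (.load (.reg 5)) (.const 1))).eval s3 =
        inputPos edges (k + 1) := by
      simp only [Expr.eval_add, Expr.eval_reg, Expr.eval_load, Expr.eval_const, hr3, hr2, hr1, h5,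
        hm3]
      rw [lay_inp (by omega), inputCells_length hk, inputPos_succ hk, add_assoc]
    refine Ter.assign (by decide) hb3 ?_ ?_
    · rw [he, inputPos_succ hk]; omega
    · intro _ _
      refine ⟨?_, ?_⟩
      · simp [-Expr.eval_add, he]
      · simp only [State.setReg_mem, hm3]
        rw [tbl_succ]
  · rintro s' hF ⟨-, hm⟩
    exact ⟨hc.of_frame hF (by decide), (hF.reg 0 (by decide)).trans h00,
      (hF.out (by decide)).trans ho0, hm⟩

end Parse

/-! ## Computing the adjacency matrix -/

section Adjacency

namespace Expr

/-- Whether the vertex `x` belongs to the hyperedge number `j`. -/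
def inEdge (x j : Expr) : Expr :=
  or (eq x (vertexAt j (.const 0))) (or (eq x (vertexAt j (.const 1))) (eq x (vertexAt j (.const 2))))

/-- Whether `x`, if it is a vertex, is in one of the hyperedges `e`, `f` and not one of `u`, `w`. -/
def inRest (e f u w x : Expr) : Expr :=
  or (not (lt x (.reg 1)))
    (and (or (inEdge x e) (inEdge x f)) (and (not (eq x u)) (not (eq x w))))

/-- Whether the hyperedge `g` is contained in the union of `e` and `f` without `u` and `w`. -/
def subRest (e f u w g : Expr) : Expr :=
  and (inRest e f u w (vertexAt g (.const 0)))
    (and (inRest e f u w (vertexAt g (.const 1))) (inRest e f u w (vertexAt g (.const 2))))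

end Expr

/-- `x` is an entry of the row `j` of the table. -/
def InRow (tab : ℕ → ℕ → ℕ) (j x : ℕ) : Prop := x = tab j 0 ∨ x = tab j 1 ∨ x = tab j 2

/-- If `x` is a vertex, then it is in one of the rows `e`, `f` and not one of `u`, `w`. -/
def InRest (n : ℕ) (tab : ℕ → ℕ → ℕ) (e f u w x : ℕ) : Prop :=
  ¬ x < n ∨ (InRow tab e x ∨ InRow tab f x) ∧ ¬ x = u ∧ ¬ x = w

/-- The row `g` is contained in the union of `e` and `f` without `u` and `w`. -/
def SubRest (n : ℕ) (tab : ℕ → ℕ → ℕ) (e f u w g : ℕ) : Prop :=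
  InRest n tab e f u w (tab g 0) ∧ InRest n tab e f u w (tab g 1) ∧ InRest n tab e f u w (tab g 2)

/-- The rows `e` and `f` admit a transversal that meets them in `u` and in `w`, respectively. -/
def Witness (n m : ℕ) (tab : ℕ → ℕ → ℕ) (e f u w : ℕ) : Prop :=
  (u < n ∧ w < n ∧ ¬ InRow tab f u ∧ ¬ InRow tab e w) ∧ ∀ g < m, ¬ SubRest n tab e f u w g

/-- The relation computed by the program: equality or adjacency. -/
def EqOrAdj (n m : ℕ) (tab : ℕ → ℕ → ℕ) (x y : ℕ) : Prop :=
  (False ∨ ∃ i < n, x = i ∧ y = i) ∨ ∃ e < m, ∃ f < m, ∃ i < 3, ∃ j < 3,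
    x = tab e i ∧ y = tab f j ∧ Witness n m tab e f (tab e i) (tab f j)

open DualConf.Expr in
/-- Write the relation `EqOrAdj` to the adjacency matrix. -/
def adjacency : Cmd :=
  .seq (.forTo 11 (.reg 1)
    (.store (cell 1 (.add (.mul (.reg 11) (.add (.reg 1) (.const 1))) (.reg 11))) (.const 1))) <|
  .forTo 6 (.reg 2) <| .forTo 7 (.reg 2) <| .forTo 8 (.const 3) <| .forTo 9 (.const 3) <|
  .seq (.assign 11 (vertexAt (.reg 6) (.reg 8))) <|
  .seq (.assign 12 (vertexAt (.reg 7) (.reg 9))) <|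
  .seq (.assign 13 (and (and (lt (.reg 11) (.reg 1)) (lt (.reg 12) (.reg 1)))
    (and (not (inEdge (.reg 11) (.reg 7))) (not (inEdge (.reg 12) (.reg 6)))))) <|
  .seq (.forTo 10 (.reg 2)
    (.assign 13 (and (.reg 13) (not (subRest (.reg 6) (.reg 7) (.reg 11) (.reg 12) (.reg 10)))))) <|
  .store (cell 1 (.add (.mul (.reg 11) (.add (.reg 1) (.const 1))) (.reg 12)))
    (or (relB (.reg 11) (.reg 12)) (.reg 13))

variable {n m Y : ℕ} {tab : ℕ → ℕ → ℕ} {inp B L M : ℕ → ℕ} {R : ℕ → ℕ → Prop} {s : State}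

section Eval

variable {x y j i e f u w g : Expr}

theorem eval_vertexAt (hc : Ctx n m s) (hm : s.mem = lay (4 * m + 2) inp (tbl m tab) B L M)
    (hj : j.eval s < m) (hi : i.eval s < 3) :
    (Expr.vertexAt j i).eval s = tab (j.eval s) (i.eval s) := by
  simp only [Expr.vertexAt, Expr.cell, Expr.eval_load, Expr.eval_add, Expr.eval_mul, Expr.eval_reg,
    Expr.eval_const, hc.r3, hm, lay_E, tbl_apply hj hi]

theorem eval_relB (hc : Ctx n m s)
    (hm : s.mem = lay (4 * m + 2) inp (tbl m tab) (arr (n + 1) R) L M) (hy : y.eval s ≤ n) :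
    (Expr.relB x y).eval s = ind (R (x.eval s) (y.eval s)) := by
  simp only [Expr.relB, Expr.cell, Expr.eval_load, Expr.eval_add, Expr.eval_mul, Expr.eval_reg,
    Expr.eval_const, hc.r3, hc.r1, hm, lay_B]
  rw [arr_apply (by omega)]

theorem eval_inEdge (hc : Ctx n m s) (hm : s.mem = lay (4 * m + 2) inp (tbl m tab) B L M)
    (hj : j.eval s < m) : (Expr.inEdge x j).eval s = ind (InRow tab (j.eval s) (x.eval s)) := by
  refine Expr.eval_or ?_ (Expr.eval_or ?_ ?_) <;>
  rw [Expr.eval_eq, eval_vertexAt hc hm hj (by simp)] <;> rfl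

theorem eval_inRest (hc : Ctx n m s) (hm : s.mem = lay (4 * m + 2) inp (tbl m tab) B L M)
    (he : e.eval s < m) (hf : f.eval s < m) : (Expr.inRest e f u w x).eval s =
      ind (InRest n tab (e.eval s) (f.eval s) (u.eval s) (w.eval s) (x.eval s)) := by
  refine Expr.eval_or ?_ ?_
  · simp [hc.r1]
  · simp [Expr.eval_or (eval_inEdge hc hm he) (eval_inEdge hc hm hf)]

theorem eval_subRest (hc : Ctx n m s) (hm : s.mem = lay (4 * m + 2) inp (tbl m tab) B L M)
    (he : e.eval s < m) (hf : f.eval s < m) (hg : g.eval s < m) :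
    (Expr.subRest e f u w g).eval s =
      ind (SubRest n tab (e.eval s) (f.eval s) (u.eval s) (w.eval s) (g.eval s)) := by
  have h : ∀ k < 3, (Expr.vertexAt g (.const k)).eval s = tab (g.eval s) k :=
    fun k hk => eval_vertexAt hc hm hg hk
  simp [Expr.subRest, eval_inRest hc hm he hf, h, SubRest]

end Eval

/-- A loop whose rounds add pairs to the relation in the adjacency matrix. -/
theorem Ter.forTo_relB {r : ℕ} {b : Expr} {c : Cmd} {k T : ℕ} (P : ℕ → ℕ → ℕ → Prop)
    (hbG : b.Good) (hw : c.writes r = false) (hb : Bdd Y s) (hk : k ≤ Y)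
    (hbk : ∀ s', Frame (.forTo r b c) s s' → b.eval s' = k)
    (hm : s.mem = lay (4 * m + 2) inp (tbl m tab) (arr (n + 1) R) L M)
    (hstep : ∀ i s' R', i < k → Bdd Y s' → Frame (.forTo r b c) s s' → s'.reg r = i →
      s'.mem = lay (4 * m + 2) inp (tbl m tab) (arr (n + 1) R') L M →
      Ter Y c s' T fun s'' => s''.mem = lay (4 * m + 2) inp (tbl m tab)
        (arr (n + 1) fun x y => R' x y ∨ P i x y) L M) :
    Ter Y (.forTo r b c) s (2 + k * (T + 2)) fun s' => s'.mem = lay (4 * m + 2) inp (tbl m tab)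
      (arr (n + 1) fun x y => R x y ∨ ∃ i < k, P i x y) L M := by
  refine Ter.forTo (fun k s' => s'.mem = lay (4 * m + 2) inp (tbl m tab)
      (arr (n + 1) fun x y => R x y ∨ ∃ i < k, P i x y) L M) hbG hw hb hk hbk ?_ ?_ ?_
  · simpa using hm
  · intro i s' hi hb' hF hr hm'
    refine (hstep i s' _ hi hb' hF hr hm').mono le_rfl fun s'' _ _ h _ _ => ?_
    rw [State.setReg_mem, h]
    congr 2
    funext x y
    simp only [Nat.lt_succ_iff_lt_or_eq, or_and_right, exists_or, or_assoc,
      exists_eq_left]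
  · exact fun s' _ h => h

theorem store_relB (hc : Ctx n m s)
    (hm : s.mem = lay (4 * m + 2) inp (tbl m tab) (arr (n + 1) R) L M) {x y e : Expr} {p : Prop}
    (hy : y.eval s ≤ n) (he : e.eval s = ind (R (x.eval s) (y.eval s) ∨ p)) :
    (s.setMem ((Expr.cell 1 (.add (.mul x (.add (.reg 1) (.const 1))) y)).eval s) (e.eval s)).mem =
      lay (4 * m + 2) inp (tbl m tab)
        (arr (n + 1) fun a b => R a b ∨ a = x.eval s ∧ b = y.eval s ∧ p) L M := by
  simp only [Expr.cell, Expr.eval_add, Expr.eval_mul, Expr.eval_reg,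
    Expr.eval_const, hc.r3, hc.r1, hm, State.setMem_mem, he]
  rw [update_lay_B, arr_update (by omega)]
  congr 2
  funext a b
  by_cases ha : a = x.eval s <;> by_cases hb : b = y.eval s <;> simp [ha, hb]

/-- The search runs over pairs of table entries rather than pairs of vertices: nine pairs for any
two hyperedges, each tested against all hyperedges, hence `O(m^3)`. A padded entry leads to a
harmless rewrite of row or column `n`, for which the matrix has room. -/
theorem adjacency_ter (htab : ∀ j i, tab j i ≤ n) (hb : Bdd Y s) (hc : Ctx n m s)
    (hm : s.mem = lay (4 * m + 2) inp (tbl m tab) 0 L M) :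
    Ter Y adjacency s ((2 + n * (1 + 2)) + (2 + m * ((2 + m * ((2 + 3 * ((2 + 3 *
      ((1 + (1 + (1 + ((2 + m * (1 + 2)) + 1)))) + 2)) + 2)) + 2)) + 2))) fun s' =>
      s'.mem = lay (4 * m + 2) inp (tbl m tab) (arr (n + 1) (EqOrAdj n m tab)) L M := by
  have h10 := hb.ten
  have hnY : n ≤ Y := hc.r1 ▸ hb.reg 1
  have hmY : m ≤ Y := hc.r2 ▸ hb.reg 2
  -- Blank memory represents the empty relation.
  have h0 : (0 : ℕ → ℕ) = arr (n + 1) (fun _ _ => False) := by funext; simp [arr, ind]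
  rw [h0] at hm
  refine Ter.seq ((Ter.forTo_relB (fun i x y => x = i ∧ y = i) (by decide) (by decide) hb hnY
    (by exact fun s' hF => (hc.of_frame hF (by decide)).r1) hm ?_).mono le_rfl ?_)
  · intro i s' R' hi hb' hF hr hm'
    have hc' := hc.of_frame hF (by decide)
    refine Ter.store (by decide) (by decide) hb' (by simpa using by omega) ?_
    rw [store_relB hc' hm' (p := True) (by simpa [hr] using hi.le) (by simp [ind])]
    simp [hr]
  intro s hb _ hm hb hF1
  replace hc := hc.of_frame hF1 (by decide)
  refine Ter.forTo_relB (fun e x y => ∃ f < m, ∃ i < 3, ∃ j < 3,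
    x = tab e i ∧ y = tab f j ∧ Witness n m tab e f (tab e i) (tab f j)) (by decide) (by decide)
    hb hmY (fun s' hF => (hc.of_frame hF (by decide)).r2) hm ?_
  intro e s R he hb hF h6 hm
  replace hc := hc.of_frame hF (by decide)
  refine Ter.forTo_relB (fun f x y => ∃ i < 3, ∃ j < 3,
    x = tab e i ∧ y = tab f j ∧ Witness n m tab e f (tab e i) (tab f j)) (by decide) (by decide)
    hb hmY (fun s' hF => (hc.of_frame hF (by decide)).r2) hm ?_
  intro f s R hf hb hF h7 hm
  replace hc := hc.of_frame hF (by decide)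
  replace h6 := (hF.reg 6 (by decide)).trans h6
  refine Ter.forTo_relB (fun i x y => ∃ j < 3,
    x = tab e i ∧ y = tab f j ∧ Witness n m tab e f (tab e i) (tab f j)) (by decide) (by decide)
    hb (by omega) (fun s' hF => rfl) hm ?_
  intro i s R hi hb hF h8 hm
  replace hc := hc.of_frame hF (by decide)
  replace h6 := (hF.reg 6 (by decide)).trans h6
  replace h7 := (hF.reg 7 (by decide)).trans h7
  refine Ter.forTo_relB (fun j x y =>
    x = tab e i ∧ y = tab f j ∧ Witness n m tab e f (tab e i) (tab f j)) (by decide) (by decide)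
    hb (by omega) (fun s' hF => rfl) hm ?_
  intro j s R hj hb hF h9 hm
  replace hc := hc.of_frame hF (by decide)
  replace h6 := (hF.reg 6 (by decide)).trans h6
  replace h7 := (hF.reg 7 (by decide)).trans h7
  replace h8 := (hF.reg 8 (by decide)).trans h8
  clear hF hF1
  have hv1 : (Expr.vertexAt (.reg 6) (.reg 8)).eval s = tab e i := by
    rw [eval_vertexAt hc hm (by simpa [h6]) (by simpa [h8])]; simp [h6, h8]
  refine Ter.seq (Ter.assign (by decide) hb (hb.mem _) fun hb hF => ?_)
  rw [hv1] at hb hF ⊢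
  replace hm : (s.setReg 11 (tab e i)).mem = _ := hm
  replace hc := hc.of_frame hF (by decide)
  replace h6 := (hF.reg 6 (by decide)).trans h6
  replace h7 := (hF.reg 7 (by decide)).trans h7
  replace h9 := (hF.reg 9 (by decide)).trans h9
  have h11 : (s.setReg 11 (tab e i)).reg 11 = tab e i := by simp
  clear hv1
  generalize s.setReg 11 (tab e i) = s at *
  have hv2 : (Expr.vertexAt (.reg 7) (.reg 9)).eval s = tab f j := by
    rw [eval_vertexAt hc hm (by simpa [h7]) (by simpa [h9])]; simp [h7, h9]
  refine Ter.seq (Ter.assign (by decide) hb (hb.mem _) fun hb hF => ?_)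
  rw [hv2] at hb hF ⊢
  replace hm : (s.setReg 12 (tab f j)).mem = _ := hm
  replace hc := hc.of_frame hF (by decide)
  replace h6 := (hF.reg 6 (by decide)).trans h6
  replace h7 := (hF.reg 7 (by decide)).trans h7
  replace h11 := (hF.reg 11 (by decide)).trans h11
  have h12 : (s.setReg 12 (tab f j)).reg 12 = tab f j := by simp
  generalize s.setReg 12 (tab f j) = s at *
  have hin1 := eval_inEdge (x := .reg 11) (j := .reg 7) hc hm (by simpa [h7])
  have hin2 := eval_inEdge (x := .reg 12) (j := .reg 6) hc hm (by simpa [h6])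
  set p0 : Prop := (tab e i < n ∧ tab f j < n) ∧ ¬ InRow tab f (tab e i) ∧ ¬ InRow tab e (tab f j)
    with hp0
  have hv3 : (Expr.and (.and (.lt (.reg 11) (.reg 1)) (.lt (.reg 12) (.reg 1)))
      (.and (.not (.inEdge (.reg 11) (.reg 7))) (.not (.inEdge (.reg 12) (.reg 6))))).eval s =
      ind p0 := by
    simp only [Expr.eval_and, Expr.eval_lt, Expr.eval_not, hin1, hin2, one_sub_ind, ind_mul,
      Expr.eval_reg, h6, h7, h11, h12, hc.r1, hp0]
  refine Ter.seq (Ter.assign (by decide) hb ?_ fun hb hF => ?_)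
  · rw [hv3]; exact ind_le_one.trans (by omega)
  rw [hv3] at hb hF ⊢
  replace hm : (s.setReg 13 (ind p0)).mem = _ := hm
  replace hc := hc.of_frame hF (by decide)
  replace h6 := (hF.reg 6 (by decide)).trans h6
  replace h7 := (hF.reg 7 (by decide)).trans h7
  replace h11 := (hF.reg 11 (by decide)).trans h11
  replace h12 := (hF.reg 12 (by decide)).trans h12
  have h13 : (s.setReg 13 (ind p0)).reg 13 = ind p0 := by simp
  generalize s.setReg 13 (ind p0) = s at *
  clear hv2 hv3 hin1 hin2 hF
  -- Register 13 starts with `p0`, the part of `Witness` that does not involve `g`; each round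
  -- conjoins the condition for one more hyperedge `g`.
  refine Ter.seq (Ter.forTo (fun k s' => s'.reg 13 = ind (p0 ∧ ∀ g < k,
    ¬ SubRest n tab e f (tab e i) (tab f j) g)) (by decide) (by decide) hb hmY
    (by exact fun s' hF => (hc.of_frame hF (by decide)).r2) ?_ ?_ ?_)
  · simpa using h13
  · intro g s' hg hb' hF h10 h13
    have hc' := hc.of_frame hF (by decide)
    have h6' := (hF.reg 6 (by decide)).trans h6
    have h7' := (hF.reg 7 (by decide)).trans h7
    have h11' := (hF.reg 11 (by decide)).trans h11
    have h12' := (hF.reg 12 (by decide)).trans h12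
    have hsub := eval_subRest (u := .reg 11) (w := .reg 12) hc' ((hF.mem (by decide)).trans hm)
      (e := .reg 6) (f := .reg 7) (g := .reg 10) (by simpa [h6']) (by simpa [h7']) (by simpa [h10])
    refine Ter.assign (by decide) hb' ?_ ?_
    · simp only [Expr.eval_and, Expr.eval_not, hsub, one_sub_ind, ind_mul, Expr.eval_reg, h13]
      exact ind_le_one.trans (by omega)
    · simp only [Expr.eval_and, Expr.eval_not, hsub, one_sub_ind, ind_mul, Expr.eval_reg, h13,
        State.setReg_reg, h6', h7', h11', h12', h10]
      intro _ _
      refine ind_congr ?_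
      simp only [Nat.lt_succ_iff_lt_or_eq, or_imp, forall_and, forall_eq, and_assoc]
  · intro s' hF h13 hb' _
    have hc' := hc.of_frame hF (by decide)
    have h11' := (hF.reg 11 (by decide)).trans h11
    have h12' := (hF.reg 12 (by decide)).trans h12
    have hm' := (hF.mem (by decide)).trans hm
    have he : (Expr.or (.relB (.reg 11) (.reg 12)) (.reg 13)).eval s' =
        ind (R (tab e i) (tab f j) ∨ Witness n m tab e f (tab e i) (tab f j)) := by
      refine Expr.eval_or ?_ ?_
      · rw [eval_relB hc' hm' (by simpa [h12'] using htab f j)]; simp [h11', h12']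
      · rw [Expr.eval_reg, h13]
        exact ind_congr (by simp [hp0, Witness, and_assoc])
    refine Ter.store (by decide) (by decide) hb' ?_ ?_
    · rw [he]
      exact ind_le_one.trans (by omega)
    · rw [store_relB hc' hm' (by simpa [h12'] using htab f j)
        (p := Witness n m tab e f (tab e i) (tab f j)) (by simpa [h11', h12'] using he)]
      simp [h11', h12']

end Adjacency

/-! ## The formula of a vertex: output -/

section Clauses

variable (n m : ℕ) (tab : ℕ → ℕ → ℕ) (R : ℕ → ℕ → Prop) (v : ℕ)

open Classical in
/-- The code of the clauses that exclude two nonadjacent neighbours of `v`. -/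
noncomputable def conflictCode : List ℕ :=
  (List.range n).flatMap fun u => (List.range n).flatMap fun w =>
    if (R v u ∧ ¬ v = u) ∧ (R v w ∧ ¬ v = w) ∧ ¬ R u w then [2 * u + 3, 2 * w + 3, 0] else []

open Classical in
/-- The code of the literal for the entry `i` of the row `e`, if it is a neighbour of `v`. -/
noncomputable def literalCode (e i : ℕ) : List ℕ :=
  if R v (tab e i) ∧ ¬ v = tab e i then [2 * tab e i + 2] else []

open Classical in
/-- The code of the clause for the row `e`, if it contains `v`. -/
noncomputable def rowCode (e : ℕ) : List ℕ :=
  if InRow tab e v then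
    literalCode tab R v e 0 ++ literalCode tab R v e 1 ++ literalCode tab R v e 2 ++ [0] else []

open Classical in
/-- The rows among the first `k` ones that contain `v`. -/
noncomputable def incident (k : ℕ) : List ℕ := (List.range k).filter fun e => InRow tab e v

open Classical in
/-- The two entries of the row `e` other than `v`. -/
noncomputable def other (e i : ℕ) : ℕ :=
  if i = 0 then (if tab e 0 = v then tab e 1 else tab e 0)
  else (if tab e 2 = v then tab e 1 else tab e 2)

open DualConf.Expr

/-- Write the clauses that exclude two nonadjacent neighbours of the vertex in register 14. -/
def conflicts : Cmd :=
  .forTo 11 (.reg 1) <| .forTo 12 (.reg 1) <|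
  .when (and (and (relB (.reg 14) (.reg 11)) (not (eq (.reg 14) (.reg 11))))
    (and (and (relB (.reg 14) (.reg 12)) (not (eq (.reg 14) (.reg 12))))
      (not (relB (.reg 11) (.reg 12))))) <|
  .seq (.emit (.add (.mul (.const 2) (.reg 11)) (.const 3))) <|
  .seq (.emit (.add (.mul (.const 2) (.reg 12)) (.const 3))) <|
  .emit (.const 0)

/-- Write the literal for the entry `i` of the row in register 6, if it is a neighbour of the vertex
in register 14. -/
def literal (i : ℕ) : Cmd :=
  .when (and (relB (.reg 14) (vertexAt (.reg 6) (.const i)))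
      (not (eq (.reg 14) (vertexAt (.reg 6) (.const i))))) <|
  .emit (.add (.mul (.const 2) (vertexAt (.reg 6) (.const i))) (.const 2))

/-- Write the clauses for the rows that contain the vertex in register 14, store the other two
entries of each of these rows, and count the rows in register 15. -/
def rows : Cmd :=
  .seq (.assign 15 (.const 0)) <|
  .forTo 6 (.reg 2) <|
  .when (inEdge (.reg 14) (.reg 6)) <|
  .seq (.store (cell 2 (.mul (.const 2) (.reg 15)))
    (cond (eq (vertexAt (.reg 6) (.const 0)) (.reg 14))
      (vertexAt (.reg 6) (.const 1)) (vertexAt (.reg 6) (.const 0)))) <|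
  .seq (.store (cell 2 (.add (.mul (.const 2) (.reg 15)) (.const 1)))
    (cond (eq (vertexAt (.reg 6) (.const 2)) (.reg 14))
      (vertexAt (.reg 6) (.const 1)) (vertexAt (.reg 6) (.const 2)))) <|
  .seq (literal 0) <| .seq (literal 1) <| .seq (literal 2) <| .seq (.emit (.const 0)) <|
  .assign 15 (.add (.reg 15) (.const 1))

variable {n m tab R v} {Y : ℕ} {inp B L M : ℕ → ℕ} {s : State}

/-- A loop whose rounds write to the output. -/
theorem Ter.forTo_out {r : ℕ} {b : Expr} {c : Cmd} {k T : ℕ} (f : ℕ → List ℕ)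
    (hbG : b.Good) (hw : c.writes r = false) (hb : Bdd Y s) (hk : k ≤ Y)
    (hbk : ∀ s', Frame (.forTo r b c) s s' → b.eval s' = k)
    (hstep : ∀ i s', i < k → Bdd Y s' → Frame (.forTo r b c) s s' → s'.reg r = i →
      Ter Y c s' T fun s'' => s''.out = s'.out ++ f i) :
    Ter Y (.forTo r b c) s (2 + k * (T + 2)) fun s' =>
      s'.out = s.out ++ (List.range k).flatMap f := by
  refine Ter.forTo (fun k s' => s'.out = s.out ++ (List.range k).flatMap f) hbG hw hb hk hbk
    (by simp) ?_ (fun s' _ h => h)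
  intro i s' hi hb' hF hr ho
  refine (hstep i s' hi hb' hF hr).mono le_rfl fun s'' _ _ h _ _ => ?_
  rw [State.setReg_out, h, ho, List.range_succ, List.flatMap_append, List.append_assoc]
  simp

theorem conflicts_ter (hb : Bdd Y s) (hc : Ctx n m s) (h14 : s.reg 14 = v)
    (hm : s.mem = lay (4 * m + 2) inp (tbl m tab) (arr (n + 1) R) L M) :
    Ter Y conflicts s (2 + n * ((2 + n * (((1 + (1 + 1)) + 1) + 2)) + 2)) fun s' =>
      s'.out = s.out ++ conflictCode n R v := by
  have h10 := hb.ten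
  have hnY : n ≤ Y := hc.r1 ▸ hb.reg 1
  refine Ter.forTo_out _ (by decide) (by decide) hb hnY
    (by exact fun s' hF => (hc.of_frame hF (by decide)).r1) ?_
  intro u s hu hb hF h11
  replace hc := hc.of_frame hF (by decide)
  replace h14 := (hF.reg 14 (by decide)).trans h14
  replace hm := (hF.mem (by decide)).trans hm
  refine Ter.forTo_out _ (by decide) (by decide) hb hnY
    (by exact fun s' hF => (hc.of_frame hF (by decide)).r1) ?_
  intro w s hw hb hF h12
  replace hc := hc.of_frame hF (by decide)
  replace h14 := (hF.reg 14 (by decide)).trans h14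
  replace h11 := (hF.reg 11 (by decide)).trans h11
  replace hm := (hF.mem (by decide)).trans hm
  have hr : ∀ x y : Expr, y.eval s < n → (Expr.relB x y).eval s = ind (R (x.eval s) (y.eval s)) :=
    fun x y hy => eval_relB hc hm hy.le
  have h1 := hr (.reg 14) (.reg 11) (by simpa [h11])
  have h2 := hr (.reg 14) (.reg 12) (by simpa [h12])
  have h3 := hr (.reg 11) (.reg 12) (by simpa [h12])
  refine Ter.when (by omega) (by decide) hb ?_ ?_
  · intro h
    simp only [eval_and, eval_not, eval_eq, h1, h2, h3, one_sub_ind, ind_mul, ind_pos, eval_reg,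
      h14, h11, h12] at h
    refine Ter.seq (Ter.emit (by decide) hb fun hb _ => ?_)
    refine Ter.seq (T₁ := 1) (T₂ := 1) (Ter.emit (by decide) hb fun hb _ => ?_)
    refine Ter.emit (by decide) hb ?_
    rw [if_pos h]
    simp [h11, h12]
  · intro h
    simp only [eval_and, eval_not, eval_eq, h1, h2, h3, one_sub_ind, ind_mul, ind_eq_zero,
      eval_reg, h14, h11, h12] at h
    rw [if_neg h, List.append_nil]

theorem literal_ter (htab : ∀ j i, tab j i ≤ n) (hb : Bdd Y s) (hc : Ctx n m s)
    (h14 : s.reg 14 = v) {e i : ℕ} (h6 : s.reg 6 = e) (he : e < m) (hi : i < 3)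
    (hm : s.mem = lay (4 * m + 2) inp (tbl m tab) (arr (n + 1) R) L M) :
    Ter Y (literal i) s (1 + 1) fun s' => s'.out = s.out ++ literalCode tab R v e i := by
  have h1 : (vertexAt (.reg 6) (.const i)).eval s = tab e i := by
    rw [eval_vertexAt hc hm (by simpa [h6]) (by simpa)]; simp [h6]
  have h2 := eval_relB (x := .reg 14) (y := vertexAt (.reg 6) (.const i)) hc hm
    (by rw [h1]; exact htab e i)
  rw [literalCode]
  refine Ter.when le_rfl (by interval_cases i <;> decide) hb ?_ ?_
  · intro h
    simp only [eval_and, eval_not, eval_eq, h1, h2, one_sub_ind, ind_mul, ind_pos, eval_reg,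
      h14] at h
    refine Ter.emit (by interval_cases i <;> decide) hb ?_
    rw [if_pos h]
    simp [h1]
  · intro h
    simp only [eval_and, eval_not, eval_eq, h1, h2, one_sub_ind, ind_mul, ind_eq_zero,
      eval_reg, h14] at h
    rw [if_neg h, List.append_nil]

theorem other_le (htab : ∀ j i, tab j i ≤ n) (e i : ℕ) : other tab v e i ≤ n := by
  unfold other
  split_ifs <;> apply htab

theorem length_incident_le (k : ℕ) : (incident tab v k).length ≤ k := by
  classical
  exact (List.length_filter_le _ _).trans_eq List.length_range

/-- `L` lists, for each row in `l`, the two entries other than `v`. -/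
def ListsOthers (tab : ℕ → ℕ → ℕ) (v : ℕ) (l : List ℕ) (L : ℕ → ℕ) : Prop :=
  ∀ i < l.length, L (2 * i) = other tab v (l.getD i 0) 0 ∧
    L (2 * i + 1) = other tab v (l.getD i 0) 1

-- One scan both writes the clauses and stores the options, at constant cost per hyperedge. The
-- compatibility matrix `M` is not touched.
open Classical in
theorem rows_ter (htab : ∀ j i, tab j i ≤ n) (hb : Bdd Y s) (hc : Ctx n m s) (h14 : s.reg 14 = v)
    (hm : s.mem = lay (4 * m + 2) inp (tbl m tab) (arr (n + 1) R) L M) :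
    Ter Y rows s (1 + (2 + m * (((1 + (1 + ((1 + 1) + ((1 + 1) + ((1 + 1) + (1 + 1)))))) + 1) + 2)))
      fun s' => s'.out = s.out ++ (List.range m).flatMap (rowCode tab R v) ∧
        s'.reg 15 = (incident tab v m).length ∧
        ∃ L', s'.mem = lay (4 * m + 2) inp (tbl m tab) (arr (n + 1) R) L' M ∧
          ListsOthers tab v (incident tab v m) L' := by
  have h10 := hb.ten
  have hmY : m ≤ Y := hc.r2 ▸ hb.reg 2
  have hnY : n ≤ Y := hc.r1 ▸ hb.reg 1
  refine Ter.seq (Ter.assign (by decide) hb (by simp) fun hb hF => ?_)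
  have ho : s.out = (s.setReg 15 ((const 0).eval s)).out := rfl
  replace hm : (s.setReg 15 ((const 0).eval s)).mem = _ := hm
  replace hc := hc.of_frame hF (by decide)
  replace h14 := (hF.reg 14 (by decide)).trans h14
  have h15 : (s.setReg 15 ((const 0).eval s)).reg 15 = 0 := by simp
  rw [ho]
  generalize s.setReg 15 ((const 0).eval s) = s at *
  refine Ter.forTo (fun k s' => s'.out = s.out ++ (List.range k).flatMap (rowCode tab R v) ∧
    s'.reg 15 = (incident tab v k).length ∧
    ∃ L', s'.mem = lay (4 * m + 2) inp (tbl m tab) (arr (n + 1) R) L' M ∧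
      ListsOthers tab v (incident tab v k) L') (by decide) (by decide) hb hmY
    (by exact fun s' hF => (hc.of_frame hF (by decide)).r2) ?_ ?_ (fun s' _ h => h)
  · refine ⟨by simp, by simp [h15, incident], L, hm, ?_⟩
    intro i hi
    simp [incident] at hi
  rintro e s₁ he hb hF h6 ⟨ho, h15, L₁, hm, hL⟩
  replace hc := hc.of_frame hF (by decide)
  replace h14 := (hF.reg 14 (by decide)).trans h14
  have hle := length_incident_le (tab := tab) (v := v) e
  have hin := eval_inEdge (x := .reg 14) (j := .reg 6) hc hm (by simpa [h6])
  -- Stated for arbitrary `B`, `L`, `M`, because the option array changes between the reads.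
  have htabE : ∀ s₂ : State, Ctx n m s₂ → s₂.reg 6 = e → ∀ {B L M : ℕ → ℕ},
      s₂.mem = lay (4 * m + 2) inp (tbl m tab) B L M → ∀ i < 3,
      (vertexAt (.reg 6) (.const i)).eval s₂ = tab e i := by
    intro s₂ hc h6 B L M hm i hi
    rw [eval_vertexAt hc hm (by simpa [h6]) (by simpa)]; simp [h6]
  have hsucc : (incident tab v (e + 1)) =
      incident tab v e ++ (if InRow tab e v then [e] else []) := by
    simp only [incident, List.range_succ, List.filter_append, List.filter_singleton]
    split_ifs <;> simp_all
  refine Ter.when (by omega) (by decide) hb ?_ ?_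
  · intro h
    simp only [hin, ind_pos, eval_reg, h6, h14] at h
    have hv1 : (cond (eq (vertexAt (.reg 6) (.const 0)) (.reg 14))
        (vertexAt (.reg 6) (.const 1)) (vertexAt (.reg 6) (.const 0))).eval s₁ =
        other tab v e 0 := by
      rw [eval_cond (eval_eq _ _ _), htabE s₁ hc h6 hm 0 (by omega), htabE s₁ hc h6 hm 1 (by omega),
        eval_reg, h14, other, if_pos rfl]
      split_ifs <;> rfl
    refine Ter.seq (Ter.store (by decide) (by decide) hb ?_ fun hb hF => ?_)
    · rw [hv1]; exact (other_le htab e 0).trans hnY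
    rw [hv1] at hb hF ⊢
    have hm2 : (s₁.setMem ((cell 2 (.mul (.const 2) (.reg 15))).eval s₁) (other tab v e 0)).mem =
        lay (4 * m + 2) inp (tbl m tab) (arr (n + 1) R)
          (Function.update L₁ (2 * (incident tab v e).length) (other tab v e 0)) M := by
      simp only [cell, eval_add, eval_mul, eval_reg, eval_const, hc.r3, h15, State.setMem_mem, hm,
        update_lay_L]
    have ho2 : (s₁.setMem ((cell 2 (.mul (.const 2) (.reg 15))).eval s₁) (other tab v e 0)).out =
      _ := ho
    replace hc := hc.of_frame hF (by decide)
    replace h14 := (hF.reg 14 (by decide)).trans h14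
    replace h15 := (hF.reg 15 (by decide)).trans h15
    replace h6 := (hF.reg 6 (by decide)).trans h6
    clear hv1
    generalize s₁.setMem ((cell 2 (.mul (.const 2) (.reg 15))).eval s₁) (other tab v e 0) = s₂ at *
    have hv2 : (cond (eq (vertexAt (.reg 6) (.const 2)) (.reg 14))
        (vertexAt (.reg 6) (.const 1)) (vertexAt (.reg 6) (.const 2))).eval s₂ =
        other tab v e 1 := by
      rw [eval_cond (eval_eq _ _ _), htabE s₂ hc h6 hm2 1 (by omega),
        htabE s₂ hc h6 hm2 2 (by omega), eval_reg, h14]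
      simp only [other, one_ne_zero, if_false]
      split_ifs <;> rfl
    refine Ter.seq (T₁ := 1) (T₂ := (1 + 1) + ((1 + 1) + ((1 + 1) + (1 + 1)))) (Ter.store (by decide) (by decide) hb ?_ fun hb hF => ?_)
    · rw [hv2]; exact (other_le htab e 1).trans hnY
    rw [hv2] at hb hF ⊢
    have hm3 : (s₂.setMem ((cell 2 (.add (.mul (.const 2) (.reg 15)) (.const 1))).eval s₂)
        (other tab v e 1)).mem =
        lay (4 * m + 2) inp (tbl m tab) (arr (n + 1) R)
          (Function.update (Function.update L₁ (2 * (incident tab v e).length) (other tab v e 0))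
            (2 * (incident tab v e).length + 1) (other tab v e 1)) M := by
      simp only [cell, eval_add, eval_mul, eval_reg, eval_const, hc.r3, h15, State.setMem_mem, hm2,
        update_lay_L]
    have ho3 : (s₂.setMem ((cell 2 (.add (.mul (.const 2) (.reg 15)) (.const 1))).eval s₂)
        (other tab v e 1)).out = _ := ho2
    replace hc := hc.of_frame hF (by decide)
    replace h14 := (hF.reg 14 (by decide)).trans h14
    replace h15 := (hF.reg 15 (by decide)).trans h15
    replace h6 := (hF.reg 6 (by decide)).trans h6
    clear hv2
    generalize s₂.setMem ((cell 2 (.add (.mul (.const 2) (.reg 15)) (.const 1))).eval s₂)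
        (other tab v e 1) = s₃ at *
    clear ho ho2 hm hm2 hF
    refine Ter.seq ((literal_ter htab hb hc h14 h6 he (by omega) hm3).mono le_rfl ?_)
    intro s₄ hb hF ho4 _ _
    replace hc := hc.of_frame hF (by decide)
    replace h14 := (hF.reg 14 (by decide)).trans h14
    replace h15 := (hF.reg 15 (by decide)).trans h15
    replace h6 := (hF.reg 6 (by decide)).trans h6
    have hm4 := (hF.mem (by decide)).trans hm3
    refine Ter.seq ((literal_ter htab hb hc h14 h6 he (by omega) hm4).mono le_rfl ?_)
    intro s₅ hb hF ho5 _ _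
    replace hc := hc.of_frame hF (by decide)
    replace h14 := (hF.reg 14 (by decide)).trans h14
    replace h15 := (hF.reg 15 (by decide)).trans h15
    replace h6 := (hF.reg 6 (by decide)).trans h6
    have hm5 := (hF.mem (by decide)).trans hm4
    refine Ter.seq ((literal_ter htab hb hc h14 h6 he (by omega) hm5).mono le_rfl ?_)
    intro s₆ hb hF ho6 _ _
    replace hc := hc.of_frame hF (by decide)
    replace h15 := (hF.reg 15 (by decide)).trans h15
    have hm6 := (hF.mem (by decide)).trans hm5
    refine Ter.seq (Ter.emit (by decide) hb fun hb hF => ?_)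
    refine Ter.assign (by decide) hb ?_ ?_
    · simp [h15]; omega
    intro _ _
    refine ⟨?_, ?_, _, hm6, ?_⟩
    · simp [ho6, ho5, ho4, ho3, List.range_succ, rowCode, h]
    · simp [h15, hsucc, h]
    -- The two new options lie just beyond those of the earlier rows, which therefore survive both
    -- updates.
    · rw [hsucc, if_pos h]
      intro i hi
      rw [List.length_append, List.length_singleton] at hi
      rcases Nat.lt_succ_iff_lt_or_eq.1 hi with hi | rfl
      · rw [List.getD_append _ _ _ _ hi]
        have := hL i hi
        rw [Function.update_of_ne (by omega), Function.update_of_ne (by omega),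
          Function.update_of_ne (by omega), Function.update_of_ne (by omega)]
        exact this
      · rw [List.getD_append_right _ _ _ _ le_rfl]
        rw [Function.update_of_ne (by omega)]
        simp
  · intro h
    simp only [hin, ind_eq_zero, eval_reg, h6, h14] at h
    intro _ _
    refine ⟨?_, ?_, L₁, hm, ?_⟩
    · simp [ho, List.range_succ, rowCode, h]
    · simp [h15, hsucc, h]
    · simpa [hsucc, h] using hL

end Clauses

/-! ## The formula of a vertex: satisfiability -/

section Elimination

open DualConf.Expr

/-- Fill the compatibility matrix with the expression `e`. -/
def matrix (e : Expr) : Cmd :=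
  .forTo 16 (.add (.mul (.const 2) (.reg 15)) (.const 1)) <|
  .forTo 17 (.add (.mul (.const 2) (.reg 15)) (.const 1)) <|
  .store (cellM (.reg 16) (.reg 17)) e

/-- The option number `2 * i + k` for the row in register 10 is compatible with itself and with the
options in registers 16 and 17. -/
def extendsBoth (k : ℕ) : Expr :=
  and (relM (.reg 16) (.add (.mul (.const 2) (.reg 10)) (.const k)))
    (and (relM (.reg 17) (.add (.mul (.const 2) (.reg 10)) (.const k)))
      (relM (.add (.mul (.const 2) (.reg 10)) (.const k))
        (.add (.mul (.const 2) (.reg 10)) (.const k))))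

/-- Eliminate the choice of an option for the row in register 10. -/
def eliminate : Cmd :=
  matrix (and (relM (.reg 16) (.reg 17))
    (or (not (and (lt (.add (.mul (.const 2) (.reg 10)) (.const 1)) (.reg 16))
      (lt (.add (.mul (.const 2) (.reg 10)) (.const 1)) (.reg 17)))) (or (extendsBoth 0) (extendsBoth 1))))

/-- Decide whether there are compatible options for the rows through the vertex in register 14. -/
def solve : Cmd :=
  .seq (.store (cell 2 (.mul (.const 2) (.reg 15))) (.reg 14)) <|
  .seq (matrix (relB (optAt (.reg 16)) (optAt (.reg 17)))) <|
  .forTo 10 (.reg 15) eliminate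

/-- The option `x` extends the options `p` and `q`. -/
def Extends (R : ℕ → ℕ → Prop) (x p q : ℕ) : Prop := R p x ∧ R q x ∧ R x x

/-- The relation after elimination of the options `2 * g` and `2 * g + 1`. -/
def elim (g : ℕ) (R : ℕ → ℕ → Prop) (p q : ℕ) : Prop :=
  R p q ∧ (¬ (2 * g + 1 < p ∧ 2 * g + 1 < q) ∨
    (Extends R (2 * g + 0) p q ∨ Extends R (2 * g + 1) p q))

/-- The relation after elimination of the first `2 * g` options. -/
def elims (R : ℕ → ℕ → Prop) : ℕ → ℕ → ℕ → Prop
  | 0 => R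
  | g + 1 => elim g (elims R g)

/-- The stored matrix is controlled only on the indices in use; elimination reads no others. -/
theorem elim_congr {R R' : ℕ → ℕ → Prop} {g k : ℕ} (hg : 2 * g + 1 < k)
    (h : ∀ a < k, ∀ b < k, R a b ↔ R' a b) {p q : ℕ} (hp : p < k) (hq : q < k) :
    elim g R p q ↔ elim g R' p q := by
  have h0 : 2 * g + 0 < k := by omega
  simp only [elim, Extends, h p hp q hq, h _ hp _ hg, h _ hp _ h0, h _ hq _ hg, h _ hq _ h0,
    h _ hg _ hg, h _ h0 _ h0]

variable {n m Y : ℕ} {tab : ℕ → ℕ → ℕ} {inp E B L M : ℕ → ℕ} {R : ℕ → ℕ → Prop} {s : State}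

theorem eval_relM (hc : Ctx n m s)
    (hm : s.mem = lay (4 * m + 2) inp E B L (arr (2 * m + 1) R)) {x y : Expr}
    (hy : y.eval s < 2 * m + 1) : (relM x y).eval s = ind (R (x.eval s) (y.eval s)) := by
  simp only [relM, cellM, cell, eval_load, eval_add, eval_mul, eval_reg,
    eval_const, hc.r3, hc.r4, hm, lay_M]
  rw [arr_apply hy]

theorem store_relM (hc : Ctx n m s)
    (hm : s.mem = lay (4 * m + 2) inp E B L (arr (2 * m + 1) R)) {x y e : Expr} {p : Prop}
    (hy : y.eval s < 2 * m + 1) (he : e.eval s = ind p) :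
    (s.setMem ((cellM x y).eval s) (e.eval s)).mem = lay (4 * m + 2) inp E B L
      (arr (2 * m + 1) fun a b => a = x.eval s ∧ b = y.eval s ∧ p ∨
        ¬ (a = x.eval s ∧ b = y.eval s) ∧ R a b) := by
  simp only [cellM, cell, eval_add, eval_mul, eval_reg, eval_const, hc.r3, hc.r4, hm,
    State.setMem_mem, he]
  rw [update_lay_M, arr_update hy]

/-- `T` on the pairs with `D`, and `R` on the others. -/
def mix (D T R : ℕ → ℕ → Prop) (a b : ℕ) : Prop := D a b ∧ T a b ∨ ¬ D a b ∧ R a b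

/-- The matrix is overwritten in place, so `e` may meet old and new entries. The hypothesis `hev`
offers what is certain: each entry is that of `R` or of `T`, and the current one is still that of
`R`. -/
theorem matrix_ter {e : Expr} {d : ℕ} (T : ℕ → ℕ → Prop) (he : e.Good) (hd : d ≤ m)
    (hY : 2 * m + 1 ≤ Y) (hb : Bdd Y s) (hc : Ctx n m s) (h15 : s.reg 15 = d)
    (hm : s.mem = lay (4 * m + 2) inp E B L (arr (2 * m + 1) R))
    (hev : ∀ s' p q R', p < 2 * d + 1 → q < 2 * d + 1 → Frame (matrix e) s s' → s'.reg 16 = p →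
      s'.reg 17 = q → s'.mem = lay (4 * m + 2) inp E B L (arr (2 * m + 1) R') →
      (∀ a b, (R' a b ↔ R a b) ∨ (R' a b ↔ T a b)) → (R' p q ↔ R p q) →
      e.eval s' = ind (T p q)) :
    Ter Y (matrix e) s (2 + (2 * d + 1) * ((2 + (2 * d + 1) * (1 + 2)) + 2)) fun s' =>
      ∃ R', s'.mem = lay (4 * m + 2) inp E B L (arr (2 * m + 1) R') ∧
        ∀ a < 2 * d + 1, ∀ b < 2 * d + 1, R' a b ↔ T a b := by
  have h10 := hb.ten
  refine Ter.forTo (fun p s' => s'.mem = lay (4 * m + 2) inp E B L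
    (arr (2 * m + 1) (mix (fun a b => a < p ∧ b < 2 * d + 1) T R))) (by decide) rfl
    hb (by omega) ?_ ?_ ?_ ?_
  · intro s' hF
    simp [(hF.reg 15 rfl).trans h15]
  · have : mix (fun a b => a < 0 ∧ b < 2 * d + 1) T R = R := by funext; simp [mix]
    rw [State.setReg_mem, this, hm]
  · intro p s₁ hp hb hF₁ h16 hm
    have hc₁ := hc.of_frame hF₁ rfl
    have h15₁ := (hF₁.reg 15 rfl).trans h15
    refine Ter.forTo (fun q s' => s'.mem = lay (4 * m + 2) inp E B L
      (arr (2 * m + 1) (mix (fun a b => a < p ∧ b < 2 * d + 1 ∨ a = p ∧ b < q) T R))) (by decide)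
      rfl hb (by omega) ?_ ?_ ?_ ?_
    · intro s' hF
      simp [(hF.reg 15 rfl).trans h15₁]
    · simp [hm]
    · intro q s₂ hq hb hF₂ h17 hm
      have hc₂ := hc₁.of_frame hF₂ rfl
      have h16₂ := (hF₂.reg 16 rfl).trans h16
      have hv := hev s₂ p q _ hp hq (hF₁.trans (hF₂.mono (by simp +contextual [Cmd.writes,
        Cmd.forTo]) (by simp [Cmd.stores, Cmd.forTo]) (by simp [Cmd.emits, Cmd.forTo]))) h16₂ h17 hm (fun a b => by unfold mix; tauto) (by simp [mix])
      refine Ter.store (by decide) he hb ?_ ?_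
      · rw [hv]; exact ind_le_one.trans (by omega)
      · intro _ _
        rw [State.setReg_mem, store_relM hc₂ hm (by simp [h17]; omega) hv]
        congr 2
        funext a b
        simp only [eval_reg, h16₂, h17, mix, eq_iff_iff]
        by_cases ha : a = p
        · subst ha
          by_cases hbq : b = q
          · subst hbq; simp
          · have : b < q + 1 ↔ b < q := by omega
            simp [hbq, this]
        · simp [ha]
    · intro s' _ hm' _ _
      rw [State.setReg_mem, hm']
      congr 2
      funext a b
      have : (a < p ∧ b < 2 * d + 1 ∨ a = p ∧ b < 2 * d + 1) ↔ a < p + 1 ∧ b < 2 * d + 1 := by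
        omega
      simp only [mix, this]
  · intro s' _ hm'
    refine ⟨_, hm', fun a ha b hb => ?_⟩
    simp [mix, ha, hb]

/-- In-place updating is harmless: elimination alters only pairs with both indices above `2 * g +
1`, while the extension test reads only entries whose second index is `2 * g` or `2 * g + 1`. -/
theorem eliminate_ter {d g : ℕ} (hg : g < d) (hd : d ≤ m) (hY : 2 * m + 1 ≤ Y) (hb : Bdd Y s)
    (hc : Ctx n m s) (h15 : s.reg 15 = d) (h10 : s.reg 10 = g)
    (hm : s.mem = lay (4 * m + 2) inp E B L (arr (2 * m + 1) R)) :
    Ter Y eliminate s (2 + (2 * d + 1) * ((2 + (2 * d + 1) * (1 + 2)) + 2)) fun s' =>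
      ∃ R', s'.mem = lay (4 * m + 2) inp E B L (arr (2 * m + 1) R') ∧
        ∀ a < 2 * d + 1, ∀ b < 2 * d + 1, R' a b ↔ elim g R a b := by
  refine matrix_ter _ (by decide) hd hY hb hc h15 hm ?_
  intro s p q R' hp hq hF h16 h17 hm hR' hpq
  replace hc := hc.of_frame hF (by decide)
  replace h10 := (hF.reg 10 (by decide)).trans h10
  -- Entries whose second index belongs to row `g` or earlier are fixed by `elim g`, so it does not
  -- matter whether they have been rewritten.
  have hrel : ∀ a x, x ≤ 2 * g + 1 → (R' a x ↔ R a x) := by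
    intro a x hx
    refine (hR' a x).elim id fun h => h.trans ?_
    have : ¬ (2 * g + 1 < a ∧ 2 * g + 1 < x) := by omega
    simp [elim, this]
  have hex : ∀ k < 2, (extendsBoth k).eval s = ind (Extends R (2 * g + k) p q) := by
    intro k hk
    have hy : (Expr.add (.mul (.const 2) (.reg 10)) (.const k)).eval s = 2 * g + k := by simp [h10]
    simp only [extendsBoth, eval_and]
    rw [eval_relM hc hm (by omega), eval_relM hc hm (by omega), eval_relM hc hm (by omega)]
    simp only [hy, eval_reg, h16, h17, ind_mul, hrel _ (2 * g + k) (by omega), Extends]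
  rw [eval_and, eval_relM hc hm (by simp [h17]; omega),
    eval_or (p := ¬ (2 * g + 1 < p ∧ 2 * g + 1 < q)) (by simp [h10, h16, h17])
      (eval_or (hex 0 (by omega)) (hex 1 (by omega))), eval_reg, eval_reg, h16, h17, ind_mul, hpq,
    elim]

/-- The compatibility of two options, where the last option is the vertex `v`. -/
def Compat (R : ℕ → ℕ → Prop) (L : ℕ → ℕ) (p q : ℕ) : Prop := R (L p) (L q)

/-- Placing `v` as option `2 * d` makes compatibility with `v` part of the same matrix. Outside the
first `2 * d + 1` indices the matrix may contain leftovers from other vertices, so nothing is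
claimed there. -/
theorem solve_ter {d v : ℕ} (hd : d ≤ m) (hY : 2 * m + 1 ≤ Y) (hb : Bdd Y s) (hv : v ≤ n)
    (hL : ∀ p < 2 * d, L p ≤ n)
    (hc : Ctx n m s) (h15 : s.reg 15 = d) (h14 : s.reg 14 = v)
    (hm : s.mem = lay (4 * m + 2) inp E (arr (n + 1) R) L (arr (2 * m + 1) M')) :
    Ter Y solve s (1 + ((2 + (2 * d + 1) * ((2 + (2 * d + 1) * (1 + 2)) + 2)) +
      (2 + d * ((2 + (2 * d + 1) * ((2 + (2 * d + 1) * (1 + 2)) + 2)) + 2)))) fun s' =>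
      ∃ R', s'.mem = lay (4 * m + 2) inp E (arr (n + 1) R) (Function.update L (2 * d) v)
        (arr (2 * m + 1) R') ∧ ∀ a < 2 * d + 1, ∀ b < 2 * d + 1,
          R' a b ↔ elims (Compat R (Function.update L (2 * d) v)) d a b := by
  have hr14 := hb.reg 14
  refine Ter.seq (Ter.store (by decide) (by decide) hb (by simpa using hr14) fun hb hF => ?_)
  have hm1 : (s.setMem ((cell 2 (.mul (.const 2) (.reg 15))).eval s) ((Expr.reg 14).eval s)).mem =
      lay (4 * m + 2) inp E (arr (n + 1) R) (Function.update L (2 * d) v)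
        (arr (2 * m + 1) M') := by
    simp only [cell, eval_add, eval_mul, eval_reg, eval_const, hc.r3, h15, State.setMem_mem, hm,
      h14, update_lay_L]
  replace hc := hc.of_frame hF (by decide)
  replace h15 := (hF.reg 15 (by decide)).trans h15
  generalize s.setMem ((cell 2 (.mul (.const 2) (.reg 15))).eval s) ((Expr.reg 14).eval s) = s at *
  have hL' : ∀ p < 2 * d + 1, Function.update L (2 * d) v p ≤ n := by
    intro p hp
    rw [Function.update_apply]
    split_ifs with h
    · exact hv
    · exact hL p (by omega)
  generalize Function.update L (2 * d) v = L at *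
  refine Ter.seq ((matrix_ter (Compat R L) (by decide) hd hY hb hc h15 hm1 ?_).mono le_rfl ?_)
  · intro s p q R' hp hq hF h16 h17 hm _ _
    have hopt : ∀ x : Expr, (optAt x).eval s = L (x.eval s) := by
      intro x
      simp only [optAt, cell, eval_load, eval_add, eval_mul, eval_reg, eval_const,
        (hc.of_frame hF (by decide)).r3, hm, lay_L]
    have : (relB (optAt (.reg 16)) (optAt (.reg 17))).eval s =
        ind (R ((optAt (.reg 16)).eval s) ((optAt (.reg 17)).eval s)) := by
      have hc := hc.of_frame hF (by decide)
      have hy : (optAt (.reg 17)).eval s ≤ n := by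
        rw [hopt, eval_reg, h17]; exact hL' q hq
      rw [relB]
      simp only [cell, eval_load, eval_add, eval_mul, eval_const, eval_reg, hc.r3, hm, lay_B]
      rw [hc.r1, arr_apply (by omega)]
    rw [this, hopt, hopt, eval_reg, eval_reg, h16, h17, Compat]
  · rintro s₁ hb hF ⟨R₁, hm, hR₁⟩ _ _
    replace hc := hc.of_frame hF (by decide)
    replace h15 := (hF.reg 15 (by decide)).trans h15
    refine Ter.forTo (fun g s' => ∃ R', s'.mem = lay (4 * m + 2) inp E (arr (n + 1) R) L
      (arr (2 * m + 1) R') ∧ ∀ a < 2 * d + 1, ∀ b < 2 * d + 1, R' a b ↔ elims (Compat R L) g a b)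
      (by decide) (by decide) hb (by omega)
      (by exact fun s' hF => (hF.reg 15 (by decide)).trans h15) ⟨R₁, hm, hR₁⟩ ?_ (fun s' _ h => h)
    rintro g s₂ hg hb hF h10 ⟨R₂, hm, hR₂⟩
    refine (eliminate_ter hg hd hY hb (hc.of_frame hF (by decide))
      ((hF.reg 15 (by decide)).trans h15) h10 hm).mono le_rfl ?_
    rintro s₃ _ _ ⟨R₃, hm, hR₃⟩ _ _
    refine ⟨R₃, hm, fun a ha b hb => (hR₃ a ha b hb).trans ?_⟩
    exact elim_congr (by omega) hR₂ ha hb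

end Elimination

/-! ## The programs -/

section Programs

open DualConf.Expr

variable {n m Y D : ℕ} {tab : ℕ → ℕ → ℕ} {inp B L M : ℕ → ℕ} {R : ℕ → ℕ → Prop} {s : State}

/-- The vertex of the option number `p`: two options for each row through `v`, and then `v`. -/
noncomputable def optionOf (m : ℕ) (tab : ℕ → ℕ → ℕ) (v p : ℕ) : ℕ :=
  if p = 2 * (incident tab v m).length then v
  else other tab v ((incident tab v m).getD (p / 2) 0) (p % 2)

/-- The elimination of all options except `v` leaves `v` compatible with itself. -/
def Solvable (m : ℕ) (tab : ℕ → ℕ → ℕ) (R : ℕ → ℕ → Prop) (v : ℕ) : Prop :=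
  elims (Compat R (optionOf m tab v)) (incident tab v m).length
    (2 * (incident tab v m).length) (2 * (incident tab v m).length)

/-- The output for the vertex `v`. -/
noncomputable def vertexCode (n m : ℕ) (tab : ℕ → ℕ → ℕ) (R : ℕ → ℕ → Prop) (v : ℕ) : List ℕ :=
  conflictCode n R v ++ (List.range m).flatMap (rowCode tab R v) ++ [1] ++
    [ind (Solvable m tab R v)]

/-- Write and solve the formula of the vertex in register 14. -/
def vertexStep : Cmd :=
  .seq conflicts <| .seq rows <| .seq (.emit (.const 1)) <| .seq solve <|
  .seq (.emit (relM (.mul (.const 2) (.reg 15)) (.mul (.const 2) (.reg 15)))) <|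
  .assign 0 (or (.reg 0) (relM (.mul (.const 2) (.reg 15)) (.mul (.const 2) (.reg 15))))

/-- Write and solve the formulas of all vertices. -/
def testProgram : Cmd := .seq parse <| .seq adjacency <| .forTo 14 (.reg 1) vertexStep

/-- The vertices in registers 11, 12, 13 are equal or adjacent, and they are not equal or adjacent to
the first, second, and third vertex of the hyperedge in register 6, respectively. -/
def avoidsTest : Expr :=
  and (and (relB (.reg 11) (.reg 12)) (and (relB (.reg 11) (.reg 13)) (relB (.reg 12) (.reg 13))))
    (and (not (relB (.reg 11) (vertexAt (.reg 6) (.const 0))))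
      (and (not (relB (.reg 12) (vertexAt (.reg 6) (.const 1))))
        (not (relB (.reg 13) (vertexAt (.reg 6) (.const 2))))))

/-- Search a hyperedge and three equal or adjacent vertices that are not equal or adjacent to the
first, second, and third vertex of the hyperedge, respectively. -/
def cliques : Cmd :=
  .forTo 6 (.reg 2) <| .forTo 11 (.reg 1) <| .forTo 12 (.reg 1) <| .forTo 13 (.reg 1) <|
  .assign 0 (or (.reg 0) avoidsTest)

/-- Decide dual conformality. -/
def conformalProgram : Cmd :=
  .seq testProgram <| .seq cliques <| .assign 0 (not (.reg 0))

theorem elims_congr {R R' : ℕ → ℕ → Prop} {d k : ℕ} (hd : 2 * d ≤ k)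
    (h : ∀ a < k, ∀ b < k, R a b ↔ R' a b) {p q : ℕ} (hp : p < k) (hq : q < k) :
    elims R d p q ↔ elims R' d p q := by
  induction d generalizing p q with
  | zero => exact h p hp q hq
  | succ d ih =>
    exact elim_congr (by omega) (fun a ha b hb => ih (by omega) ha hb) hp hq

/-- The time for the elimination with `d` rows. -/
def solveTime (d : ℕ) : ℕ := 1 + ((2 + (2 * d + 1) * ((2 + (2 * d + 1) * (1 + 2)) + 2)) +
  (2 + d * ((2 + (2 * d + 1) * ((2 + (2 * d + 1) * (1 + 2)) + 2)) + 2)))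

theorem solveTime_mono {d d' : ℕ} (h : d ≤ d') : solveTime d ≤ solveTime d' := by
  unfold solveTime
  gcongr

/-- The time for one vertex. -/
def vertexTime (n m d : ℕ) : ℕ := (2 + n * ((2 + n * (((1 + (1 + 1)) + 1) + 2)) + 2)) +
  ((1 + (2 + m * (((1 + (1 + ((1 + 1) + ((1 + 1) + ((1 + 1) + (1 + 1)))))) + 1) + 2))) +
    (1 + (solveTime d + (1 + 1))))

/-- Only the solving phase depends on the number of hyperedges through `v`; `D` is a bound common to
all vertices. -/
theorem vertexStep_ter {v : ℕ} {M : ℕ → ℕ → Prop} {p : Prop} (htab : ∀ j i, tab j i ≤ n)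
    (hv : v < n)
    (hD : (incident tab v m).length ≤ D) (hY : 2 * m + 1 ≤ Y) (hb : Bdd Y s) (hc : Ctx n m s)
    (h14 : s.reg 14 = v) (h0 : s.reg 0 = ind p)
    (hm : s.mem = lay (4 * m + 2) inp (tbl m tab) (arr (n + 1) R) L (arr (2 * m + 1) M)) :
    Ter Y vertexStep s (vertexTime n m D) fun s' =>
      s'.out = s.out ++ vertexCode n m tab R v ∧ s'.reg 0 = ind (p ∨ Solvable m tab R v) ∧
      ∃ L' M', s'.mem = lay (4 * m + 2) inp (tbl m tab) (arr (n + 1) R) L'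
        (arr (2 * m + 1) M') := by
  have h10 := hb.ten
  refine Ter.seq ((conflicts_ter hb hc h14 hm).mono le_rfl ?_)
  intro s₁ hb hF ho₁ _ _
  replace hc := hc.of_frame hF (by decide)
  replace h14 := (hF.reg 14 (by decide)).trans h14
  replace h0 := (hF.reg 0 (by decide)).trans h0
  replace hm := (hF.mem (by decide)).trans hm
  refine Ter.seq ((rows_ter htab hb hc h14 hm).mono le_rfl ?_)
  rintro s₂ hb hF ⟨ho₂, h15, L₂, hm₂, hL₂⟩ _ _
  replace hc := hc.of_frame hF (by decide)
  replace h14 := (hF.reg 14 (by decide)).trans h14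
  replace h0 := (hF.reg 0 (by decide)).trans h0
  clear hm
  refine Ter.seq (T₁ := 1) (T₂ := solveTime D + (1 + 1)) (Ter.emit (by decide) hb fun hb hF => ?_)
  replace hc := hc.of_frame hF (by decide)
  replace h14 := (hF.reg 14 (by decide)).trans h14
  replace h0 := (hF.reg 0 (by decide)).trans h0
  replace h15 := (hF.reg 15 (by decide)).trans h15
  have hm₃ := (hF.mem (by decide)).trans hm₂
  have ho₃ : (s₂.addOut ((Expr.const 1).eval s₂)).out = s₂.out ++ [1] := rfl
  generalize s₂.addOut ((Expr.const 1).eval s₂) = s₃ at *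
  have hd := length_incident_le (tab := tab) (v := v) m
  set d := (incident tab v m).length with hd_def
  have hL : ∀ p < 2 * d, L₂ p = optionOf m tab v p := by
    intro p hp
    rw [optionOf, if_neg (by omega)]
    obtain ⟨h1, h2⟩ := hL₂ (p / 2) (by omega)
    rcases Nat.mod_two_eq_zero_or_one p with h | h
    · rw [h, ← h1]; congr 1; omega
    · rw [h, ← h2]; congr 1; omega
  have hLn : ∀ p < 2 * d, L₂ p ≤ n := by
    intro p hp
    rw [hL p hp, optionOf, if_neg (by omega)]
    exact other_le htab _ _
  refine Ter.seq ((solve_ter hd hY hb hv.le hLn hc h15 h14 hm₃).mono (solveTime_mono hD) ?_)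
  rintro s₄ hb hF ⟨R', hm₄, hR'⟩ _ _
  replace hc := hc.of_frame hF (by decide)
  replace h0 := (hF.reg 0 (by decide)).trans h0
  replace h15 := (hF.reg 15 (by decide)).trans h15
  have ho₄ := (hF.out (by decide)).trans ho₃
  have hsol : R' (2 * d) (2 * d) ↔ Solvable m tab R v := by
    rw [hR' _ (by omega) _ (by omega), Solvable, ← hd_def]
    refine elims_congr (k := 2 * d + 1) (by omega) (fun a ha b hb => ?_) (by omega) (by omega)
    have hopt : ∀ a < 2 * d + 1, Function.update L₂ (2 * d) v a = optionOf m tab v a := by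
      intro a ha
      rw [Function.update_apply]
      split_ifs with h
      · rw [optionOf, if_pos h]
      · exact hL a (by omega)
    rw [Compat, Compat, hopt a ha, hopt b hb]
  have hrel : ∀ s : State, s.reg 15 = d → Ctx n m s → s.mem = s₄.mem →
      (relM (.mul (.const 2) (.reg 15)) (.mul (.const 2) (.reg 15))).eval s =
        ind (Solvable m tab R v) := by
    intro s h15 hc hm
    rw [eval_relM hc (hm.trans hm₄) (by simp [h15]; omega)]
    simp [h15, hsol]
  refine Ter.seq (T₁ := 1) (T₂ := 1) (Ter.emit (by decide) hb fun hb hF => ?_)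
  rw [hrel s₄ h15 hc rfl] at hb hF ⊢
  have ho₅ : (s₄.addOut (ind (Solvable m tab R v))).out =
    s₄.out ++ [ind (Solvable m tab R v)] := rfl
  replace hc := hc.of_frame hF (by decide)
  replace h0 := (hF.reg 0 (by decide)).trans h0
  replace h15 := (hF.reg 15 (by decide)).trans h15
  have hm₅ := hF.mem (by decide)
  generalize s₄.addOut (ind (Solvable m tab R v)) = s₅ at *
  have hor := eval_or (a := .reg 0) h0 (hrel s₅ h15 hc hm₅)
  refine Ter.assign (by decide) hb ?_ ?_
  · rw [hor]; exact ind_le_one.trans (by omega)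
  · rw [hor]
    refine ⟨?_, by simp, _, _, hm₅.trans hm₄⟩
    simp [ho₅, ho₄, ho₂, ho₁, vertexCode]

/-- The time for reading the input and computing the adjacency matrix. -/
def setupTime (n m : ℕ) : ℕ :=
  (1 + (1 + (1 + (1 + (1 + (2 + m * ((1 + (1 + (1 + 1))) + 2))))))) +
    ((2 + n * (1 + 2)) + (2 + m * ((2 + m * ((2 + 3 * ((2 + 3 *
      ((1 + (1 + (1 + ((2 + m * (1 + 2)) + 1)))) + 2)) + 2)) + 2)) + 2)))

variable {edges : List (List ℕ)}

theorem testProgram_ter (hn : ∀ l ∈ edges, ∀ x ∈ l, x < n) (h3 : ∀ l ∈ edges, l.length ≤ 3)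
    (hY : 10 ≤ Y) (hnY : n ≤ Y) (hmY : 4 * edges.length + 2 ≤ Y)
    (htab : tab = entry edges n) (hm : m = edges.length) (hR : R = EqOrAdj n m tab)
    (hD : ∀ v < n, (incident tab v m).length ≤ D) :
    Ter Y testProgram (State.init (n :: m :: encodeLists edges))
      (setupTime n m + (2 + n * (vertexTime n m D + 2))) fun s => Ctx n m s ∧
        s.reg 0 = ind (∃ v < n, Solvable m tab R v) ∧
        s.out = (List.range n).flatMap (vertexCode n m tab R) ∧
        ∃ L M, s.mem = lay (4 * m + 2) (inputCells n edges) (tbl m tab) (arr (n + 1) R) L M := by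
  subst hm
  have htabn : ∀ j i, tab j i ≤ n := by
    rw [htab]; exact fun j i => entry_le hn j i
  rw [setupTime, add_assoc]
  refine Ter.seq ((parse_ter hn h3 hY hnY hmY).mono le_rfl ?_)
  rintro s₁ hb hF ⟨hc, h0, ho, hm⟩ _ _
  rw [← htab] at hm
  refine Ter.seq ((adjacency_ter htabn hb hc hm).mono le_rfl ?_)
  rintro s₂ hb hF hm _ _
  rw [← hR] at hm
  replace hc := hc.of_frame hF (by decide)
  replace h0 := (hF.reg 0 (by decide)).trans h0
  replace ho := (hF.out (by decide)).trans ho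
  refine Ter.forTo (fun k s => Ctx n edges.length s ∧ s.reg 0 = ind (∃ v < k, Solvable edges.length tab R v) ∧
    s.out = (List.range k).flatMap (vertexCode n edges.length tab R) ∧
      ∃ L M, s.mem = lay (4 * edges.length + 2) (inputCells n edges) (tbl edges.length tab)
        (arr (n + 1) R) L (arr (2 * edges.length + 1) M)) (by decide) (by decide) hb hnY
    (by exact fun s' hF => (hc.of_frame hF (by decide)).r1) ?_ ?_ ?_
  · refine ⟨hc.setReg (by omega), ?_, ?_, 0, fun _ _ => False, ?_⟩
    · simp [h0, ind]
    · simp [ho]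
    · rw [State.setReg_mem, hm]
      congr 1
      funext; simp [arr, ind]
  · rintro v s hv hb hF h14 ⟨hc, h0, ho, L, M, hm⟩
    refine (vertexStep_ter htabn hv (hD v hv) (by omega) hb hc h14 h0 hm).mono le_rfl ?_
    rintro s' _ hF ⟨ho', h0', L', M', hm'⟩ _ _
    refine ⟨(hc.of_frame hF (by decide)).setReg (by omega), ?_, ?_, L', M', hm'⟩
    · rw [State.setReg_reg, if_neg (by omega), h0']
      refine ind_congr ?_
      simp only [Nat.lt_succ_iff_lt_or_eq, or_and_right, exists_or, exists_eq_left]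
    · simp [ho', ho, List.range_succ]
  · rintro s' _ ⟨hc, h0, ho, L, M, hm⟩
    exact ⟨hc, h0, ho, L, _, hm⟩

/-- A loop whose rounds add cases to the answer. -/
theorem Ter.forTo_answer {r : ℕ} {b : Expr} {c : Cmd} {k T : ℕ} {p : Prop} (P : ℕ → Prop)
    (hr : 0 < r)
    (hbG : b.Good) (hw : c.writes r = false) (hb : Bdd Y s) (hk : k ≤ Y)
    (hbk : ∀ s', Frame (.forTo r b c) s s' → b.eval s' = k) (h0 : s.reg 0 = ind p)
    (hstep : ∀ i s' p', i < k → Bdd Y s' → Frame (.forTo r b c) s s' → s'.reg r = i →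
      s'.reg 0 = ind p' → Ter Y c s' T fun s'' => s''.reg 0 = ind (p' ∨ P i)) :
    Ter Y (.forTo r b c) s (2 + k * (T + 2)) fun s' =>
      s'.reg 0 = ind (p ∨ ∃ i < k, P i) := by
  have hr' : ∀ s : State, ∀ x, (s.setReg r x).reg 0 = s.reg 0 := by
    intro s x; rw [State.setReg_reg, if_neg (by omega)]
  refine Ter.forTo (fun k s' => s'.reg 0 = ind (p ∨ ∃ i < k, P i)) hbG hw hb hk hbk ?_ ?_
    (fun s' _ h => h)
  · rw [hr', h0]; simp
  intro i s' hi hb' hF hri h0'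
  refine (hstep i s' _ hi hb' hF hri h0').mono le_rfl fun s'' _ _ h _ _ => ?_
  rw [hr', h]
  refine ind_congr ?_
  simp only [Nat.lt_succ_iff_lt_or_eq, or_and_right, exists_or, or_assoc, exists_eq_left]

/-- Three equal or adjacent vertices that are not equal or adjacent to the first, second, and third
entry of the row `e`, respectively. -/
def Avoids (tab : ℕ → ℕ → ℕ) (R : ℕ → ℕ → Prop) (e x y z : ℕ) : Prop :=
  (R x y ∧ R x z ∧ R y z) ∧ ¬ R x (tab e 0) ∧ ¬ R y (tab e 1) ∧ ¬ R z (tab e 2)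

/-- Four nested loops with one test of constant cost: this is the source of the term `|E||V|^3`. -/
theorem cliques_ter {p : Prop} (htab : ∀ j i, tab j i ≤ n) (hb : Bdd Y s) (hc : Ctx n m s)
    (h0 : s.reg 0 = ind p)
    (hm : s.mem = lay (4 * m + 2) inp (tbl m tab) (arr (n + 1) R) L M) :
    Ter Y cliques s
      (2 + m * ((2 + n * ((2 + n * ((2 + n * (1 + 2)) + 2)) + 2)) + 2)) fun s' =>
      s'.reg 0 = ind (p ∨ ∃ e < m, ∃ x < n, ∃ y < n, ∃ z < n, Avoids tab R e x y z) := by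
  have h10 := hb.ten
  have hnY : n ≤ Y := hc.r1 ▸ hb.reg 1
  have hmY : m ≤ Y := hc.r2 ▸ hb.reg 2
  refine Ter.forTo_answer _ (by omega) (by decide) (by decide) hb hmY
    (by exact fun s' hF => (hc.of_frame hF (by decide)).r2) h0 ?_
  intro e s p he hb hF h6 h0
  replace hc := hc.of_frame hF (by decide)
  replace hm := (hF.mem (by decide)).trans hm
  refine Ter.forTo_answer _ (by omega) (by decide) (by decide) hb hnY
    (by exact fun s' hF => (hc.of_frame hF (by decide)).r1) h0 ?_
  intro x s p hx hb hF h11 h0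
  replace hc := hc.of_frame hF (by decide)
  replace hm := (hF.mem (by decide)).trans hm
  replace h6 := (hF.reg 6 (by decide)).trans h6
  refine Ter.forTo_answer _ (by omega) (by decide) (by decide) hb hnY
    (by exact fun s' hF => (hc.of_frame hF (by decide)).r1) h0 ?_
  intro y s p hy hb hF h12 h0
  replace hc := hc.of_frame hF (by decide)
  replace hm := (hF.mem (by decide)).trans hm
  replace h6 := (hF.reg 6 (by decide)).trans h6
  replace h11 := (hF.reg 11 (by decide)).trans h11
  refine Ter.forTo_answer _ (by omega) (by decide) (by decide) hb hnY
    (by exact fun s' hF => (hc.of_frame hF (by decide)).r1) h0 ?_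
  intro z s p hz hb hF h13 h0
  replace hc := hc.of_frame hF (by decide)
  replace hm := (hF.mem (by decide)).trans hm
  replace h6 := (hF.reg 6 (by decide)).trans h6
  replace h11 := (hF.reg 11 (by decide)).trans h11
  replace h12 := (hF.reg 12 (by decide)).trans h12
  have hv : ∀ i < 3, (vertexAt (.reg 6) (.const i)).eval s = tab e i := by
    intro i hi
    rw [eval_vertexAt hc hm (by simpa [h6]) (by simpa)]; simp [h6]
  have hr : ∀ x y : Expr, y.eval s ≤ n → (relB x y).eval s = ind (R (x.eval s) (y.eval s)) :=
    fun x y hy => eval_relB hc hm hy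
  have hr' : ∀ x : Expr, ∀ i < 3, (relB x (vertexAt (.reg 6) (.const i))).eval s =
      ind (R (x.eval s) (tab e i)) := by
    intro x i hi
    rw [hr x _ (by rw [hv i hi]; exact htab e i), hv i hi]
  have hav : avoidsTest.eval s = ind (Avoids tab R e x y z) := by
    simp only [avoidsTest, eval_and, eval_not, hr' _ 0 (by omega), hr' _ 1 (by omega),
      hr' _ 2 (by omega), hr _ (.reg 12) (by simpa [h12] using hy.le),
      hr _ (.reg 13) (by simpa [h13] using hz.le), one_sub_ind, ind_mul, eval_reg, h11, h12, h13,
      Avoids]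
  have hor := eval_or (a := .reg 0) h0 hav
  refine Ter.assign (by decide) hb ?_ ?_
  · rw [hor]; exact ind_le_one.trans (by omega)
  · rw [State.setReg_reg, if_pos rfl, hor]

/-- The time for the search of cliques. -/
def cliqueTime (n m : ℕ) : ℕ := 2 + m * ((2 + n * ((2 + n * ((2 + n * (1 + 2)) + 2)) + 2)) + 2)

theorem conformalProgram_ter (hn : ∀ l ∈ edges, ∀ x ∈ l, x < n) (h3 : ∀ l ∈ edges, l.length ≤ 3)
    (hY : 10 ≤ Y) (hnY : n ≤ Y) (hmY : 4 * edges.length + 2 ≤ Y)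
    (htab : tab = entry edges n) (hm : m = edges.length) (hR : R = EqOrAdj n m tab)
    (hD : ∀ v < n, (incident tab v m).length ≤ D) :
    Ter Y conformalProgram (State.init (n :: m :: encodeLists edges))
      ((setupTime n m + (2 + n * (vertexTime n m D + 2))) + (cliqueTime n m + 1)) fun s =>
        s.reg 0 = ind (¬ ((∃ v < n, Solvable m tab R v) ∨
          ∃ e < m, ∃ x < n, ∃ y < n, ∃ z < n, Avoids tab R e x y z)) := by
  have htabn : ∀ j i, tab j i ≤ n := by
    rw [htab]; exact fun j i => entry_le hn j i
  refine Ter.seq ((testProgram_ter hn h3 hY hnY hmY htab hm hR hD).mono le_rfl ?_)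
  rintro s₁ hb _ ⟨hc, h0, -, L, M, hm⟩ _ _
  refine Ter.seq ((cliques_ter htabn hb hc h0 hm).mono le_rfl ?_)
  rintro s₂ hb _ h0 _ _
  have hv := eval_not (.reg 0) s₂
  rw [eval_reg, h0, one_sub_ind] at hv
  refine Ter.assign (by decide) hb ?_ ?_
  · rw [hv]; exact ind_le_one.trans (by omega)
  · rw [State.setReg_reg, if_pos rfl, hv]

end Programs

/-! ## Dual hypergraphs -/

section Dual

variable {V : Type*} {H : Hypergraph V}

theorem Covered.mem_vertexSet (hH : Covered H) (v : V) : v ∈ H.vertexSet := by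
  obtain ⟨e, he, hv⟩ := hH v
  exact H.subset_vertexSet_of_mem_edgeSet' he hv

theorem ncard_le_of_dim_le [Finite V] {k : ℕ} (h : dim H ≤ k) {e : Set V} (he : e ∈ H.edgeSet) :
    e.ncard ≤ k :=
  (le_csSup (Set.toFinite _).bddAbove (Set.mem_image_of_mem _ he)).trans h

theorem degree_le_maxDegree [Finite V] (v : V) : degree H v ≤ maxDegree H :=
  le_csSup (Set.toFinite _).bddAbove (Set.mem_range_self v)

theorem isTransversal_iff (hH : Covered H) {T : Set V} :
    IsTransversal H T ↔ ∀ e ∈ H.edgeSet, (T ∩ e).Nonempty :=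
  ⟨fun h => h.2, fun h => ⟨fun v _ => hH.mem_vertexSet v, h⟩⟩

theorem exists_minimal_transversal_subset [Finite V] {T : Set V} (hT : IsTransversal H T) :
    ∃ T' ⊆ T, Minimal (IsTransversal H) T' := by
  obtain ⟨T', h, h'⟩ := (Set.toFinite {T | IsTransversal H T}).exists_le_minimal hT
  exact ⟨T', h, h'⟩

/-- Each vertex of a minimal transversal is the only one in some hyperedge. -/
theorem exists_inter_eq_singleton {T : Set V} (hT : Minimal (IsTransversal H) T) {v : V}
    (hv : v ∈ T) : ∃ e ∈ H.edgeSet, T ∩ e = {v} := by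
  by_contra! h
  -- Without a private hyperedge, every hyperedge that meets `T` in `v` meets it elsewhere too, so
  -- `v` could be dropped.
  have : IsTransversal H (T \ {v}) := by
    refine ⟨Set.sdiff_subset.trans hT.prop.1, fun e he => ?_⟩
    obtain ⟨x, hx⟩ := hT.prop.2 e he
    by_cases hxv : x = v
    · subst hxv
      obtain ⟨y, hy, hyx⟩ : ∃ y ∈ T ∩ e, y ≠ x := by
        by_contra! h'
        exact h e he (Set.eq_singleton_iff_unique_mem.2 ⟨hx, h'⟩)
      exact ⟨y, ⟨hy.1, hyx⟩, hy.2⟩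
    · exact ⟨x, ⟨hx.1, hxv⟩, hx.2⟩
  exact (hT.le_of_le this Set.sdiff_subset hv).2 rfl

/-- Two vertices lie in a common minimal transversal if and only if they have private hyperedges
whose other vertices do not contain a hyperedge. -/
theorem coGraph_dual_adj [Finite V] (hH : Covered H) {u w : V} :
    (coGraph (dual H)).Adj u w ↔ ∃ e ∈ H.edgeSet, ∃ f ∈ H.edgeSet, u ∈ e ∧ w ∈ f ∧ u ∉ f ∧ w ∉ e ∧
      ∀ g ∈ H.edgeSet, ¬ ∀ x ∈ g, (x ∈ e ∨ x ∈ f) ∧ x ≠ u ∧ x ≠ w := by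
  constructor
  · rintro ⟨huw, T, hT, hu, hw⟩
    obtain ⟨e, he, hTe⟩ := exists_inter_eq_singleton hT hu
    obtain ⟨f, hf, hTf⟩ := exists_inter_eq_singleton hT hw
    rw [Set.eq_singleton_iff_unique_mem] at hTe hTf
    refine ⟨e, he, f, hf, hTe.1.2, hTf.1.2, fun h => huw (hTf.2 u ⟨hu, h⟩),
      fun h => huw (hTe.2 w ⟨hw, h⟩).symm, fun g hg h => ?_⟩
    obtain ⟨x, hxT, hxg⟩ := hT.prop.2 g hg
    obtain ⟨h1 | h1, h2, h3⟩ := h x hxg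
    · exact h2 (hTe.2 x ⟨hxT, h1⟩)
    · exact h3 (hTf.2 x ⟨hxT, h1⟩)
  · rintro ⟨e, he, f, hf, hue, hwf, huf, hwe, h⟩
    -- The complement of `(e ∪ f) \ {u, w}` is a transversal because no hyperedge lies inside `(e ∪
    -- f) \ {u, w}`. A minimal transversal within it can meet `e` only in `u` and `f` only in `w`,
    -- so it contains both.
    have hT : IsTransversal H {x | ¬ ((x ∈ e ∨ x ∈ f) ∧ x ≠ u ∧ x ≠ w)} := by
      rw [isTransversal_iff hH]
      intro g hg
      have := h g hg
      push Not at this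
      obtain ⟨x, hx, hx'⟩ := this
      exact ⟨x, fun h => h.2.2 (hx' h.1 h.2.1), hx⟩
    obtain ⟨T, hTs, hT⟩ := exists_minimal_transversal_subset hT
    refine ⟨fun h => huf (h ▸ hwf), T, hT, ?_, ?_⟩
    · obtain ⟨x, hxT, hxe⟩ := hT.prop.2 e he
      by_cases hxu : x = u
      · exact hxu ▸ hxT
      · exact absurd ⟨Or.inl hxe, hxu, fun h => hwe (h ▸ hxe)⟩ (hTs hxT)
    · obtain ⟨x, hxT, hxf⟩ := hT.prop.2 f hf
      by_cases hxw : x = w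
      · exact hxw ▸ hxT
      · exact absurd ⟨Or.inr hxf, fun h => huf (h ▸ hxf), hxw⟩ (hTs hxT)

theorem exists_maximal_clique [Finite V] {G : SimpleGraph V} {C : Set V} (hC : G.IsClique C) :
    ∃ C', C ⊆ C' ∧ Maximal G.IsClique C' := by
  obtain ⟨T', h, h'⟩ := (Set.toFinite {T | G.IsClique T}).exists_le_maximal hC
  exact ⟨T', h, h'⟩

theorem IsClique.subset_of_duallyConformal (hH : Covered H) (h : DuallyConformal H) {C : Set V}
    (hC : (coGraph (dual H)).IsClique C) :
    ∃ T, Minimal (IsTransversal H) T ∧ C ⊆ T :=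
  h C (fun v _ => hH.mem_vertexSet v) fun _ hu _ hw huw => (hC hu hw huw).2

theorem isClique_of_minimal {T : Set V} (hT : Minimal (IsTransversal H) T) :
    (coGraph (dual H)).IsClique T :=
  fun _ hu _ hw huw => ⟨huw, T, hT, hu, hw⟩

/-- If neither obstruction occurs, every maximal clique is a minimal transversal, and these cliques
contain all pairwise co-occurring sets. Conversely, each obstruction is a clique that no minimal
transversal can contain. No bound on the dimension is needed. -/
theorem not_duallyConformal_iff_hasCliqueAt [Finite V] (hH : Covered H) : ¬ DuallyConformal H ↔
    (∃ C : Set V, Maximal (coGraph (dual H)).IsClique C ∧ ¬ IsTransversal H C) ∨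
      ∃ v : V, HasCliqueAt H v := by
  constructor
  · intro h
    by_contra! hcon
    obtain ⟨h1, h2⟩ := hcon
    refine h fun U hU hUc => ?_
    obtain ⟨C, hUC, hC⟩ := exists_maximal_clique (G := coGraph (dual H)) (C := U)
      fun u hu w hw huw => ⟨huw, hUc u hu w hw huw⟩
    refine ⟨C, ?_, hUC⟩
    refine ⟨h1 C hC, fun T hT hTC x hx => ?_⟩
    by_contra hxT
    -- A transversal `T ⊆ C` that misses `x` meets each hyperedge through `x` in another vertex, so
    -- `C` meets it at least twice.
    refine h2 x ⟨C, hC.prop, hx, fun e he hxe => ?_⟩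
    obtain ⟨y, hy⟩ := hT.2 e he
    refine (Set.one_lt_ncard).2 ⟨x, ⟨hx, hxe⟩, y, ⟨hTC hy.1, hy.2⟩, ?_⟩
    rintro rfl
    exact hxT hy.1
  · rintro (⟨C, hC, hCt⟩ | ⟨v, C, hC, hv, hCv⟩) h
    · obtain ⟨T, hT, hCT⟩ := IsClique.subset_of_duallyConformal hH h hC.prop
      -- A minimal transversal is itself a clique, so a maximal clique inside it equals it.
      exact hCt ((hC.eq_of_subset (isClique_of_minimal hT) hCT) ▸ hT.prop)
    · obtain ⟨T, hT, hCT⟩ := IsClique.subset_of_duallyConformal hH h hC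
      obtain ⟨e, he, hTe⟩ := exists_inter_eq_singleton hT (hCT hv)
      have hve : v ∈ T ∩ e := hTe ▸ rfl
      have h1 := hCv e he hve.2
      have h2 : (C ∩ e).ncard ≤ 1 := by
        rw [← Set.ncard_singleton v, ← hTe]
        exact Set.ncard_le_ncard (Set.inter_subset_inter_left e hCT)
      omega

/-- A satisfying assignment gives the clique of `v` and its true neighbours; a clique gives its
indicator function. The clauses of the hyperedges supply the second common vertex. -/
theorem satisfiable_vertexFormula_iff [Finite V] (v : V) :
    Satisfiable (vertexFormula H v) ↔ HasCliqueAt H v := by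
  classical
  constructor
  · rintro ⟨a, ha⟩
    have hneg : ∀ u w : V, (coGraph (dual H)).Adj v u → (coGraph (dual H)).Adj v w → u ≠ w →
        a u = true → a w = true → (coGraph (dual H)).Adj u w := by
      intro u w hu hw huw hau haw
      by_contra h
      obtain ⟨l, hl, hal⟩ := ha _ (Or.inl ⟨u, w, hu, hw, huw, h, rfl⟩)
      rcases hl with rfl | rfl <;> simp_all
    refine ⟨insert v {u | (coGraph (dual H)).Adj v u ∧ a u = true}, ?_, Set.mem_insert _ _, ?_⟩
    · rintro x (rfl | ⟨hx, hax⟩) y (rfl | ⟨hy, hay⟩) hxy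
      · exact absurd rfl hxy
      · exact hy
      · exact hx.symm
      · exact hneg x y hx hy hxy hax hay
    · intro e he hve
      obtain ⟨⟨u, b⟩, ⟨rfl, hue, huv⟩, hal⟩ := ha _ (Or.inr ⟨e, he, hve, rfl⟩)
      exact (Set.one_lt_ncard).2 ⟨v, ⟨Set.mem_insert _ _, hve⟩, u, ⟨Or.inr ⟨huv, hal⟩, hue⟩, huv.ne⟩
  · rintro ⟨C, hC, hv, hCe⟩
    refine ⟨fun u => decide (u ∈ C), ?_⟩
    rintro c (⟨u, w, hu, hw, huw, hnadj, rfl⟩ | ⟨e, he, hve, rfl⟩)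
    · by_cases huC : u ∈ C
      · exact ⟨(w, false), by simp, by simpa using fun hwC => hnadj (hC huC hwC huw)⟩
      · exact ⟨(u, false), by simp, by simpa using huC⟩
    · obtain ⟨u, hu, huv⟩ := Set.exists_ne_of_one_lt_ncard (hCe e he hve) v
      exact ⟨(u, true), ⟨rfl, hu.2, hC hv hu.1 huv.symm⟩, by simpa using hu.1⟩

/-- `v` is not its own neighbour, so the clause of a hyperedge through `v` loses at least one
vertex. -/
theorem ncard_clause_le [Finite V] {k : ℕ} (hdim : dim H ≤ k + 1) (hk : 2 ≤ k) {v : V} {c : Set (V × Bool)}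
    (hc : c ∈ vertexFormula H v) : c.ncard ≤ k := by
  rcases hc with ⟨u, w, -, -, -, -, rfl⟩ | ⟨e, he, hve, rfl⟩
  · exact (Set.ncard_insert_le _ _).trans (by simpa)
  · have h1 : {l : V × Bool | l.2 = true ∧ l.1 ∈ e ∧ (coGraph (dual H)).Adj v l.1} ⊆
        (fun u => (u, true)) '' (e \ {v}) := by
      rintro ⟨u, b⟩ ⟨rfl, hue, huv⟩
      exact ⟨u, ⟨hue, huv.ne'⟩, rfl⟩
    have h2 := Set.ncard_le_ncard h1
    have h3 := Set.ncard_image_le (f := fun u : V => (u, true)) (Set.toFinite (e \ {v}))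
    have h4 := Set.ncard_sdiff_singleton_add_one hve (Set.toFinite e)
    have h5 := ncard_le_of_dim_le hdim he
    omega

/-- A missed hyperedge is certified by one blocking clique member for each of its vertices. The
certificate passes to any subclique that keeps the blockers, so maximality disappears and `|e|`
members are enough. -/
theorem exists_maximal_clique_not_transversal_iff [Finite V] (hH : Covered H) :
    (∃ C : Set V, Maximal (coGraph (dual H)).IsClique C ∧ ¬ IsTransversal H C) ↔
      ∃ e ∈ H.edgeSet, ∃ C : Set V, (coGraph (dual H)).IsClique C ∧
        ∀ a ∈ e, ∃ x ∈ C, ¬ (x = a ∨ (coGraph (dual H)).Adj x a) := by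
  constructor
  · rintro ⟨C, hC, hCt⟩
    simp only [isTransversal_iff hH, not_forall, Set.not_nonempty_iff_eq_empty] at hCt
    obtain ⟨e, he, hCe⟩ := hCt
    refine ⟨e, he, C, hC.prop, fun a ha => ?_⟩
    -- If no member of `C` blocked `a`, then `C ∪ {a}` would be a clique, and maximality would put
    -- `a` into `C ∩ e = ∅`.
    by_contra! h
    have hins : (coGraph (dual H)).IsClique (insert a C) := by
      rw [SimpleGraph.isClique_insert]
      exact ⟨hC.prop, fun x hx hax => ((h x hx).resolve_left hax.symm).symm⟩
    have : a ∈ C ∩ e := ⟨hC.le_of_ge hins (Set.subset_insert a C) (Set.mem_insert a C), ha⟩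
    simp [hCe] at this
  · rintro ⟨e, he, C, hC, h⟩
    obtain ⟨C', hCC', hC'⟩ := exists_maximal_clique hC
    refine ⟨C', hC', fun ht => ?_⟩
    obtain ⟨a, haC, hae⟩ := ht.2 e he
    obtain ⟨x, hx, hxa⟩ := h a hae
    by_cases hne : x = a
    · exact hxa (Or.inl hne)
    · exact hxa (Or.inr (hC'.prop (hCC' hx) haC hne))

end Dual

/-! ## Listings and tables -/

section Table

variable {V : Type*} {H : Hypergraph V} (L : Listing H)

/-- The set of vertices in a list of positions. -/
def Listing.toSet (l : List (Fin L.n)) : Set V := {v | ∃ i ∈ l, L.vert i = v}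

/-- The hyperedge number `j`, as a list. -/
def Listing.row (j : ℕ) : List (Fin L.n) := L.edges.getD j []

/-- The hyperedges as lists of numbers. -/
def Listing.lists : List (List ℕ) := L.edges.map (List.map Fin.val)

/-- The table of the hyperedges. -/
def Listing.tab : ℕ → ℕ → ℕ := entry L.lists L.n

/-- The number of hyperedges. -/
def Listing.m : ℕ := L.edges.length

variable {L}

@[simp] theorem vert_mem_toSet {l : List (Fin L.n)} {i : Fin L.n} :
    L.vert i ∈ L.toSet l ↔ i ∈ l := by
  simp [Listing.toSet]

theorem mem_edgeSet_iff {e : Set V} : e ∈ H.edgeSet ↔ ∃ j < L.m, e = L.toSet (L.row j) := by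
  rw [L.complete]
  constructor
  · rintro ⟨l, hl, rfl⟩
    obtain ⟨j, hj, rfl⟩ := List.getElem_of_mem hl
    exact ⟨j, hj, by rw [Listing.row, List.getD_eq_getElem _ _ hj]; rfl⟩
  · rintro ⟨j, hj, rfl⟩
    exact ⟨L.row j, by rw [Listing.row, List.getD_eq_getElem _ _ hj]; exact List.getElem_mem _, rfl⟩

theorem exists_edge_iff {P : Set V → Prop} :
    (∃ e ∈ H.edgeSet, P e) ↔ ∃ j < L.m, P (L.toSet (L.row j)) := by
  simp only [mem_edgeSet_iff (L := L)]
  constructor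
  · rintro ⟨_, ⟨j, hj, rfl⟩, h⟩; exact ⟨j, hj, h⟩
  · rintro ⟨j, hj, h⟩; exact ⟨_, ⟨j, hj, rfl⟩, h⟩

theorem forall_edge_iff {P : Set V → Prop} :
    (∀ e ∈ H.edgeSet, P e) ↔ ∀ j < L.m, P (L.toSet (L.row j)) := by
  simp only [mem_edgeSet_iff (L := L)]
  constructor
  · intro h j hj; exact h _ ⟨j, hj, rfl⟩
  · rintro h _ ⟨j, hj, rfl⟩; exact h j hj

theorem forall_vert_iff {P : V → Prop} : (∀ v, P v) ↔ ∀ i, P (L.vert i) :=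
  L.vert.forall_congr_right.symm

theorem exists_vert_iff {P : V → Prop} : (∃ v, P v) ↔ ∃ i, P (L.vert i) :=
  L.vert.exists_congr_right.symm

theorem Listing.input_eq : L.input = L.n :: L.m :: encodeLists L.lists := by
  simp [Listing.input, encodeLists, Listing.lists, Listing.m, List.flatMap_map]

theorem Listing.length_lists : L.lists.length = L.m := by simp [Listing.lists, Listing.m]

theorem Listing.lists_lt : ∀ l ∈ L.lists, ∀ x ∈ l, x < L.n := by
  intro l hl x hx
  simp only [Listing.lists, List.mem_map] at hl
  obtain ⟨l, -, rfl⟩ := hl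
  obtain ⟨i, -, rfl⟩ := List.mem_map.1 hx
  exact i.2

theorem Listing.nodup_row (j : ℕ) : (L.row j).Nodup := by
  rw [Listing.row]
  by_cases hj : j < L.edges.length
  · rw [List.getD_eq_getElem _ _ hj]; exact L.nodup_vertices _ (List.getElem_mem _)
  · rw [List.getD_eq_default _ _ (by omega)]; exact List.nodup_nil

theorem Listing.tab_eq (j i : ℕ) : L.tab j i = ((L.row j).map Fin.val).getD i L.n := by
  have : L.lists.getD j [] = (L.row j).map Fin.val := by
    rw [Listing.lists, Listing.row]
    exact List.getD_map _ [] (List.map Fin.val)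
  rw [Listing.tab, entry, this]

theorem ncard_toSet {l : List (Fin L.n)} (hl : l.Nodup) : (L.toSet l).ncard = l.length := by
  have : L.toSet l = L.vert '' (l.toFinset : Set (Fin L.n)) := by
    ext v
    constructor <;> rintro ⟨i, hi, rfl⟩ <;> exact ⟨i, by simpa using hi, rfl⟩
  rw [this, Set.ncard_image_of_injective _ L.vert.injective, Set.ncard_coe_finset,
    List.toFinset_card_of_nodup hl]

theorem length_le_of_dim_le [Finite V] {k : ℕ} (h : dim H ≤ k) : ∀ l ∈ L.edges, l.length ≤ k := by
  intro l hl
  rw [← ncard_toSet (L.nodup_vertices l hl)]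
  exact ncard_le_of_dim_le h ((L.complete _).2 ⟨l, hl, rfl⟩)

theorem length_row_le [Finite V] {k : ℕ} (h : dim H ≤ k) (j : ℕ) : (L.row j).length ≤ k := by
  rw [Listing.row]
  by_cases hj : j < L.edges.length
  · rw [List.getD_eq_getElem _ _ hj]; exact length_le_of_dim_le h _ (List.getElem_mem _)
  · rw [List.getD_eq_default _ _ (by omega)]; simp

theorem length_lists_le [Finite V] {k : ℕ} (h : dim H ≤ k) : ∀ l ∈ L.lists, l.length ≤ k := by
  intro l hl
  simp only [Listing.lists, List.mem_map] at hl
  obtain ⟨l, hl, rfl⟩ := hl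
  simpa using length_le_of_dim_le h l hl

theorem Listing.card_eq : Nat.card V = L.n := by
  rw [← Nat.card_congr L.vert, Nat.card_eq_fintype_card, Fintype.card_fin]

theorem Listing.ncard_edgeSet : H.edgeSet.ncard = L.m := by
  classical
  have : H.edgeSet = ((L.edges.map L.toSet).toFinset : Set (Set V)) := by
    ext e
    rw [L.complete]
    simp [Listing.toSet, eq_comm]
  have hnd : (L.edges.map L.toSet).Nodup := L.nodup_edges
  rw [this, Set.ncard_coe_finset, List.toFinset_card_of_nodup hnd, List.length_map, Listing.m]

-- The listing has no repeated hyperedge, so counting positions in the list does not exceed the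
-- degree.
open Classical in
theorem length_filter_le_degree [Finite V] (v : Fin L.n) :
    (L.edges.filter fun l => v ∈ l).length ≤ degree H (L.vert v) := by
  have hnd : ((L.edges.filter fun l => v ∈ l).map L.toSet).Nodup :=
    L.nodup_edges.sublist (List.filter_sublist.map _)
  rw [← List.length_map (f := L.toSet), ← List.toFinset_card_of_nodup hnd, ← Set.ncard_coe_finset]
  refine Set.ncard_le_ncard fun e he => ?_
  simp only [List.coe_toFinset, List.mem_map, List.mem_filter, decide_eq_true_eq] at he
  obtain ⟨l, ⟨hl, hv⟩, rfl⟩ := he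
  exact ⟨(L.complete _).2 ⟨l, hl, rfl⟩, vert_mem_toSet.2 hv⟩

theorem ncard_edgeSet_le [Finite V] : H.edgeSet.ncard ≤ Nat.card V * maxDegree H + 1 := by
  classical
  have := Fintype.ofFinite V
  -- An empty hyperedge is not excluded and contributes to no degree; it accounts for the `+ 1`.
  have hsub : H.edgeSet ⊆ insert ∅ (⋃ v : V, {e ∈ H.edgeSet | v ∈ e}) := by
    intro e he
    rcases e.eq_empty_or_nonempty with rfl | ⟨v, hv⟩
    · exact Set.mem_insert _ _
    · exact Or.inr (Set.mem_iUnion.2 ⟨v, he, hv⟩)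
  refine (Set.ncard_le_ncard hsub).trans ((Set.ncard_insert_le _ _).trans ?_)
  have h1 : (⋃ v : V, {e ∈ H.edgeSet | v ∈ e}).ncard ≤ ∑ v : V, degree H v :=
    Set.ncard_iUnion_le_of_fintype _
  have h2 : ∑ v : V, degree H v ≤ ∑ _v : V, maxDegree H :=
    Finset.sum_le_sum fun v _ => degree_le_maxDegree v
  simp only [Finset.sum_const, Finset.card_univ, smul_eq_mul, ← Nat.card_eq_fintype_card] at h2
  omega

theorem maxDegree_pos [Finite V] [Nonempty V] (hH : Covered H) : 1 ≤ maxDegree H := by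
  obtain ⟨v⟩ := ‹Nonempty V›
  obtain ⟨e, he, hv⟩ := hH v
  refine le_trans ?_ (degree_le_maxDegree v)
  exact (Set.ncard_pos).2 ⟨e, he, hv⟩

theorem maxDegree_le [Finite V] [Nonempty V] : maxDegree H ≤ H.edgeSet.ncard := by
  refine csSup_le (Set.range_nonempty _) ?_
  rintro _ ⟨v, rfl⟩
  exact Set.ncard_le_ncard (Set.sep_subset _ _)

/-- Every vertex occurs in some listed hyperedge, so the lists have total length at least `n`. This
is how the word size controls the number of vertices. -/
theorem le_length_input (hH : Covered H) : 2 + L.m + L.n ≤ L.input.length := by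
  have h1 : L.input.length = 2 + L.m + L.edges.flatten.length := by
    rw [Listing.input, Listing.m]
    simp only [List.length_cons, List.length_flatMap, List.length_map, List.length_flatten]
    have : ∀ l : List (List (Fin L.n)), (l.map fun x => x.length + 1).sum =
        l.length + (l.map List.length).sum := by
      intro l
      induction l with
      | nil => rfl
      | cons a t ih => simp only [List.map_cons, List.sum_cons, ih, List.length_cons]; omega
    rw [this]; omega
  have h2 : Fintype.card (Fin L.n) ≤ L.edges.flatten.toFinset.card := by
    rw [← Finset.card_univ]
    refine Finset.card_le_card fun i _ => ?_
    obtain ⟨e, he, hi⟩ := hH (L.vert i)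
    obtain ⟨l, hl, rfl⟩ := (L.complete e).1 he
    simp only [List.mem_toFinset, List.mem_flatten]
    exact ⟨l, hl, vert_mem_toSet.1 hi⟩
  have h3 := List.toFinset_card_le L.edges.flatten
  rw [Fintype.card_fin] at h2
  omega

theorem eq_getD_iff_mem {l : List ℕ} (h3 : l.length ≤ 3) {n x : ℕ} (hx : x < n) :
    (x = l.getD 0 n ∨ x = l.getD 1 n ∨ x = l.getD 2 n) ↔ x ∈ l := by
  match l, h3 with
  | [], _ => simp; omega
  | [a], _ => simp; omega
  | [a, b], _ => simp; omega
  | [a, b, c], _ => simp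

theorem inRow_iff [Finite V] (hdim : dim H ≤ 3) {j : ℕ} {i : Fin L.n} :
    InRow L.tab j i ↔ i ∈ L.row j := by
  simp only [InRow, Listing.tab_eq]
  rw [eq_getD_iff_mem (by simpa using length_row_le hdim j) i.2]
  simp [Fin.val_inj]

theorem tab_lt_or_eq (j i : ℕ) : (∃ x : Fin L.n, x ∈ L.row j ∧ L.tab j i = x) ∨ L.tab j i = L.n := by
  rw [Listing.tab_eq]
  by_cases hi : i < ((L.row j).map Fin.val).length
  · left
    rw [List.getD_eq_getElem _ _ hi]
    rw [List.length_map] at hi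
    exact ⟨(L.row j)[i], List.getElem_mem _, by simp⟩
  · right
    rw [List.getD_eq_default _ _ (by omega)]

/-- The padding value may be repeated in a row, so distinctness is restricted to entries below `n`.
-/
theorem tab_injective {j i i' : ℕ} (h : L.tab j i = L.tab j i') (hi : L.tab j i < L.n) :
    i = i' := by
  have hnd : ((L.row j).map Fin.val).Nodup := (L.nodup_row j).map Fin.val_injective
  rw [Listing.tab_eq] at h hi
  rw [Listing.tab_eq] at h
  generalize (L.row j).map Fin.val = l at *
  have hl : ∀ k, l.getD k L.n < L.n → k < l.length := by
    intro k hk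
    by_contra hk'
    rw [List.getD_eq_default _ _ (by omega)] at hk
    omega
  have h1 := hl i hi
  have h2 := hl i' (h ▸ hi)
  rw [List.getD_eq_getElem _ _ h1, List.getD_eq_getElem _ _ h2] at h
  exact (hnd.getElem_inj_iff).1 h

/-- The two other entries of a row through `v` list its vertices other than `v`. -/
theorem eq_other_iff {j v x : ℕ} (hv : InRow L.tab j v) (hvn : v < L.n) (hx : x < L.n) :
    (x = other L.tab v j 0 ∨ x = other L.tab v j 1) ↔ InRow L.tab j x ∧ x ≠ v := by
  have h01 := tab_injective (L := L) (j := j) (i := 0) (i' := 1)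
  have h02 := tab_injective (L := L) (j := j) (i := 0) (i' := 2)
  have h12 := tab_injective (L := L) (j := j) (i := 1) (i' := 2)
  simp only [InRow, other, if_true, one_ne_zero, if_false] at *
  grind

/-- Padded entries pass the test vacuously, so testing three entries amounts to testing all vertices
of the row. -/
theorem subRest_iff [Finite V] (hdim : dim H ≤ 3) {e f g : ℕ} {u w : Fin L.n} :
    SubRest L.n L.tab e f u w g ↔
      ∀ x ∈ L.row g, (x ∈ L.row e ∨ x ∈ L.row f) ∧ x ≠ u ∧ x ≠ w := by
  have h : ∀ x : Fin L.n, InRest L.n L.tab e f u w x ↔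
      (x ∈ L.row e ∨ x ∈ L.row f) ∧ x ≠ u ∧ x ≠ w := by
    intro x
    simp only [InRest, x.2, not_true, false_or, inRow_iff hdim, Fin.val_inj, ne_eq]
  have h' : ∀ i, InRest L.n L.tab e f u w (L.tab g i) ↔
      ∀ x : Fin L.n, x = L.tab g i → (x ∈ L.row e ∨ x ∈ L.row f) ∧ x ≠ u ∧ x ≠ w := by
    intro i
    rcases tab_lt_or_eq (L := L) g i with ⟨x, -, hx⟩ | hx
    · rw [hx, h]
      simp [Fin.val_inj]
    · rw [hx]
      simp only [InRest, lt_irrefl, not_false_eq_true, true_or, true_iff]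
      intro x hx; exact absurd hx x.2.ne
  have hrow : ∀ x : Fin L.n, x ∈ L.row g ↔ InRow L.tab g x := fun x => (inRow_iff hdim).symm
  simp only [SubRest, h']
  constructor
  · rintro ⟨h0, h1, h2⟩ x hx
    rcases (hrow x).1 hx with hx | hx | hx
    exacts [h0 x hx, h1 x hx, h2 x hx]
  · intro H
    exact ⟨fun x hx => H x ((hrow x).2 (.inl hx)), fun x hx => H x ((hrow x).2 (.inr (.inl hx))),
      fun x hx => H x ((hrow x).2 (.inr (.inr hx)))⟩

/-- The padding value `n` is related to nothing, not even to itself. Hence a padded option is never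
chosen, and a padded entry of a hyperedge is avoided by every vertex. -/
theorem lt_of_eqOrAdj {x y : ℕ} (h : EqOrAdj L.n L.m L.tab x y) : x < L.n ∧ y < L.n := by
  rcases h with (h | ⟨i, hi, rfl, rfl⟩) | ⟨e, -, f, -, i, -, j, -, rfl, rfl, h, -⟩
  · exact h.elim
  · exact ⟨hi, hi⟩
  · exact ⟨h.1, h.2.1⟩

/-- This is `coGraph_dual_adj` in coordinates, with `u` and `w` located as entries of the rows `e`
and `f`. -/
theorem eqOrAdj_iff [Finite V] (hH : Covered H) (hdim : dim H ≤ 3) {u w : Fin L.n} :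
    EqOrAdj L.n L.m L.tab u w ↔ u = w ∨ (coGraph (dual H)).Adj (L.vert u) (L.vert w) := by
  have h1 : (False ∨ ∃ i < L.n, (u : ℕ) = i ∧ (w : ℕ) = i) ↔ u = w := by
    simp [← Fin.val_inj]
    omega
  rw [EqOrAdj, h1, coGraph_dual_adj hH, exists_edge_iff (L := L)]
  refine or_congr_right (exists_congr fun e => and_congr_right fun he => ?_)
  rw [exists_edge_iff (L := L)]
  refine exists_congr fun f => and_congr_right fun hf => ?_
  rw [forall_edge_iff (L := L)]
  have h2 : ∀ g, (∀ x ∈ L.toSet (L.row g), (x ∈ L.toSet (L.row e) ∨ x ∈ L.toSet (L.row f)) ∧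
      x ≠ L.vert u ∧ x ≠ L.vert w) ↔ SubRest L.n L.tab e f u w g := by
    intro g
    rw [forall_vert_iff (L := L), subRest_iff hdim]
    simp
  simp only [h2, vert_mem_toSet, ← inRow_iff hdim]
  constructor
  · rintro ⟨i, hi, j, hj, hu, hw, ⟨-, -, h3, h4⟩, h5⟩
    rw [← hu] at h3 h5
    rw [← hw] at h4 h5
    refine ⟨?_, ?_, h3, h4, h5⟩
    · rw [hu]; unfold InRow; interval_cases i <;> simp
    · rw [hw]; unfold InRow; interval_cases j <;> simp
  · rintro ⟨hu, hw, h3, h4, h5⟩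
    obtain ⟨i, hi, hu⟩ : ∃ i < 3, (u : ℕ) = L.tab e i := by
      rcases hu with h | h | h
      exacts [⟨0, by omega, h⟩, ⟨1, by omega, h⟩, ⟨2, by omega, h⟩]
    obtain ⟨j, hj, hw⟩ : ∃ i < 3, (w : ℕ) = L.tab f i := by
      rcases hw with h | h | h
      exacts [⟨0, by omega, h⟩, ⟨1, by omega, h⟩, ⟨2, by omega, h⟩]
    refine ⟨i, hi, j, hj, hu, hw, ?_⟩
    rw [← hu, ← hw]
    exact ⟨⟨u.2, w.2, h3, h4⟩, h5⟩

end Table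

/-! ## Correctness of the elimination -/

section Correctness

/-- A choice of one option for each of the rows `g, …, d - 1` such that these options and the last
one are compatible. -/
def HasChoice (R : ℕ → ℕ → Prop) (d g : ℕ) : Prop :=
  ∃ c : ℕ → ℕ, (∀ i, c i < 2) ∧ c d = 0 ∧ ∀ i ≤ d, ∀ j ≤ i, g ≤ j → R (2 * i + c i) (2 * j + c j)

/-- With two options per row, a Helly property holds: if each pair of later choices is extended by
some option of row `g`, then one option extends all of them. Only entries whose first row is not
before the second are used, so no symmetry of `R` is required. -/
theorem hasChoice_elim {R : ℕ → ℕ → Prop} {d g : ℕ} (hg : g < d) :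
    HasChoice R d g ↔ HasChoice (elim g R) d (g + 1) := by
  constructor
  · rintro ⟨c, hc, hcd, h⟩
    refine ⟨c, hc, hcd, fun i hi j hj hgj => ⟨h i hi j hj (by omega), Or.inr ?_⟩⟩
    have hE : Extends R (2 * g + c g) (2 * i + c i) (2 * j + c j) :=
      ⟨h i hi g (by omega) le_rfl, h j (by omega) g (by omega) le_rfl,
        h g (by omega) g le_rfl le_rfl⟩
    have := hc g
    interval_cases c g
    exacts [Or.inl hE, Or.inr hE]
  · rintro ⟨c, hc, hcd, h⟩
    -- Otherwise option 0 fails against some row `i` and option 1 against some row `j`, and neither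
    -- extends the pair of choices at `i` and `j`. An option incompatible with itself counts as
    -- failing at `d`.
    obtain ⟨k, hk, hkR, hki⟩ : ∃ k < 2, R (2 * g + k) (2 * g + k) ∧
        ∀ i ≤ d, g + 1 ≤ i → R (2 * i + c i) (2 * g + k) := by
      by_contra! hcon
      have key : ∀ k < 2, ∃ i ≤ d, g + 1 ≤ i ∧
          ¬ (R (2 * i + c i) (2 * g + k) ∧ R (2 * g + k) (2 * g + k)) := by
        intro k hk
        by_cases hR : R (2 * g + k) (2 * g + k)
        · obtain ⟨i, hi, hgi, hn⟩ := hcon k hk hR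
          exact ⟨i, hi, hgi, fun h => hn h.1⟩
        · exact ⟨d, le_rfl, hg, fun h => hR h.2⟩
      obtain ⟨i, hi, hgi, hni⟩ := key 0 (by omega)
      obtain ⟨j, hj, hgj, hnj⟩ := key 1 (by omega)
      rcases le_total i j with hij | hij
      · rcases (h j hj i hij hgi).2 with h1 | h1 | h1
        · exact h1 ⟨by omega, by omega⟩
        · exact hni ⟨h1.2.1, h1.2.2⟩
        · exact hnj ⟨h1.1, h1.2.2⟩
      · rcases (h i hi j hij hgj).2 with h1 | h1 | h1
        · exact h1 ⟨by omega, by omega⟩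
        · exact hni ⟨h1.1, h1.2.2⟩
        · exact hnj ⟨h1.2.1, h1.2.2⟩
    refine ⟨Function.update c g k, ?_, ?_, ?_⟩
    · intro i
      rw [Function.update_apply]
      split_ifs
      exacts [hk, hc i]
    · rwa [Function.update_of_ne (by omega)]
    · intro i hi j hj hgj
      rcases hgj.eq_or_lt with rfl | hgj
      · rw [Function.update_self]
        rcases hj.eq_or_lt with rfl | hj
        · rwa [Function.update_self]
        · rw [Function.update_of_ne (by omega)]
          exact hki i hi hj
      · rw [Function.update_of_ne (by omega), Function.update_of_ne (by omega)]
        exact (h i hi j hj hgj).1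

/-- After all `d` rows are eliminated, only index `d` is left, with its single option `2 * d`. -/
theorem elims_iff (R : ℕ → ℕ → Prop) (d : ℕ) :
    elims R d (2 * d) (2 * d) ↔ HasChoice R d 0 := by
  have h : ∀ g ≤ d, HasChoice R d 0 ↔ HasChoice (elims R g) d g := by
    intro g
    induction g with
    | zero => intro _; rfl
    | succ g ih => intro hg; rw [ih (by omega), hasChoice_elim hg]; rfl
  rw [h d le_rfl]
  constructor
  · intro h
    refine ⟨fun _ => 0, fun _ => Nat.two_pos, rfl, fun i hi j hj hd => ?_⟩
    rw [show j = d by omega, show i = d by omega]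
    exact h
  · rintro ⟨c, -, hc, h⟩
    simpa [hc] using h d le_rfl d le_rfl le_rfl

variable {V : Type*} {H : Hypergraph V} {L : Listing H}

theorem mem_incident {tab : ℕ → ℕ → ℕ} {v k e : ℕ} :
    e ∈ incident tab v k ↔ e < k ∧ InRow tab e v := by
  simp [incident]

theorem optionOf_last (m : ℕ) (tab : ℕ → ℕ → ℕ) (v : ℕ) :
    optionOf m tab v (2 * (incident tab v m).length) = v := by
  rw [optionOf, if_pos rfl]

theorem optionOf_of_lt {m : ℕ} {tab : ℕ → ℕ → ℕ} {v i k : ℕ} (hi : i < (incident tab v m).length)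
    (hk : k < 2) : optionOf m tab v (2 * i + k) = other tab v (incident tab v m)[i] k := by
  rw [optionOf, if_neg (by omega), show (2 * i + k) / 2 = i by omega,
    show (2 * i + k) % 2 = k by omega, List.getD_eq_getElem _ _ hi]

theorem hasCliqueAt_iff (v : Fin L.n) : HasCliqueAt H (L.vert v) ↔
    ∃ C : Set (Fin L.n), (∀ x ∈ C, ∀ y ∈ C, x = y ∨ (coGraph (dual H)).Adj (L.vert x) (L.vert y)) ∧
      v ∈ C ∧ ∀ j < L.m, v ∈ L.row j → ∃ u ∈ C, u ∈ L.row j ∧ u ≠ v := by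
  constructor
  · rintro ⟨C, hC, hv, h⟩
    refine ⟨L.vert ⁻¹' C, ?_, hv, fun j hj hvj => ?_⟩
    · intro x hx y hy
      by_cases hxy : x = y
      · exact Or.inl hxy
      · exact Or.inr (hC hx hy (L.vert.injective.ne hxy))
    · obtain ⟨u, ⟨huC, hu⟩, huv⟩ := Set.exists_ne_of_one_lt_ncard
        (h _ (mem_edgeSet_iff.2 ⟨j, hj, rfl⟩) (vert_mem_toSet.2 hvj)) (L.vert v)
      obtain ⟨u, rfl⟩ := L.vert.surjective u
      exact ⟨u, huC, vert_mem_toSet.1 hu, fun h => huv (h ▸ rfl)⟩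
  · rintro ⟨C, hC, hv, h⟩
    refine ⟨L.vert '' C, ?_, Set.mem_image_of_mem _ hv, ?_⟩
    · rintro _ ⟨x, hx, rfl⟩ _ ⟨y, hy, rfl⟩ hxy
      exact (hC x hx y hy).resolve_left fun h => hxy (h ▸ rfl)
    · intro e he hve
      obtain ⟨j, hj, rfl⟩ := (mem_edgeSet_iff (L := L)).1 he
      obtain ⟨u, huC, hu, huv⟩ := h j hj (vert_mem_toSet.1 hve)
      exact (Set.one_lt_ncard).2 ⟨L.vert u, ⟨Set.mem_image_of_mem _ huC, vert_mem_toSet.2 hu⟩,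
        L.vert v, ⟨Set.mem_image_of_mem _ hv, hve⟩, L.vert.injective.ne huv⟩

/-- A compatible choice, together with `v`, is a clique with a second vertex in each hyperedge
through `v`; conversely, each such hyperedge has an option in the clique. -/
theorem solvable_iff [Finite V] (hH : Covered H) (hdim : dim H ≤ 3) (v : Fin L.n) :
    Solvable L.m L.tab (EqOrAdj L.n L.m L.tab) v ↔ HasCliqueAt H (L.vert v) := by
  rw [Solvable, elims_iff, hasCliqueAt_iff]
  have hR : ∀ {x y : Fin L.n}, EqOrAdj L.n L.m L.tab x y ↔
      x = y ∨ (coGraph (dual H)).Adj (L.vert x) (L.vert y) := eqOrAdj_iff hH hdim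
  have hlast := optionOf_last L.m L.tab v
  have hopt := @optionOf_of_lt L.m L.tab v
  have hmem : ∀ e, e ∈ incident L.tab v L.m ↔ e < L.m ∧ v ∈ L.row e := by
    intro e; rw [mem_incident, inRow_iff hdim]
  have hother : ∀ {e : ℕ} {x : Fin L.n}, e ∈ incident L.tab v L.m →
      (((x : ℕ) = other L.tab v e 0 ∨ (x : ℕ) = other L.tab v e 1) ↔ x ∈ L.row e ∧ x ≠ v) := by
    intro e x he
    rw [eq_other_iff (mem_incident.1 he).2 v.2 x.2, inRow_iff hdim, ne_eq, ne_eq, Fin.val_inj]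
  generalize optionOf L.m L.tab v = opt at *
  generalize incident L.tab v L.m = l at *
  constructor
  · rintro ⟨c, hc, hcd, h⟩
    -- The index `i = l.length` contributes `v` itself.
    refine ⟨{x | ∃ i ≤ l.length, (x : ℕ) = opt (2 * i + c i)}, ?_, ?_, ?_⟩
    · rintro x ⟨i, hi, hx⟩ y ⟨j, hj, hy⟩
      rcases le_total j i with hij | hij
      · have := h i hi j hij (Nat.zero_le _)
        rw [Compat, ← hx, ← hy] at this
        exact hR.1 this
      · have := h j hj i hij (Nat.zero_le _)
        rw [Compat, ← hx, ← hy] at this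
        exact (hR.1 this).imp Eq.symm SimpleGraph.Adj.symm
    · exact ⟨l.length, le_rfl, by rw [hcd, add_zero, hlast]⟩
    · intro j hj hvj
      obtain ⟨i, hi, rfl⟩ := List.getElem_of_mem ((hmem j).2 ⟨hj, hvj⟩)
      -- The chosen option is compatible with itself, so it is a vertex and not the padding value.
      have hlt := (lt_of_eqOrAdj (h i hi.le i le_rfl (Nat.zero_le _))).1
      refine ⟨⟨opt (2 * i + c i), hlt⟩, ⟨i, hi.le, rfl⟩, (hother (List.getElem_mem hi)).1 ?_⟩
      have := hc i
      simp only [hopt hi this]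
      interval_cases c i
      exacts [Or.inl rfl, Or.inr rfl]
  · rintro ⟨C, hC, hv, h⟩
    -- Each row picks an option lying in `C`; index `l.length` picks `v`, and larger indices are
    -- irrelevant.
    have hex : ∀ i, ∃ k < 2, (i = l.length → k = 0) ∧
        (i ≤ l.length → ∃ u ∈ C, opt (2 * i + k) = (u : ℕ)) := by
      intro i
      by_cases hi : i < l.length
      · have hmi := List.getElem_mem hi
        obtain ⟨u, huC, hu⟩ := h l[i] ((hmem _).1 hmi).1 ((hmem _).1 hmi).2
        rcases (hother hmi).2 hu with hu | hu
        · exact ⟨0, by omega, fun _ => rfl, fun _ => ⟨u, huC, by rw [hopt hi (by omega), hu]⟩⟩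
        · exact ⟨1, by omega, fun h => absurd h hi.ne,
            fun _ => ⟨u, huC, by rw [hopt hi (by omega), hu]⟩⟩
      · exact ⟨0, by omega, fun _ => rfl, fun hi' => ⟨v, hv, by
          rw [show i = l.length by omega, add_zero, hlast]⟩⟩
    choose c hc hcd hcu using hex
    refine ⟨c, hc, hcd _ rfl, fun i hi j hj _ => ?_⟩
    obtain ⟨u, hu, hu'⟩ := hcu i hi
    obtain ⟨w, hw, hw'⟩ := hcu j (by omega)
    rw [Compat, hu', hw']
    exact hR.2 (hC u hu w hw)

/-- The condition tested by the search of cliques. -/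
theorem avoids_iff [Finite V] [Nonempty V] (hH : Covered H) (hdim : dim H ≤ 3) :
    (∃ e < L.m, ∃ x < L.n, ∃ y < L.n, ∃ z < L.n,
      Avoids L.tab (EqOrAdj L.n L.m L.tab) e x y z) ↔
    ∃ C : Set V, Maximal (coGraph (dual H)).IsClique C ∧ ¬ IsTransversal H C := by
  have hR : ∀ {x y : Fin L.n}, EqOrAdj L.n L.m L.tab x y ↔
      x = y ∨ (coGraph (dual H)).Adj (L.vert x) (L.vert y) := eqOrAdj_iff hH hdim
  rw [exists_maximal_clique_not_transversal_iff hH, exists_edge_iff (L := L)]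
  refine exists_congr fun e => and_congr_right fun he => ?_
  constructor
  · rintro ⟨x, hx, y, hy, z, hz, ⟨hxy, hxz, hyz⟩, hxe, hye, hze⟩
    lift x to Fin L.n using hx
    lift y to Fin L.n using hy
    lift z to Fin L.n using hz
    rw [hR] at hxy hxz hyz
    refine ⟨{L.vert x, L.vert y, L.vert z}, ?_, ?_⟩
    · have key : ∀ {a b : Fin L.n}, a = b ∨ (coGraph (dual H)).Adj (L.vert a) (L.vert b) →
          L.vert a ≠ L.vert b → (coGraph (dual H)).Adj (L.vert a) (L.vert b) :=
        fun h hne => h.resolve_left fun h => hne (h ▸ rfl)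
      rintro a (rfl | rfl | rfl) b (rfl | rfl | rfl) hab
      · exact absurd rfl hab
      · exact key hxy hab
      · exact key hxz hab
      · exact (key hxy hab.symm).symm
      · exact absurd rfl hab
      · exact key hyz hab
      · exact (key hxz hab.symm).symm
      · exact (key hyz hab.symm).symm
      · exact absurd rfl hab
    · intro a ha
      obtain ⟨a, rfl⟩ := L.vert.surjective a
      rcases (inRow_iff hdim).2 (vert_mem_toSet.1 ha) with h | h | h
      · refine ⟨L.vert x, by simp, fun h' => hxe ?_⟩
        rw [← h, hR]; simpa using h'
      · refine ⟨L.vert y, by simp, fun h' => hye ?_⟩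
        rw [← h, hR]; simpa using h'
      · refine ⟨L.vert z, by simp, fun h' => hze ?_⟩
        rw [← h, hR]; simpa using h'
  · rintro ⟨C, hC, h⟩
    -- An empty clique can serve only an empty hyperedge, and then any single vertex serves as well.
    -- A member `x₀` is needed as blocker for padded entries.
    obtain ⟨C, hC, ⟨x₀, hx₀⟩, h⟩ : ∃ C : Set V, (coGraph (dual H)).IsClique C ∧ C.Nonempty ∧
        ∀ a ∈ L.toSet (L.row e), ∃ x ∈ C, ¬ (x = a ∨ (coGraph (dual H)).Adj x a) := by
      rcases C.eq_empty_or_nonempty with rfl | hne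
      · obtain ⟨v⟩ := ‹Nonempty V›
        refine ⟨{v}, by simp, Set.singleton_nonempty v, fun a ha => ?_⟩
        obtain ⟨x, hx, -⟩ := h a ha
        exact hx.elim
      · exact ⟨C, hC, hne, h⟩
    obtain ⟨x₀, rfl⟩ := L.vert.surjective x₀
    have key : ∀ i, ∃ x : Fin L.n, L.vert x ∈ C ∧ ¬ EqOrAdj L.n L.m L.tab x (L.tab e i) := by
      intro i
      rcases tab_lt_or_eq (L := L) e i with ⟨a, ha, hai⟩ | hn
      · obtain ⟨x, hx, hxa⟩ := h (L.vert a) (vert_mem_toSet.2 ha)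
        obtain ⟨x, rfl⟩ := L.vert.surjective x
        refine ⟨x, hx, ?_⟩
        rw [hai, hR]
        simpa using hxa
      · refine ⟨x₀, hx₀, fun h => ?_⟩
        have := (lt_of_eqOrAdj h).2
        omega
    have hCR : ∀ {a b : Fin L.n}, L.vert a ∈ C → L.vert b ∈ C →
        EqOrAdj L.n L.m L.tab a b := by
      intro a b ha hb
      rw [hR]
      by_cases hab : a = b
      · exact Or.inl hab
      · exact Or.inr (hC ha hb (L.vert.injective.ne hab))
    obtain ⟨x, hx, hx'⟩ := key 0
    obtain ⟨y, hy, hy'⟩ := key 1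
    obtain ⟨z, hz, hz'⟩ := key 2
    exact ⟨x, x.2, y, y.2, z, z.2, ⟨hCR hx hy, hCR hx hz, hCR hy hz⟩, hx', hy', hz'⟩

end Correctness

/-! ## The formulas written by the program -/

section Formulas

variable {V : Type*} {H : Hypergraph V} (L : Listing H)

/-- The variables `x`, `y` are equal or adjacent vertices. -/
abbrev Listing.Rel : ℕ → ℕ → Prop := EqOrAdj L.n L.m L.tab

open Classical in
/-- The clauses that exclude two nonadjacent neighbours of `v`. -/
noncomputable def Listing.conflictClauses (v : Fin L.n) : List (List (Fin L.n × Bool)) :=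
  (List.finRange L.n).flatMap fun u : Fin L.n => (List.finRange L.n).flatMap fun w : Fin L.n =>
    if (L.Rel v u ∧ ¬ (v : ℕ) = u) ∧ (L.Rel v w ∧ ¬ (v : ℕ) = w) ∧ ¬ L.Rel u w then
      [[(u, false), (w, false)]] else []

open Classical in
/-- The clause for the hyperedge `l` through `v`. -/
noncomputable def Listing.edgeClause (v : Fin L.n) (l : List (Fin L.n)) :
    List (Fin L.n × Bool) :=
  (l.filter fun u : Fin L.n => L.Rel v u ∧ ¬ (v : ℕ) = u).map fun u => (u, true)

open Classical in
/-- The clauses for the hyperedges through `v`. -/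
noncomputable def Listing.edgeClauses (v : Fin L.n) : List (List (Fin L.n × Bool)) :=
  (L.edges.filter fun l => v ∈ l).map (L.edgeClause v)

/-- The formula of `v`. -/
noncomputable def Listing.formula (v : Fin L.n) : List (List (Fin L.n × Bool)) :=
  L.conflictClauses v ++ L.edgeClauses v

variable {L}

theorem flatMap_range {α : Type*} {n : ℕ} (f : ℕ → List α) :
    (List.range n).flatMap f = (List.finRange n).flatMap fun i : Fin n => f (i : ℕ) := by
  rw [← List.map_coe_finRange_eq_range, List.flatMap_map]

theorem conflictCode_eq (v : Fin L.n) : conflictCode L.n L.Rel v =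
    (L.conflictClauses v).flatMap fun c => c.map encodeLiteral ++ [0] := by
  classical
  simp only [conflictCode, Listing.conflictClauses, flatMap_range, List.flatMap_assoc]
  congr 1; funext u; congr 1; funext w
  split_ifs <;> simp [encodeLiteral]

theorem Listing.map_row_range : (List.range L.m).map L.row = L.edges := by
  refine List.ext_getElem (by simp [Listing.m]) fun i h1 h2 => ?_
  simp [Listing.row, h2]

theorem flatMap_ite_eq {α β : Type*} (p : α → Prop) [DecidablePred p] (f : α → List β)
    (l : List α) : (l.flatMap fun x => if p x then f x else []) = (l.filter p).flatMap f := by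
  induction l with
  | nil => rfl
  | cons a t ih => by_cases h : p a <;> simp [h, ih]

/-- The program looks at three fixed positions, the formula at the list itself; they agree because
`R v n` fails and padding emits nothing. -/
theorem filter_map_encodeLiteral {R : ℕ → ℕ → Prop} {v n : ℕ} (hR : ¬ R v n) {l : List (Fin n)}
    (h3 : l.length ≤ 3) [DecidablePred fun u : Fin n => R v u ∧ ¬ v = u] {a : ℕ → List ℕ}
    (ha : ∀ i < 3, a i = open Classical in
      if R v ((l.map Fin.val).getD i n) ∧ ¬ v = (l.map Fin.val).getD i n then
      [2 * (l.map Fin.val).getD i n + 2] else []) :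
    a 0 ++ a 1 ++ a 2 =
      ((l.filter fun u : Fin n => R v u ∧ ¬ v = u).map fun u => (u, true)).map encodeLiteral := by
  rw [ha 0 (by omega), ha 1 (by omega), ha 2 (by omega)]
  match l, h3 with
  | [], _ => simp [hR]
  | [a], _ => by_cases h : R v a ∧ ¬ v = a <;> simp [hR, h, encodeLiteral]
  | [a, b], _ =>
    by_cases h : R v a ∧ ¬ v = a <;> by_cases h' : R v b ∧ ¬ v = b <;>
      simp [hR, h, h', encodeLiteral]
  | [a, b, c], _ =>
    by_cases h : R v a ∧ ¬ v = a <;> by_cases h' : R v b ∧ ¬ v = b <;>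
      by_cases h'' : R v c ∧ ¬ v = c <;> simp [h, h', h'', encodeLiteral]

theorem rowCode_eq [Finite V] (hdim : dim H ≤ 3) (v : Fin L.n) :
    (List.range L.m).flatMap (rowCode L.tab L.Rel v) =
      (L.edgeClauses v).flatMap fun c => c.map encodeLiteral ++ [0] := by
  classical
  have hR : ¬ L.Rel v L.n := fun h => absurd (lt_of_eqOrAdj h).2 (lt_irrefl _)
  have h : ∀ j, rowCode L.tab L.Rel v j =
      if v ∈ L.row j then (L.edgeClause v (L.row j)).map encodeLiteral ++ [0] else [] := by
    intro j
    rw [rowCode]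
    by_cases hv : v ∈ L.row j
    · rw [if_pos hv, if_pos ((inRow_iff hdim).2 hv)]
      congr 1
      rw [Listing.edgeClause]
      refine filter_map_encodeLiteral (R := L.Rel) hR (length_row_le hdim j) fun i hi => ?_
      rw [literalCode, Listing.tab_eq]
    · rw [if_neg hv, if_neg (mt (inRow_iff hdim).1 hv)]
  have h1 : (List.range L.m).flatMap (rowCode L.tab L.Rel v) = L.edges.flatMap fun l =>
      if v ∈ l then (L.edgeClause v l).map encodeLiteral ++ [0] else [] := by
    rw [← Listing.map_row_range, List.flatMap_map]
    congr 1
    funext j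
    exact h j
  rw [h1, flatMap_ite_eq, Listing.edgeClauses, List.flatMap_map]

theorem vertexCode_eq [Finite V] (hdim : dim H ≤ 3) (v : Fin L.n) :
    vertexCode L.n L.m L.tab L.Rel v =
      encodeFormula (L.formula v) ++ [ind (Solvable L.m L.tab L.Rel v)] := by
  rw [vertexCode, conflictCode_eq, rowCode_eq hdim, encodeFormula, Listing.formula,
    List.flatMap_append]

theorem length_le_two_of_mem_formula [Finite V] (hdim : dim H ≤ 3) (v : Fin L.n) :
    ∀ c ∈ L.formula v, c.length ≤ 2 := by
  classical
  intro c hc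
  rcases List.mem_append.1 hc with hc | hc
  · simp only [Listing.conflictClauses, List.mem_flatMap] at hc
    obtain ⟨u, -, w, -, hc⟩ := hc
    split_ifs at hc
    · rw [List.mem_singleton] at hc; simp [hc]
    · simp at hc
  · simp only [Listing.edgeClauses, List.mem_map, List.mem_filter, decide_eq_true_eq] at hc
    obtain ⟨l, ⟨hl, hv⟩, rfl⟩ := hc
    rw [Listing.edgeClause, List.length_map]
    have h1 := length_le_of_dim_le hdim l hl
    -- The filter drops at least `v`, so a list of at most three vertices leaves at most two
    -- literals.
    refine Nat.le_of_lt_succ (lt_of_lt_of_le (List.length_filter_lt_length_iff_exists.2 ?_) h1)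
    exact ⟨v, hv, by simp⟩

theorem length_flatMap_le {α β : Type*} {f : α → List β} {k : ℕ} (h : ∀ a, (f a).length ≤ k)
    (l : List α) : (l.flatMap f).length ≤ l.length * k := by
  induction l with
  | nil => simp
  | cons a t ih =>
    have := h a
    rw [List.flatMap_cons, List.length_append, List.length_cons, add_mul]
    omega

theorem length_formula_le [Finite V] (v : Fin L.n) :
    (L.formula v).length ≤ Nat.card V ^ 2 + maxDegree H := by
  classical
  rw [Listing.formula, List.length_append, Listing.card_eq (L := L)]
  refine Nat.add_le_add ?_ ?_
  · have := length_flatMap_le (k := L.n) (f := fun u : Fin L.n => (List.finRange L.n).flatMap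
      fun w : Fin L.n => if (L.Rel v u ∧ ¬ (v : ℕ) = u) ∧ (L.Rel v w ∧ ¬ (v : ℕ) = w) ∧ ¬ L.Rel u w then
      [[(u, false), (w, false)]] else []) (fun u => by
        have := length_flatMap_le (k := 1) (f := fun w : Fin L.n =>
          if (L.Rel v u ∧ ¬ (v : ℕ) = u) ∧ (L.Rel v w ∧ ¬ (v : ℕ) = w) ∧ ¬ L.Rel u w then
          [[(u, false), (w, false)]] else []) (fun w => by split_ifs <;> simp) (List.finRange L.n)
        simpa using this) (List.finRange L.n)
    rw [List.length_finRange, ← pow_two] at this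
    exact this
  · rw [Listing.edgeClauses, List.length_map]
    exact (length_filter_le_degree v).trans (degree_le_maxDegree _)

theorem length_incident [Finite V] (hdim : dim H ≤ 3) (v : Fin L.n) :
    (incident L.tab v L.m).length ≤ maxDegree H := by
  classical
  refine le_trans (le_of_eq ?_) ((length_filter_le_degree v).trans (degree_le_maxDegree _))
  rw [incident, ← Listing.map_row_range, List.filter_map, List.length_map]
  congr 1
  refine List.filter_congr fun j _ => ?_
  simp [inRow_iff hdim]

theorem listsFormula_formula [Finite V] (hH : Covered H) (hdim : dim H ≤ 3) (v : Fin L.n) :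
    ListsFormula L.vert (L.formula v) (vertexFormula H (L.vert v)) := by
  classical
  have hR : ∀ {x y : Fin L.n}, L.Rel x y ↔
      x = y ∨ (coGraph (dual H)).Adj (L.vert x) (L.vert y) := eqOrAdj_iff hH hdim
  have hN : ∀ {x y : Fin L.n}, L.Rel x y ∧ ¬ (x : ℕ) = y ↔
      (coGraph (dual H)).Adj (L.vert x) (L.vert y) := by
    intro x y
    rw [hR, Fin.val_inj]
    constructor
    · rintro ⟨h | h, h'⟩
      exacts [absurd h h', h]
    · exact fun h => ⟨Or.inr h, fun h' => h.ne (h' ▸ rfl)⟩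
  have hset : ∀ l, {v | ∃ i ∈ l, L.vert i = v} = L.toSet l := fun _ => rfl
  have hedge : ∀ l : List (Fin L.n), {x | ∃ y ∈ L.edgeClause v l, x = (L.vert y.1, y.2)} =
      {x : V × Bool | x.2 = true ∧ x.1 ∈ L.toSet l ∧ (coGraph (dual H)).Adj (L.vert v) x.1} := by
    intro l
    ext ⟨x, b⟩
    obtain ⟨x, rfl⟩ := L.vert.surjective x
    constructor
    · rintro ⟨⟨y, b'⟩, hy, heq⟩
      simp only [Listing.edgeClause, List.mem_map, List.mem_filter, decide_eq_true_eq] at hy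
      obtain ⟨u, ⟨hu, hvu⟩, hy⟩ := hy
      simp only [Prod.mk.injEq] at hy heq
      obtain ⟨rfl, rfl⟩ := hy
      obtain ⟨hx, rfl⟩ := heq
      obtain rfl := L.vert.injective hx
      exact ⟨rfl, vert_mem_toSet.2 hu, hN.1 hvu⟩
    · rintro ⟨rfl, hx, hvx⟩
      refine ⟨(x, true), ?_, rfl⟩
      simp only [Listing.edgeClause, List.mem_map, List.mem_filter, decide_eq_true_eq]
      exact ⟨x, ⟨vert_mem_toSet.1 hx, hN.2 hvx⟩, rfl⟩
  have hconf : ∀ u w : Fin L.n, {x | ∃ y ∈ [(u, false), (w, false)], x = (L.vert y.1, y.2)} =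
      ({(L.vert u, false), (L.vert w, false)} : Set (V × Bool)) := by
    intro u w
    ext x
    constructor
    · rintro ⟨y, hy, rfl⟩
      simp only [List.mem_cons, List.not_mem_nil, or_false] at hy
      rcases hy with rfl | rfl
      exacts [Or.inl rfl, Or.inr rfl]
    · rintro (rfl | rfl)
      exacts [⟨(u, false), by simp, rfl⟩, ⟨(w, false), by simp, rfl⟩]
  ext c
  constructor
  · rintro ⟨d, hd, rfl⟩
    rcases List.mem_append.1 hd with hd | hd
    · simp only [Listing.conflictClauses, List.mem_flatMap] at hd
      obtain ⟨u, -, w, -, hd⟩ := hd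
      split_ifs at hd with hcond
      · rw [List.mem_singleton] at hd
        subst hd
        obtain ⟨h1, h2, h3⟩ := hcond
        rw [hN] at h1 h2
        rw [hR, not_or] at h3
        exact Or.inl ⟨L.vert u, L.vert w, h1, h2, L.vert.injective.ne h3.1, h3.2, hconf u w⟩
      · simp at hd
    · simp only [Listing.edgeClauses, List.mem_map, List.mem_filter, decide_eq_true_eq] at hd
      obtain ⟨l, ⟨hl, hv⟩, rfl⟩ := hd
      exact Or.inr ⟨L.toSet l, (L.complete _).2 ⟨l, hl, rfl⟩, vert_mem_toSet.2 hv, hedge l⟩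
  · rintro (⟨u, w, hu, hw, huw, hnadj, rfl⟩ | ⟨e, he, hv, rfl⟩)
    · obtain ⟨u, rfl⟩ := L.vert.surjective u
      obtain ⟨w, rfl⟩ := L.vert.surjective w
      refine ⟨[(u, false), (w, false)], List.mem_append_left _ ?_, (hconf u w).symm⟩
      simp only [Listing.conflictClauses, List.mem_flatMap]
      refine ⟨u, List.mem_finRange u, w, List.mem_finRange w, ?_⟩
      have hR' : ¬ L.Rel u w := by
        rw [hR, not_or]
        exact ⟨fun h => huw (h ▸ rfl), hnadj⟩
      rw [if_pos ⟨hN.2 hu, hN.2 hw, hR'⟩]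
      exact List.mem_singleton_self _
    · obtain ⟨l, hl, rfl⟩ := (L.complete e).1 he
      rw [hset] at hv ⊢
      refine ⟨L.edgeClause v l, List.mem_append_right _ ?_, (hedge l).symm⟩
      simp only [Listing.edgeClauses, List.mem_map, List.mem_filter, decide_eq_true_eq]
      exact ⟨l, ⟨hl, vert_mem_toSet.1 hv⟩, rfl⟩

end Formulas

/-! ## The running time -/

section Time

variable {n m d : ℕ}

/-- The costs are `m^3` for the adjacency matrix and `n * (n^2 + m + d^3)` for the vertices. The
term `m^3` uses `m ≤ 2 * (n * d)`, and `n * d^3` uses `d ≤ m`. -/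
theorem setupTime_add_le (hn : 1 ≤ n) (hm : 1 ≤ m) (hd : 1 ≤ d) (hmd : m ≤ 2 * (n * d)) (hdm : d ≤ m) :
    setupTime n m + (2 + n * (vertexTime n m d + 2)) ≤ 2000 * (m * n ^ 2 * d ^ 2 + n ^ 3) := by
  have h0 : m ≤ m * n ^ 2 * d ^ 2 := by
    rw [mul_assoc]
    exact Nat.le_mul_of_pos_right _ (by positivity)
  have h1 : 1 ≤ m * n ^ 2 * d ^ 2 := hm.trans h0
  have h2 : n * m ≤ m * n ^ 2 * d ^ 2 := by
    calc n * m = m * n ^ 1 * 1 := by ring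
      _ ≤ m * n ^ 2 * d ^ 2 := by gcongr <;> first | omega | exact Nat.one_le_pow _ _ hd
  have h3 : m ^ 2 ≤ 2 * (m * n ^ 2 * d ^ 2) := by
    calc m ^ 2 = m * m := by ring
      _ ≤ m * (2 * (n ^ 1 * d ^ 1)) := by simpa using Nat.mul_le_mul_left m hmd
      _ ≤ m * (2 * (n ^ 2 * d ^ 2)) := by gcongr <;> omega
      _ = _ := by ring
  -- One factor `m` is kept and the other two are replaced by `2 * (n * d)`.
  have h4 : m ^ 3 ≤ 4 * (m * n ^ 2 * d ^ 2) := by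
    calc m ^ 3 = m * m ^ 2 := by ring
      _ ≤ m * (2 * (n * d)) ^ 2 := by gcongr
      _ = _ := by ring
  have h5 : n * d ^ 3 ≤ m * n ^ 2 * d ^ 2 := by
    calc n * d ^ 3 = d * n ^ 1 * d ^ 2 := by ring
      _ ≤ m * n ^ 2 * d ^ 2 := by gcongr; omega
  have h6 : n * d ^ 2 ≤ m * n ^ 2 * d ^ 2 := by
    calc n * d ^ 2 = 1 * n ^ 1 * d ^ 2 := by ring
      _ ≤ m * n ^ 2 * d ^ 2 := by gcongr; omega
  have h7 : n * d ≤ m * n ^ 2 * d ^ 2 := by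
    calc n * d = 1 * n ^ 1 * d ^ 1 := by ring
      _ ≤ m * n ^ 2 * d ^ 2 := by gcongr <;> omega
  have h8 : n ≤ n ^ 3 := Nat.le_self_pow (by omega) n
  have h9 : n ^ 2 ≤ n ^ 3 := Nat.pow_le_pow_right hn (by omega)
  unfold setupTime vertexTime solveTime
  ring_nf at *
  omega

theorem cliqueTime_add_le (hn : 1 ≤ n) (hm : 1 ≤ m) :
    cliqueTime n m + 1 ≤ 100 * (m * n ^ 3) := by
  have h1 : m * 1 ≤ m * n ^ 3 := Nat.mul_le_mul_left m (Nat.one_le_pow _ _ hn)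
  have h2 : m * n ≤ m * n ^ 3 := Nat.mul_le_mul_left m (Nat.le_self_pow (by omega) n)
  have h3 : m * n ^ 2 ≤ m * n ^ 3 :=
    Nat.mul_le_mul_left m (Nat.pow_le_pow_right hn (by omega))
  unfold cliqueTime
  ring_nf at *
  omega

end Time

/-! ## The programs on the input word -/

section Programs

variable {V : Type*} [Finite V] {H : Hypergraph V} (L : Listing H)

theorem Listing.n_pos [Nonempty V] : 1 ≤ L.n := by
  rw [← Listing.card_eq (L := L)]
  exact Nat.card_pos

theorem Listing.length_incident_le (hdim : dim H ≤ 3) :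
    ∀ v < L.n, (incident L.tab v L.m).length ≤ maxDegree H :=
  fun v hv => length_incident hdim ⟨v, hv⟩

/-- The factor 2 absorbs a possible empty hyperedge, since `n * Δ ≥ 1`. -/
theorem Listing.bounds [Nonempty V] (hH : Covered H) : 1 ≤ L.m ∧ 1 ≤ maxDegree H ∧ maxDegree H ≤ L.m ∧
    L.m ≤ 2 * (L.n * maxDegree H) := by
  have h1 := maxDegree_pos hH
  have h2 := maxDegree_le (H := H)
  have h3 := ncard_edgeSet_le (H := H)
  rw [Listing.ncard_edgeSet (L := L)] at h2 h3
  rw [Listing.card_eq (L := L)] at h3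
  have h4 := Nat.mul_le_mul L.n_pos h1
  exact ⟨h1.trans h2, h1, h2, by omega⟩

/-- `n, m ≥ 1` gives `N ≥ 4`, hence `N^3 ≥ 16 * N`, which leaves room for the small constants and
for `4 * m + 2`. -/
theorem Listing.word_bounds [Nonempty V] (hH : Covered H) : 10 ≤ L.input.length ^ 3 ∧
    L.n ≤ L.input.length ^ 3 ∧ 4 * L.lists.length + 2 ≤ L.input.length ^ 3 := by
  have h := le_length_input (L := L) hH
  have h1 := L.n_pos
  have h2 := (L.bounds hH).1
  have h3 : 16 * L.input.length ≤ L.input.length ^ 3 := by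
    calc 16 * L.input.length = 4 ^ 2 * L.input.length := by norm_num
      _ ≤ L.input.length ^ 2 * L.input.length := by gcongr; omega
      _ = _ := by ring
  rw [Listing.length_lists]
  omega

theorem Listing.testProgram_ter [Nonempty V] (hH : Covered H) (hdim : dim H ≤ 3) :
    Ter (L.input.length ^ 3) testProgram (State.init L.input)
      (2000 * (H.edgeSet.ncard * Nat.card V ^ 2 * maxDegree H ^ 2 + Nat.card V ^ 3)) fun s =>
        s.reg 0 = ind (∃ v < L.n, Solvable L.m L.tab L.Rel v) ∧
        s.out = (List.range L.n).flatMap (vertexCode L.n L.m L.tab L.Rel) := by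
  obtain ⟨hm, hd, hdm, hmd⟩ := L.bounds hH
  obtain ⟨hY, hnY, hmY⟩ := L.word_bounds hH
  rw [L.input_eq] at hY hnY hmY ⊢
  rw [Listing.ncard_edgeSet (L := L), Listing.card_eq (L := L)]
  refine (DualConf.testProgram_ter L.lists_lt (length_lists_le hdim) hY hnY hmY rfl
    L.length_lists.symm rfl (L.length_incident_le hdim)).mono
      (setupTime_add_le L.n_pos hm hd hmd hdm) ?_
  exact fun s _ _ hs => ⟨hs.2.1, hs.2.2.1⟩

theorem Listing.conformalProgram_ter [Nonempty V] (hH : Covered H) (hdim : dim H ≤ 3) :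
    Ter (L.input.length ^ 3) conformalProgram (State.init L.input)
      (2100 * (H.edgeSet.ncard * Nat.card V ^ 2 * maxDegree H ^ 2 +
        H.edgeSet.ncard * Nat.card V ^ 3)) fun s =>
        s.reg 0 = ind (¬ ((∃ v < L.n, Solvable L.m L.tab L.Rel v) ∨
          ∃ e < L.m, ∃ x < L.n, ∃ y < L.n, ∃ z < L.n, Avoids L.tab L.Rel e x y z)) := by
  obtain ⟨hm, hd, hdm, hmd⟩ := L.bounds hH
  obtain ⟨hY, hnY, hmY⟩ := L.word_bounds hH
  rw [L.input_eq] at hY hnY hmY ⊢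
  rw [Listing.ncard_edgeSet (L := L), Listing.card_eq (L := L)]
  refine (DualConf.conformalProgram_ter L.lists_lt (length_lists_le hdim) hY hnY hmY rfl
    L.length_lists.symm rfl (L.length_incident_le hdim)).mono ?_ fun s _ _ hs => hs
  have h1 := setupTime_add_le L.n_pos hm hd hmd hdm
  have h2 := cliqueTime_add_le L.n_pos hm
  have h3 : L.n ^ 3 ≤ L.m * L.n ^ 3 := Nat.le_mul_of_pos_left _ hm
  omega

variable {L}

theorem exists_solvable_iff (hH : Covered H) (hdim : dim H ≤ 3) :
    (∃ v < L.n, Solvable L.m L.tab L.Rel v) ↔ ∃ v, HasCliqueAt H v := by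
  rw [exists_vert_iff (L := L)]
  constructor
  · rintro ⟨v, hv, h⟩
    exact ⟨⟨v, hv⟩, (solvable_iff hH hdim ⟨v, hv⟩).1 h⟩
  · rintro ⟨v, h⟩
    exact ⟨v, v.2, (solvable_iff hH hdim v).2 h⟩

theorem duallyConformal_iff [Nonempty V] (hH : Covered H) (hdim : dim H ≤ 3) :
    ¬ ((∃ v < L.n, Solvable L.m L.tab L.Rel v) ∨
      ∃ e < L.m, ∃ x < L.n, ∃ y < L.n, ∃ z < L.n, Avoids L.tab L.Rel e x y z) ↔
    DuallyConformal H := by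
  rw [exists_solvable_iff hH hdim, avoids_iff hH hdim, or_comm,
    ← not_duallyConformal_iff_hasCliqueAt hH, not_not]

end Programs

theorem ind_eq_toNat {p : Prop} [Decidable p] : ind p = (decide p).toNat := by
  by_cases h : p <;> simp [ind, h]

theorem State.answers_of_reg_eq_ind {s : State} {p : Prop} (h : s.reg 0 = ind p) : s.Answers p :=
  ⟨fun hp => h.trans (ind_of hp), fun hp => h.trans (ind_not_of hp)⟩

end DualConf

theorem mainTheorem4 :
    -- the test, which writes down and solves one 2-SAT instance per vertex
    (∃ (P : DualConf.Cmd) (κ K : ℕ), ∀ (V : Type*) [Finite V] [Nonempty V] (H : Hypergraph V),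
      DualConf.Covered H → DualConf.dim H ≤ 3 → ∀ L : DualConf.Listing H,
        ∃ (t : ℕ) (s : DualConf.State) (φ : Fin L.n → List (List (Fin L.n × Bool)))
          (b : Fin L.n → Bool),
          DualConf.Exec (L.input.length ^ κ) P (DualConf.State.init L.input) t s ∧
          t ≤ K * (H.edgeSet.ncard * Nat.card V ^ 2 * DualConf.maxDegree H ^ 2
            + Nat.card V ^ 3) ∧
          s.Answers (∃ v : V, DualConf.HasCliqueAt H v) ∧
          s.out = (List.finRange L.n).flatMap
            (fun i => DualConf.encodeFormula (φ i) ++ [(b i).toNat]) ∧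
          ∀ i : Fin L.n,
            DualConf.ListsFormula L.vert (φ i) (DualConf.vertexFormula H (L.vert i)) ∧
            (∀ c ∈ φ i, c.length ≤ 2) ∧
            (φ i).length ≤ Nat.card V ^ 2 + DualConf.maxDegree H ∧
            (b i = true ↔ DualConf.Satisfiable (DualConf.vertexFormula H (L.vert i)))) ∧
    -- correctness of the 2-SAT instances, and what they mean for dual conformality
    (∀ (V : Type*) [Finite V] [Nonempty V] (H : Hypergraph V),
      DualConf.Covered H → DualConf.dim H ≤ 3 →
        (∀ v : V,
          (∀ c ∈ DualConf.vertexFormula H v, c.ncard ≤ 2) ∧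
          (DualConf.Satisfiable (DualConf.vertexFormula H v) ↔ DualConf.HasCliqueAt H v)) ∧
        (¬ DualConf.DuallyConformal H ↔
          (∃ C : Set V, Maximal (DualConf.coGraph (DualConf.dual H)).IsClique C ∧
            ¬ DualConf.IsTransversal H C) ∨
          ∃ v : V, DualConf.Satisfiable (DualConf.vertexFormula H v))) ∧
    -- the resulting algorithm for dual conformality
    (∃ (Q : DualConf.Cmd) (κ K : ℕ), ∀ (V : Type*) [Finite V] [Nonempty V] (H : Hypergraph V),
      DualConf.Covered H → DualConf.dim H ≤ 3 → ∀ L : DualConf.Listing H,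
        ∃ (t : ℕ) (s : DualConf.State),
          DualConf.Exec (L.input.length ^ κ) Q (DualConf.State.init L.input) t s ∧
          t ≤ K * (H.edgeSet.ncard * Nat.card V ^ 2 * DualConf.maxDegree H ^ 2
            + H.edgeSet.ncard * Nat.card V ^ 3) ∧
          s.Answers (DualConf.DuallyConformal H)) := by
  -- Registers and cells are bounded by `Y = N^3` and words by `Y ^ (exprBound + 1)`, which gives
  -- the exponent; `unitTime` converts the time units of `Ter` into machine steps.
  refine ⟨⟨DualConf.testProgram, 3 * (DualConf.exprBound + 1), DualConf.unitTime * 2000, ?_⟩, ?_,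
    ⟨DualConf.conformalProgram, 3 * (DualConf.exprBound + 1), DualConf.unitTime * 2100, ?_⟩⟩
  · intro V _ _ H hH hdim L
    classical
    obtain ⟨t, s, hexec, ht, -, h0, hout⟩ := L.testProgram_ter hH hdim
    refine ⟨t, s, L.formula, fun i => decide (DualConf.Solvable L.m L.tab L.Rel i), ?_, ?_, ?_, ?_,
      fun i => ⟨DualConf.listsFormula_formula hH hdim i,
        DualConf.length_le_two_of_mem_formula hdim i, DualConf.length_formula_le i, ?_⟩⟩
    · rw [pow_mul]; exact hexec
    · rw [mul_assoc]; exact ht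
    · exact DualConf.State.answers_of_reg_eq_ind
        (h0.trans (DualConf.ind_congr (DualConf.exists_solvable_iff hH hdim)))
    · rw [hout, DualConf.flatMap_range]
      congr 1
      funext i
      rw [DualConf.vertexCode_eq hdim, DualConf.ind_eq_toNat]
    · rw [decide_eq_true_iff, DualConf.solvable_iff hH hdim,
        DualConf.satisfiable_vertexFormula_iff]
  · intro V _ _ H hH hdim
    refine ⟨fun v => ⟨fun c hc => DualConf.ncard_clause_le hdim le_rfl hc,
      DualConf.satisfiable_vertexFormula_iff v⟩, ?_⟩
    simp only [DualConf.satisfiable_vertexFormula_iff]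
    exact DualConf.not_duallyConformal_iff_hasCliqueAt hH
  · intro V _ _ H hH hdim L
    obtain ⟨t, s, hexec, ht, -, h0⟩ := L.conformalProgram_ter hH hdim
    refine ⟨t, s, ?_, ?_, ?_⟩
    · rw [pow_mul]; exact hexec
    · rw [mul_assoc]; exact ht
    · exact DualConf.State.answers_of_reg_eq_ind
        (h0.trans (DualConf.ind_congr (DualConf.duallyConformal_iff hH hdim)))
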